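/- Let $G$ be a compact Lie group and $K\le G$ a closed subgroup, with Lie algebras $\mathfrak k\subset\mathfrak g$, and let $\mathfrak g=\mathfrak k\oplus\mathfrak p$ with $\mathfrak p$ an $\mathrm{Ad}(K)$-invariant complement, identified with the tangent space of $G/K$ at the base point. Assume that the isotropy representation splits as $\mathfrak p=\mathfrak p_1\oplus\mathfrak p_2$ into two inequivalent irreducible $\mathrm{Ad}(K)$-invariant summands, and that the isotropy is maximal, in the sense that no $\mathrm{Ad}(K)$-invariant Lie subalgebra $\mathfrak h$ satisfies $\mathfrak k\subsetneq\mathfrak h\subsetneq\mathfrak g$. Fix an $\mathrm{Ad}(K)$-invariant scalar product $Q$ on $\mathfrak p$, and for $x_1,x_2>0$ let $g=x_1\,Q|_{\mathfrak p_1}\oplus x_2\,Q|_{\mathfrak p_2}$ be the corresponding $G$-invariant Riemannian metric on $G/K$. A solution of the homogeneous Ricci flow on an interval $J\subseteq\mathbb R$ with more than one point is a pair of functions $x_1,x_2:J\to(0,\infty)$ such that $g(t)=x_1(t)\,Q|_{\mathfrak p_1}\oplus x_2(t)\,Q|_{\mathfrak p_2}$ satisfies $\partial_t g(t)=-2\,\mathrm{Ric}(g(t))$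 on $J$ (with one-sided derivatives at endpoints of $J$). Let $R(t)$ be the scalar curvature of $g(t)$. 1. For every solution of the homogeneous Ricci flow on such an interval $J$ and every $t\in J$ with $\dot x_1(t)<0$ and $\dot x_2(t)<0$ (both functions are decreasing), one has $R(t)>0$. 2. Let $(x_1,x_2)$ be a solution of the homogeneous Ricci flow defined on its maximal time interval $[0,T)$, $0<T\le\infty$ (it is not the restriction of a solution on a longer interval $[0,T')$). If $R(0)<0$, then the scalar curvature turns positive in finite time: there is a real $t_1$ with $0<t_1<T$ such that $R(t)>0$ for all $t\in[t_1,T)$. -/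

import Mathlib

open scoped Manifold ContDiff
open Set

noncomputable section

namespace HomRicci

/-! ### Curvature of invariant metrics on a reductive homogeneous space

`L` is the Lie algebra of `G`, `k` the isotropy algebra and `p` a complement of `k` in `L`, which is
identified with the tangent space of `G/K` at the base point. A `G`-invariant tensor on `G/K` is
identified with its value at the base point, i.e. with an invariant tensor on `p`. -/

section Curvature

variable {L : Type*} [LieRing L] [LieAlgebra ℝ L]
variable {k : LieSubalgebra ℝ L} {p : Submodule ℝ L}

/-- The `p`-component of an element of `L = k ⊕ p`. -/
def prP (hkp : IsCompl k.toSubmodule p) : L →ₗ[ℝ] p :=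
  p.projectionOnto k.toSubmodule hkp.symm

/-- The `k`-component of an element of `L = k ⊕ p`. -/
def prK (hkp : IsCompl k.toSubmodule p) : L →ₗ[ℝ] k.toSubmodule :=
  k.toSubmodule.projectionOnto p hkp

/-- The bilinear map `(X, Y) ↦ [X, Y]_p` on `p`. -/
def bracketP (hkp : IsCompl k.toSubmodule p) : p →ₗ[ℝ] p →ₗ[ℝ] p :=
  LinearMap.mk₂ ℝ (fun X Y => prP hkp ⁅(X : L), (Y : L)⁆)
    (by intros; simp) (by intros; simp) (by intros; simp) (by intros; simp)

/-- The map `(X, Y) ↦ (Z ↦ [[X, Y]_k, Z])`, the isotropy part of the curvature. -/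
def isotropyPart (hkp : IsCompl k.toSubmodule p) (X Y : p) : Module.End ℝ p :=
  prP hkp ∘ₗ (LieAlgebra.ad ℝ L (prK hkp ⁅(X : L), (Y : L)⁆ : L)) ∘ₗ p.subtype

/-- A scalar product: a symmetric, positive definite bilinear form. -/
structure IsScalarProduct {V : Type*} [AddCommGroup V] [Module ℝ V]
    (g : LinearMap.BilinForm ℝ V) : Prop where
  symm : ∀ X Y, g X Y = g Y X
  pos : ∀ X, X ≠ 0 → 0 < g X X

/-- `Λ X Y` stands for the Levi-Civita derivative `Λ(X) Y` at the base point (the Nomizu map of the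
Levi-Civita connection). It is characterised by being torsion free and metric. -/
structure IsLeviCivita (hkp : IsCompl k.toSubmodule p) (g : LinearMap.BilinForm ℝ p)
    (Λ : p →ₗ[ℝ] p →ₗ[ℝ] p) : Prop where
  torsion_free : ∀ X Y, Λ X Y - Λ Y X = bracketP hkp X Y
  metric : ∀ X Y Z, g (Λ X Y) Z + g Y (Λ X Z) = 0

open Classical in
/-- The Levi-Civita connection of the invariant metric `g`; see `existsUnique_isLeviCivita`. -/
def leviCivita (hkp : IsCompl k.toSubmodule p) (g : LinearMap.BilinForm ℝ p) :
    p →ₗ[ℝ] p →ₗ[ℝ] p :=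
  if h : ∃ Λ, IsLeviCivita hkp g Λ then h.choose else 0

/-- The curvature tensor at the base point:
`R(X, Y) = [Λ(X), Λ(Y)] - Λ([X, Y]_p) - ad([X, Y]_k)`. -/
def curvature (hkp : IsCompl k.toSubmodule p) (g : LinearMap.BilinForm ℝ p) (X Y : p) :
    Module.End ℝ p :=
  leviCivita hkp g X ∘ₗ leviCivita hkp g Y - leviCivita hkp g Y ∘ₗ leviCivita hkp g X
    - leviCivita hkp g (bracketP hkp X Y) - isotropyPart hkp X Y

/-- For fixed `Y, Z` the linear map `X ↦ R(X, Y) Z`. -/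
def curvatureMap (hkp : IsCompl k.toSubmodule p) (g : LinearMap.BilinForm ℝ p) (Y Z : p) :
    Module.End ℝ p where
  toFun X := curvature hkp g X Y Z
  map_add' X X' := by
    simp only [curvature, isotropyPart, LinearMap.sub_apply, LinearMap.comp_apply, map_add,
      LinearMap.add_apply, Submodule.coe_add, add_lie, Submodule.subtype_apply]
    abel
  map_smul' c X := by
    simp only [curvature, isotropyPart, LinearMap.sub_apply, LinearMap.comp_apply, map_smul,
      LinearMap.smul_apply, Submodule.coe_smul, smul_lie, Submodule.subtype_apply,
      RingHom.id_apply, smul_sub]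

/-- The Ricci tensor `Ric(Y, Z) = tr (X ↦ R(X, Y) Z)`. -/
def ricci (hkp : IsCompl k.toSubmodule p) (g : LinearMap.BilinForm ℝ p) :
    LinearMap.BilinForm ℝ p :=
  LinearMap.mk₂ ℝ (fun Y Z => LinearMap.trace ℝ p (curvatureMap hkp g Y Z))
    (fun Y Y' Z => by
      rw [← map_add]; congr 1; ext X : 1
      simp only [curvatureMap, curvature, isotropyPart, LinearMap.sub_apply, LinearMap.comp_apply,
        map_add, LinearMap.add_apply, Submodule.coe_add, lie_add, Submodule.subtype_apply,
        LinearMap.coe_mk, AddHom.coe_mk]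
      abel)
    (fun c Y Z => by
      rw [← map_smul]; congr 1; ext X : 1
      simp only [curvatureMap, curvature, isotropyPart, LinearMap.sub_apply, LinearMap.comp_apply,
        map_smul, LinearMap.smul_apply, Submodule.coe_smul, lie_smul, Submodule.subtype_apply,
        LinearMap.coe_mk, AddHom.coe_mk, smul_sub])
    (fun Y Z Z' => by
      rw [← map_add]; congr 1; ext X : 1
      simp only [curvatureMap, LinearMap.add_apply, LinearMap.coe_mk, AddHom.coe_mk, map_add])
    (fun c Y Z => by
      rw [← map_smul]; congr 1; ext X : 1
      simp only [curvatureMap, LinearMap.smul_apply, LinearMap.coe_mk, AddHom.coe_mk, map_smul])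

theorem IsScalarProduct.nondegenerate {V : Type*} [AddCommGroup V] [Module ℝ V]
    {g : LinearMap.BilinForm ℝ V} (hg : IsScalarProduct g) : g.Nondegenerate := by
  constructor
  · intro X hX
    by_contra h
    exact absurd (hX X) (hg.pos X h).ne'
  · intro X hX
    by_contra h
    exact absurd (hX X) (hg.pos X h).ne'

open Classical in
/-- The scalar curvature: the trace of the Ricci endomorphism `r`, where
`Ric(X, Y) = g(r X, Y)`. -/
def scalarCurvature [FiniteDimensional ℝ L] (hkp : IsCompl k.toSubmodule p)
    (g : LinearMap.BilinForm ℝ p) : ℝ :=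
  if hg : g.Nondegenerate then
    LinearMap.trace ℝ p ((g.toDual hg).symm.toLinearMap ∘ₗ ricci hkp g)
  else 0

theorem existsUnique_isLeviCivita [FiniteDimensional ℝ L] (hkp : IsCompl k.toSubmodule p)
    (g : LinearMap.BilinForm ℝ p) (hg : IsScalarProduct g) :
    ∃! Λ, IsLeviCivita hkp g Λ := by
  have hnd := hg.nondegenerate
  let β := bracketP hkp
  have hβ : ∀ X Y, β Y X = - β X Y := by
    intro X Y
    simp only [β, bracketP, LinearMap.mk₂_apply]
    rw [← lie_skew, map_neg]
  let κ : p →ₗ[ℝ] p →ₗ[ℝ] Module.Dual ℝ p :=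
    LinearMap.mk₂ ℝ
      (fun X Y => (1 / 2 : ℝ) • (g (β X Y) - (g.flip X) ∘ₗ β Y + (g.flip Y) ∘ₗ β.flip X))
      (by intros; ext; simp; ring) (by intros; ext; simp; ring)
      (by intros; ext; simp; ring) (by intros; ext; simp; ring)
  let Λ : p →ₗ[ℝ] p →ₗ[ℝ] p := κ.compr₂ (g.toDual hnd).symm.toLinearMap
  have hΛ : ∀ X Y Z, g (Λ X Y) Z
      = (1 / 2 : ℝ) * (g (β X Y) Z - g (β Y Z) X + g (β Z X) Y) := by
    intro X Y Z
    have : g (Λ X Y) Z = κ X Y Z := by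
      simp only [Λ, LinearMap.compr₂_apply, LinearEquiv.coe_coe]
      exact LinearMap.BilinForm.apply_toDual_symm_apply _ _
    rw [this]
    simp [κ]
    ring
  have ext_g : ∀ U V : p, (∀ Z, g U Z = g V Z) → U = V := by
    intro U V h
    have := hg.pos (U - V)
    by_contra hne
    have h1 := this (sub_ne_zero.mpr hne)
    rw [map_sub g, LinearMap.sub_apply, h, sub_self] at h1
    exact lt_irrefl _ h1
  refine ⟨Λ, ⟨?_, ?_⟩, ?_⟩
  · intro X Y
    apply ext_g
    intro Z
    rw [map_sub, LinearMap.sub_apply, hΛ, hΛ, hβ X Y, hβ X Z, hβ Y Z]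
    simp only [map_neg, LinearMap.neg_apply]
    change _ = g (β X Y) Z
    ring
  · intro X Y Z
    rw [hg.symm Y, hΛ, hΛ, hβ X Y, hβ Z X, hβ Z Y]
    simp only [map_neg, LinearMap.neg_apply]
    ring
  · intro M hM
    ext X Y : 2
    apply ext_g
    intro Z
    rw [hΛ]
    have t : ∀ X Y Z, g (M X Y) Z - g (M Y X) Z = g (β X Y) Z := by
      intro X Y Z
      rw [← LinearMap.sub_apply, ← map_sub, hM.torsion_free]
    have m := hM.metric
    have e1 := t X Y Z
    have e2 := t Y Z X
    have e3 := t Z X Y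
    have m1 := m X Y Z
    have m2 := m Y Z X
    have m3 := m Z X Y
    rw [hg.symm Y] at m1
    rw [hg.symm Z] at m2
    rw [hg.symm X] at m3
    linarith

/-- The family of invariant metrics `g(t)`, `t ∈ J`, solves the homogeneous Ricci flow
`g' = -2 Ric(g)` on `J`. -/
structure IsRicciFlowOn (hkp : IsCompl k.toSubmodule p) (g : ℝ → LinearMap.BilinForm ℝ p)
    (J : Set ℝ) : Prop where
  scalarProduct : ∀ t ∈ J, IsScalarProduct (g t)
  flow : ∀ t ∈ J, ∀ X Y : p,
    HasDerivWithinAt (fun s => g s X Y) (-2 * ricci hkp (g t) X Y) J t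

end Curvature

section Group

/-! ### Compact homogeneous spaces `G/K` -/

variable {n : ℕ} {G : Type*} [TopologicalSpace G] [ChartedSpace (EuclideanSpace ℝ (Fin n)) G]
  [Group G]

instance [LieGroup (𝓡 n) ∞ G] : LieGroup (𝓡 n) (minSmoothness ℝ 3) G := by
  rw [minSmoothness_of_isRCLikeNormedField]
  infer_instance

instance : FiniteDimensional ℝ (GroupLieAlgebra (𝓡 n) G) :=
  inferInstanceAs (FiniteDimensional ℝ (EuclideanSpace ℝ (Fin n)))

/-- The adjoint representation: `Ad a` is the derivative at `1` of `h ↦ a h a⁻¹`. -/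
def Ad (a : G) : GroupLieAlgebra (𝓡 n) G →ₗ[ℝ] GroupLieAlgebra (𝓡 n) G :=
  (show EuclideanSpace ℝ (Fin n) →L[ℝ] EuclideanSpace ℝ (Fin n) from
    mfderiv (𝓡 n) (𝓡 n) (fun h : G => a * h * a⁻¹) 1).toLinearMap

variable (n) in
/-- The velocities `γ'(0)` of the smooth curves `γ` of `G` that stay in `K` and have `γ(0) = 1`. -/
def tangentVectors (K : Subgroup G) : Set (GroupLieAlgebra (𝓡 n) G) :=
  {X | ∃ γ : ℝ → G, ContMDiff 𝓘(ℝ, ℝ) (𝓡 n) ∞ γ ∧ γ 0 = 1 ∧ (∀ t, γ t ∈ K) ∧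
    (mfderiv 𝓘(ℝ, ℝ) (𝓡 n) γ 0 (1 : ℝ) : EuclideanSpace ℝ (Fin n)) = X}

variable (n) in
/-- The Lie algebra of a closed subgroup `K` of `G`. For closed `K` the set `tangentVectors n K` is
itself a Lie subalgebra, so that taking the span adds nothing. -/
def isotropyAlgebra [LieGroup (𝓡 n) ∞ G] (K : Subgroup G) :
    LieSubalgebra ℝ (GroupLieAlgebra (𝓡 n) G) :=
  LieSubalgebra.lieSpan ℝ _ (tangentVectors n K)

variable [LieGroup (𝓡 n) ∞ G] {K : Subgroup G} {p : Submodule ℝ (GroupLieAlgebra (𝓡 n) G)}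

variable (n) in
/-- Maximality of the isotropy group: no `Ad(K)`-invariant Lie subalgebra lies strictly between the
Lie algebra of `K` and that of `G`. -/
def IsMaximalIsotropy (K : Subgroup G) : Prop :=
  ∀ h : LieSubalgebra ℝ (GroupLieAlgebra (𝓡 n) G), isotropyAlgebra n K ≤ h →
    (∀ a ∈ K, ∀ X ∈ h, Ad a X ∈ h) → h = isotropyAlgebra n K ∨ h = ⊤

/-- The isotropy representation on `p`: the restriction of `Ad a` to `p` (for `a ∈ K` and an
`Ad(K)`-invariant `p` the projection to `p` does nothing). -/
def isotropyRep (hkp : IsCompl (isotropyAlgebra n K).toSubmodule p) (a : G) : Module.End ℝ p :=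
  prP hkp ∘ₗ Ad a ∘ₗ p.subtype

/-- `W ⊆ p` is invariant under the isotropy representation of `K`. -/
def IsInvariant (hkp : IsCompl (isotropyAlgebra n K).toSubmodule p) (W : Submodule ℝ p) : Prop :=
  ∀ a ∈ K, ∀ X ∈ W, isotropyRep hkp a X ∈ W

/-- `W ⊆ p` is an irreducible summand of the isotropy representation of `K`. -/
structure IsIrreducibleSummand (hkp : IsCompl (isotropyAlgebra n K).toSubmodule p)
    (W : Submodule ℝ p) : Prop where
  ne_bot : W ≠ ⊥
  invariant : IsInvariant hkp W
  irreducible : ∀ U ≤ W, IsInvariant hkp U → U = ⊥ ∨ U = W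

/-- Two invariant summands are equivalent if there is a `K`-equivariant isomorphism. -/
def AreEquivalent (hkp : IsCompl (isotropyAlgebra n K).toSubmodule p)
    (W₁ W₂ : Submodule ℝ p) : Prop :=
  ∃ φ : W₁ ≃ₗ[ℝ] W₂, ∀ a ∈ K, ∀ X Y : W₁, (Y : p) = isotropyRep hkp a X →
    (φ Y : p) = isotropyRep hkp a (φ X)

/-- `p = p₁ ⊕ p₂` is the isotropy representation of `G/K`, an `Ad(K)`-invariant complement of the
Lie algebra of `K`, split into two inequivalent irreducible summands. -/
structure IsTwoSummandSplitting (hkp : IsCompl (isotropyAlgebra n K).toSubmodule p)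
    (p₁ p₂ : Submodule ℝ p) : Prop where
  reductive : ∀ a ∈ K, ∀ X ∈ p, Ad a X ∈ p
  isCompl : IsCompl p₁ p₂
  irreducible₁ : IsIrreducibleSummand hkp p₁
  irreducible₂ : IsIrreducibleSummand hkp p₂
  inequivalent : ¬ AreEquivalent hkp p₁ p₂

/-- An `Ad(K)`-invariant scalar product on `p`. -/
structure IsInvariantScalarProduct (hkp : IsCompl (isotropyAlgebra n K).toSubmodule p)
    (Q : LinearMap.BilinForm ℝ p) : Prop where
  scalarProduct : IsScalarProduct Q
  invariant : ∀ a ∈ K, ∀ X Y, Q (isotropyRep hkp a X) (isotropyRep hkp a Y) = Q X Y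

end Group

section Flow

/-- The bilinear form `x₁ Q|p₁ ⊕ x₂ Q|p₂` on `V = p₁ ⊕ p₂`. -/
def diagForm {V : Type*} [AddCommGroup V] [Module ℝ V] {p₁ p₂ : Submodule ℝ V}
    (h : IsCompl p₁ p₂) (Q : LinearMap.BilinForm ℝ V) (x₁ x₂ : ℝ) : LinearMap.BilinForm ℝ V :=
  x₁ • Q.compl₁₂ (p₁.projection p₂ h) (p₁.projection p₂ h)
    + x₂ • Q.compl₁₂ (p₂.projection p₁ h.symm) (p₂.projection p₁ h.symm)

variable {L : Type*} [LieRing L] [LieAlgebra ℝ L]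
variable {k : LieSubalgebra ℝ L} {p : Submodule ℝ L}

/-- `(x₁, x₂)` is a solution of the homogeneous Ricci flow on `J`: `x₁, x₂ > 0`, and the metrics
`x₁(t) Q|p₁ ⊕ x₂(t) Q|p₂` solve the Ricci flow. -/
structure IsHRF (hkp : IsCompl k.toSubmodule p) {p₁ p₂ : Submodule ℝ p} (h : IsCompl p₁ p₂)
    (Q : LinearMap.BilinForm ℝ p) (x₁ x₂ : ℝ → ℝ) (J : Set ℝ) : Prop where
  pos₁ : ∀ t ∈ J, 0 < x₁ t
  pos₂ : ∀ t ∈ J, 0 < x₂ t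
  flow : IsRicciFlowOn hkp (fun t => diagForm h Q (x₁ t) (x₂ t)) J

/-- The time interval `[0, T)`, where `T ≤ ∞`. -/
def timeInterval (T : EReal) : Set ℝ := {t | 0 ≤ t ∧ (t : EReal) < T}

/-- `(x₁, x₂)` is a solution of the homogeneous Ricci flow with maximal time interval `[0, T)`,
`0 < T ≤ ∞`: it cannot be extended to a solution on a longer interval `[0, T')`. -/
structure IsMaximalHRF (hkp : IsCompl k.toSubmodule p) {p₁ p₂ : Submodule ℝ p} (h : IsCompl p₁ p₂)
    (Q : LinearMap.BilinForm ℝ p) (x₁ x₂ : ℝ → ℝ) (T : EReal) : Prop where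
  pos : 0 < T
  isHRF : IsHRF hkp h Q x₁ x₂ (timeInterval T)
  maximal : ∀ T', T < T' → ∀ z₁ z₂ : ℝ → ℝ, IsHRF hkp h Q z₁ z₂ (timeInterval T') →
    ¬ (EqOn x₁ z₁ (timeInterval T) ∧ EqOn x₂ z₂ (timeInterval T))

end Flow

end HomRicci

end

/-! Averaging over the compact group `G` gives an `Ad(G)`-invariant scalar product `B` on its Lie
algebra, and restricting `B` to the orthogonal complement of `k` gives an invariant scalar product
`Q₀` on `p`. By Schur's lemma every invariant symmetric form on `p` is diagonal with respect to
`Q₀`, in particular `Q` and the Ricci tensors of the invariant metrics. So the flow is an ordinary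
differential equation for two positive functions `x`, `y`, namely `x' = -2 r₁`, `y' = -2 r₂` with
`d₁ r₁ = E₁ - A/2 · y/x + C/4 · x²/y²` and its mirror image for `r₂`, where `A ≤ E₁` and `C ≤ E₂`.
The sums of squares of structure constants `A = [112]` and `C = [221]` are positive because
`k ⊕ p₁` and `k ⊕ p₂` are not subalgebras, by maximality of the isotropy.

The scalar curvature is `d₁ r₁ / x + d₂ r₂ / y`; it is positive when both functions decrease, and it
is monotone along the flow, with derivative `2 |Ric|²`. Suppose that it stays nonpositive on
`[0, T)`. As it is positive where `x = y`, one may assume `x < y` throughout. Then `r₁ < 0`, while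
`r₂` has a positive lower bound: `x` increases, `y` decreases at least linearly, and `y > x ≥ x(0)`.
Hence `T` is finite, `x` and `y` have positive limits at `T`, and the solution extends beyond `T`,
contrary to its maximality. -/

noncomputable section

namespace HomRicci

theorem exists_invariant_isScalarProduct {G E : Type*} [Group G] [TopologicalSpace G]
    [IsTopologicalGroup G] [CompactSpace G] [NormedAddCommGroup E] [InnerProductSpace ℝ E]
    (ρ : Representation ℝ G E) (hρ : ∀ X, Continuous fun a => ρ a X) :
    ∃ B : LinearMap.BilinForm ℝ E, IsScalarProduct B ∧ ∀ a X Y, B (ρ a X) (ρ a Y) = B X Y := by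
  let _ : MeasurableSpace G := borel G
  have : BorelSpace G := ⟨rfl⟩
  let μ : MeasureTheory.Measure G := (MeasureTheory.Measure.haar : MeasureTheory.Measure G).inv
  have hcont : ∀ X Y, Continuous fun a => inner ℝ (ρ a X) (ρ a Y) :=
    fun X Y => (hρ X).inner (hρ Y)
  have hint : ∀ X Y, MeasureTheory.Integrable (fun a => inner ℝ (ρ a X) (ρ a Y)) μ := fun X Y =>
    (hcont X Y).integrable_of_hasCompactSupport (HasCompactSupport.of_compactSpace _)
  let B : LinearMap.BilinForm ℝ E :=
    LinearMap.mk₂ ℝ (fun X Y => ∫ a, inner ℝ (ρ a X) (ρ a Y) ∂μ)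
      (fun X X' Y => by
        simp only [map_add, inner_add_left]
        exact MeasureTheory.integral_add (hint _ _) (hint _ _))
      (fun c X Y => by
        simp only [map_smul, real_inner_smul_left, smul_eq_mul]
        exact MeasureTheory.integral_const_mul _ _)
      (fun X Y Y' => by
        simp only [map_add, inner_add_right]
        exact MeasureTheory.integral_add (hint _ _) (hint _ _))
      (fun c X Y => by
        simp only [map_smul, real_inner_smul_right, smul_eq_mul]
        exact MeasureTheory.integral_const_mul _ _)
  refine ⟨B, ⟨fun X Y => ?_, fun X hX => ?_⟩, fun a X Y => ?_⟩
  · exact MeasureTheory.integral_congr_ae (.of_forall fun a => real_inner_comm _ _)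
  · refine (hcont X X).integral_pos_of_hasCompactSupport_nonneg_nonzero
      (HasCompactSupport.of_compactSpace _) (fun a => real_inner_self_nonneg) (x := 1) ?_
    rw [map_one]
    exact inner_self_ne_zero.2 hX
  · have h := MeasureTheory.integral_mul_right_eq_self (μ := μ)
      (fun b => (inner ℝ (ρ b X) (ρ b Y) : ℝ)) a
    simp only [map_mul] at h
    exact h

section LieSpan

variable {R L M : Type*} [CommRing R] [LieRing L] [LieAlgebra R L] [AddCommGroup M] [Module R M]
  [LieRingModule L M] [LieModule R L M] {s : Set L} {W : Submodule R M}

theorem lie_mem_of_mem_lieSpan (hs : ∀ Z ∈ s, ∀ X ∈ W, ⁅Z, X⁆ ∈ W) {Z : L}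
    (hZ : Z ∈ LieSubalgebra.lieSpan R L s) : ∀ X ∈ W, ⁅Z, X⁆ ∈ W := by
  induction hZ using LieSubalgebra.lieSpan_induction with
  | mem Z hZ => exact hs Z hZ
  | zero => exact fun X _ => by simp only [zero_lie, zero_mem]
  | add U V _ _ hU hV => exact fun X hX => by simpa only [add_lie] using add_mem (hU X hX) (hV X hX)
  | smul c U _ hU => exact fun X hX => by simpa only [smul_lie] using W.smul_mem c (hU X hX)
  | lie U V _ _ hU hV =>
    exact fun X hX => by
      simpa only [lie_lie] using sub_mem (hU _ (hV X hX)) (hV _ (hU X hX))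

theorem form_lie_of_mem_lieSpan {g : LinearMap.BilinForm R M}
    (hsW : ∀ Z ∈ s, ∀ X ∈ W, ⁅Z, X⁆ ∈ W)
    (hsg : ∀ Z ∈ s, ∀ X ∈ W, ∀ Y ∈ W, g ⁅Z, X⁆ Y + g X ⁅Z, Y⁆ = 0) {Z : L}
    (hZ : Z ∈ LieSubalgebra.lieSpan R L s) :
    ∀ X ∈ W, ∀ Y ∈ W, g ⁅Z, X⁆ Y + g X ⁅Z, Y⁆ = 0 := by
  induction hZ using LieSubalgebra.lieSpan_induction with
  | mem Z hZ => exact hsg Z hZ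
  | zero => simp
  | add U V _ _ hU hV =>
    intro X hX Y hY
    simp only [add_lie, map_add, LinearMap.add_apply]
    linear_combination hU X hX Y hY + hV X hX Y hY
  | smul c U _ hU =>
    intro X hX Y hY
    simp only [smul_lie, map_smul, LinearMap.smul_apply, smul_eq_mul]
    linear_combination c * hU X hX Y hY
  | lie U V hUs hVs hU hV =>
    intro X hX Y hY
    have hUW := lie_mem_of_mem_lieSpan hsW hUs
    have hVW := lie_mem_of_mem_lieSpan hsW hVs
    simp only [lie_lie, map_sub, LinearMap.sub_apply]
    linear_combination hU _ (hVW X hX) Y hY - hV _ (hUW X hX) Y hY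
      - hV X hX _ (hUW Y hY) + hU X hX _ (hVW Y hY)

end LieSpan

section ScalarProduct

variable {U V : Type*} [AddCommGroup U] [Module ℝ U] [AddCommGroup V] [Module ℝ V]
variable {Q : LinearMap.BilinForm ℝ V}

theorem IsScalarProduct.nonneg (hQ : IsScalarProduct Q) (X : V) : 0 ≤ Q X X := by
  rcases eq_or_ne X 0 with rfl | hX
  · rw [map_zero]
  · exact (hQ.pos X hX).le

theorem IsScalarProduct.eq_zero (hQ : IsScalarProduct Q) {X : V} (h : Q X X = 0) : X = 0 := by
  by_contra hX
  exact (hQ.pos X hX).ne' h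

theorem IsScalarProduct.eq_of_forall (hQ : IsScalarProduct Q) {X Y : V}
    (h : ∀ Z, Q X Z = Q Y Z) : X = Y :=
  sub_eq_zero.1 <| hQ.eq_zero <| by
    rw [map_sub Q, LinearMap.sub_apply, h, sub_self]

theorem IsScalarProduct.restrict (hQ : IsScalarProduct Q) (W : Submodule ℝ V) :
    IsScalarProduct (Q.restrict W) :=
  ⟨fun _ _ => hQ.symm _ _, fun _ hX => hQ.pos _ (mt Submodule.coe_eq_zero.1 hX)⟩

/-- The inner product space structure of a scalar product, which gives access to orthonormal bases
and to the spectral theorem. -/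
@[reducible]
def IsScalarProduct.toCore (hQ : IsScalarProduct Q) : InnerProductSpace.Core ℝ V where
  inner X Y := Q X Y
  conj_inner_symm _ _ := hQ.symm _ _
  re_inner_nonneg := hQ.nonneg
  add_left _ _ _ := by rw [map_add, LinearMap.add_apply]
  smul_left _ _ _ := by rw [map_smul, LinearMap.smul_apply]; rfl
  definite _ := hQ.eq_zero

/-- An orthonormal basis for a scalar product which is given as a bilinear form rather than as an
inner product space instance. -/
def IsOrthonormalBasis {ι : Type*} [DecidableEq ι] (Q : LinearMap.BilinForm ℝ V)
    (e : Module.Basis ι ℝ V) : Prop :=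
  ∀ i j, Q (e i) (e j) = if i = j then 1 else 0

theorem IsScalarProduct.exists_isOrthonormalBasis [FiniteDimensional ℝ V]
    (hQ : IsScalarProduct Q) :
    ∃ e : Module.Basis (Fin (Module.finrank ℝ V)) ℝ V, IsOrthonormalBasis Q e := by
  let _ : NormedAddCommGroup V := hQ.toCore.toNormedAddCommGroup
  let _ : InnerProductSpace ℝ V := InnerProductSpace.ofCore hQ.toCore.toCore
  refine ⟨(stdOrthonormalBasis ℝ V).toBasis, fun i j => ?_⟩
  rw [OrthonormalBasis.coe_toBasis]
  exact orthonormal_iff_ite.1 (stdOrthonormalBasis ℝ V).orthonormal i j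

section Basis

variable {ι : Type*} [DecidableEq ι] {e : Module.Basis ι ℝ V}

theorem IsOrthonormalBasis.repr [Finite ι] (he : IsOrthonormalBasis Q e) (X : V) (i : ι) :
    e.repr X i = Q X (e i) := by
  have := Fintype.ofFinite ι
  conv_rhs => rw [← e.sum_repr X]
  simp only [map_sum, map_smul, LinearMap.sum_apply, LinearMap.smul_apply, smul_eq_mul, he _ _,
    mul_ite, mul_one, mul_zero, Finset.sum_ite_eq', Finset.mem_univ, if_true]

variable [Fintype ι]

theorem IsOrthonormalBasis.sum_smul (he : IsOrthonormalBasis Q e) (X : V) :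
    ∑ i, Q X (e i) • e i = X := by
  simp only [← he.repr, e.sum_repr]

theorem IsOrthonormalBasis.trace (he : IsOrthonormalBasis Q e) (T : Module.End ℝ V) :
    LinearMap.trace ℝ V T = ∑ i, Q (T (e i)) (e i) := by
  simp only [LinearMap.trace_eq_matrix_trace ℝ e, Matrix.trace, Matrix.diag_apply,
    LinearMap.toMatrix_apply, he.repr]

end Basis

theorem IsScalarProduct.trace_eq_zero_of_skew [FiniteDimensional ℝ V] (hQ : IsScalarProduct Q)
    {T : Module.End ℝ V} (hT : ∀ X Y, Q (T X) Y + Q X (T Y) = 0) : LinearMap.trace ℝ V T = 0 := by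
  obtain ⟨e, he⟩ := hQ.exists_isOrthonormalBasis
  rw [he.trace]
  refine Finset.sum_eq_zero fun i _ => ?_
  linarith [hT (e i) (e i), hQ.symm (e i) (T (e i))]

variable [FiniteDimensional ℝ V]

/-- The linear map representing a pairing `S` with respect to a scalar product `Q` on its second
factor; for a bilinear form `S` on `V` this is the endomorphism `T` with `Q(T X, Y) = S(X, Y)`. -/
def rieszMap (hQ : IsScalarProduct Q) (S : U →ₗ[ℝ] V →ₗ[ℝ] ℝ) : U →ₗ[ℝ] V :=
  (Q.toDual hQ.nondegenerate).symm.toLinearMap ∘ₗ S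

theorem form_rieszMap (hQ : IsScalarProduct Q) (S : U →ₗ[ℝ] V →ₗ[ℝ] ℝ) (X : U) (Y : V) :
    Q (rieszMap hQ S X) Y = S X Y :=
  LinearMap.BilinForm.apply_toDual_symm_apply (hB := hQ.nondegenerate) (S X) Y

theorem rieszMap_eq_zero_iff (hQ : IsScalarProduct Q) {S : U →ₗ[ℝ] V →ₗ[ℝ] ℝ} :
    rieszMap hQ S = 0 ↔ S = 0 := by
  refine ⟨fun h => LinearMap.ext₂ fun X Y => ?_, fun h => by rw [h]; exact LinearMap.comp_zero _⟩
  rw [← form_rieszMap hQ S, h, LinearMap.zero_apply, map_zero, LinearMap.zero_apply,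
    LinearMap.zero_apply, LinearMap.zero_apply]

theorem exists_apply_eq_smul [Nontrivial V] {S : LinearMap.BilinForm ℝ V}
    (hQ : IsScalarProduct Q) (hS : ∀ X Y, S X Y = S Y X) :
    ∃ (c : ℝ) (X : V), X ≠ 0 ∧ S X = c • Q X := by
  let _ : NormedAddCommGroup V := hQ.toCore.toNormedAddCommGroup
  let _ : InnerProductSpace ℝ V := InnerProductSpace.ofCore hQ.toCore.toCore
  have hT : (rieszMap hQ S).IsSymmetric := fun X Y => by
    change Q (rieszMap hQ S X) Y = Q X (rieszMap hQ S Y)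
    rw [form_rieszMap, hQ.symm, form_rieszMap, hS]
  obtain ⟨c, hc⟩ : ∃ c : ℝ, Module.End.HasEigenvalue (rieszMap hQ S) c :=
    ⟨_, hT.hasEigenvalue_iSup_of_finiteDimensional⟩
  obtain ⟨X, hX⟩ := hc.exists_hasEigenvector
  refine ⟨c, X, hX.2, LinearMap.ext fun Y => ?_⟩
  rw [← form_rieszMap hQ S, hX.apply_eq_smul, map_smul]

end ScalarProduct

section Schur

variable {M V W : Type*} [Group M] [AddCommGroup V] [Module ℝ V] [AddCommGroup W] [Module ℝ W]
variable {ρ : Representation ℝ M V} {σ : Representation ℝ M W}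

/-- A pairing of two representations which is invariant under the simultaneous action. For `ρ = σ`
this is the invariance of a bilinear form. -/
def IsInvariantPairing (ρ : Representation ℝ M V) (σ : Representation ℝ M W)
    (S : V →ₗ[ℝ] W →ₗ[ℝ] ℝ) : Prop :=
  ∀ a X Y, S (ρ a X) (σ a Y) = S X Y

theorem IsInvariantPairing.apply_left {S : V →ₗ[ℝ] W →ₗ[ℝ] ℝ} (hS : IsInvariantPairing ρ σ S)
    (a : M) (X : V) (Y : W) : S (ρ a X) Y = S X (σ a⁻¹ Y) := by
  rw [← hS a X, Representation.self_inv_apply]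

variable [FiniteDimensional ℝ W] {Q : LinearMap.BilinForm ℝ W}

/-- The map representing an invariant pairing, as a map of representations. -/
def rieszIntertwiningMap (hQ : IsScalarProduct Q) (hQi : IsInvariantPairing σ σ Q)
    {S : V →ₗ[ℝ] W →ₗ[ℝ] ℝ} (hS : IsInvariantPairing ρ σ S) : ρ.IntertwiningMap σ :=
  (rieszMap hQ S).intertwiningMap_of_isIntertwiningMap ρ σ fun a X =>
    hQ.eq_of_forall fun Y => by
      rw [form_rieszMap, hS.apply_left, hQi.apply_left, form_rieszMap]

theorem rieszIntertwiningMap_eq_zero_iff (hQ : IsScalarProduct Q)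
    (hQi : IsInvariantPairing σ σ Q) {S : V →ₗ[ℝ] W →ₗ[ℝ] ℝ} (hS : IsInvariantPairing ρ σ S) :
    rieszIntertwiningMap hQ hQi hS = 0 ↔ S = 0 := by
  rw [← rieszMap_eq_zero_iff hQ]
  exact ⟨congrArg Representation.IntertwiningMap.toLinearMap,
    fun h => Representation.IntertwiningMap.toLinearMap_injective _ _ h⟩

theorem eq_zero_of_isEmpty_equiv [ρ.IsIrreducible] [σ.IsIrreducible] [IsEmpty (ρ.Equiv σ)]
    (hQ : IsScalarProduct Q) (hQi : IsInvariantPairing σ σ Q) {S : V →ₗ[ℝ] W →ₗ[ℝ] ℝ}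
    (hS : IsInvariantPairing ρ σ S) : S = 0 :=
  (rieszIntertwiningMap_eq_zero_iff hQ hQi hS).1 (Subsingleton.elim _ _)

theorem eq_zero_of_apply_eq_zero [ρ.IsIrreducible] (hQ : IsScalarProduct Q)
    (hQi : IsInvariantPairing σ σ Q) {S : V →ₗ[ℝ] W →ₗ[ℝ] ℝ} (hS : IsInvariantPairing ρ σ S)
    {X : V} (hX : X ≠ 0) (h : S X = 0) : S = 0 := by
  rw [← rieszIntertwiningMap_eq_zero_iff hQ hQi hS]
  refine (Representation.IsIrreducible.injective_or_eq_zero _).resolve_left fun hinj => ?_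
  refine hX (hinj (hQ.eq_of_forall fun Y => ?_))
  rw [map_zero, map_zero]
  exact (form_rieszMap hQ S X Y).trans (congrArg (· Y) h)

theorem exists_eq_smul_of_isIrreducible [σ.IsIrreducible] (hQ : IsScalarProduct Q)
    (hQi : IsInvariantPairing σ σ Q) {S : LinearMap.BilinForm ℝ W}
    (hSi : IsInvariantPairing σ σ S) (hS : ∀ X Y, S X Y = S Y X) : ∃ c : ℝ, S = c • Q := by
  have : Nontrivial W := IsSimpleModule.nontrivial (MonoidAlgebra ℝ M) σ.asModule
  obtain ⟨c, X, hX, hc⟩ := exists_apply_eq_smul hQ hS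
  refine ⟨c, sub_eq_zero.1 (eq_zero_of_apply_eq_zero (ρ := σ) hQ hQi (fun a Y Z => ?_) hX ?_)⟩
  · simp only [LinearMap.sub_apply, LinearMap.smul_apply, hSi a Y Z, hQi a Y Z]
  · rw [LinearMap.sub_apply, hc, LinearMap.smul_apply, sub_self]

end Schur

section DiagForm

variable {V : Type*} [AddCommGroup V] [Module ℝ V] {p₁ p₂ : Submodule ℝ V}
variable {Q : LinearMap.BilinForm ℝ V}

theorem diagForm_apply (h : IsCompl p₁ p₂) (Q : LinearMap.BilinForm ℝ V) (x₁ x₂ : ℝ) (X Y : V) :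
    diagForm h Q x₁ x₂ X Y = x₁ * Q (p₁.projection p₂ h X) (p₁.projection p₂ h Y)
      + x₂ * Q (p₂.projection p₁ h.symm X) (p₂.projection p₁ h.symm Y) := rfl

theorem diagForm_comm (h : IsCompl p₁ p₂) (Q : LinearMap.BilinForm ℝ V) (x₁ x₂ : ℝ) :
    diagForm h.symm Q x₂ x₁ = diagForm h Q x₁ x₂ := add_comm _ _

theorem diagForm_apply_of_mem_left (h : IsCompl p₁ p₂) (Q : LinearMap.BilinForm ℝ V) (x₁ x₂ : ℝ)
    {X Y : V} (hX : X ∈ p₁) (hY : Y ∈ p₁) : diagForm h Q x₁ x₂ X Y = x₁ * Q X Y := by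
  rw [diagForm_apply, Submodule.projection_apply_of_mem_left h hX,
    Submodule.projection_apply_of_mem_left h hY, Submodule.projection_apply_of_mem_right h.symm hX,
    map_zero, LinearMap.zero_apply, mul_zero, add_zero]

theorem diagForm_apply_of_mem_right (h : IsCompl p₁ p₂) (Q : LinearMap.BilinForm ℝ V)
    (x₁ x₂ : ℝ) {X Y : V} (hX : X ∈ p₂) (hY : Y ∈ p₂) : diagForm h Q x₁ x₂ X Y = x₂ * Q X Y := by
  rw [← diagForm_comm, diagForm_apply_of_mem_left h.symm Q x₂ x₁ hX hY]

theorem diagForm_diagForm (h : IsCompl p₁ p₂) (Q : LinearMap.BilinForm ℝ V) (q₁ q₂ x₁ x₂ : ℝ) :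
    diagForm h (diagForm h Q q₁ q₂) x₁ x₂ = diagForm h Q (q₁ * x₁) (q₂ * x₂) := by
  refine LinearMap.ext₂ fun X Y => ?_
  have m₁ := Submodule.projection_apply_mem h
  have m₂ := Submodule.projection_apply_mem h.symm
  rw [diagForm_apply, diagForm_apply_of_mem_left h Q q₁ q₂ (m₁ X) (m₁ Y),
    diagForm_apply_of_mem_right h Q q₁ q₂ (m₂ X) (m₂ Y), diagForm_apply]
  ring

theorem isScalarProduct_diagForm (h : IsCompl p₁ p₂) (hQ : IsScalarProduct Q) {x₁ x₂ : ℝ}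
    (h₁ : 0 < x₁) (h₂ : 0 < x₂) : IsScalarProduct (diagForm h Q x₁ x₂) := by
  refine ⟨fun X Y => ?_, fun X hX => ?_⟩
  · rw [diagForm_apply, diagForm_apply, hQ.symm, hQ.symm (p₂.projection p₁ h.symm X)]
  · rw [diagForm_apply]
    by_cases h0 : p₁.projection p₂ h X = 0
    · have h3 : p₂.projection p₁ h.symm X ≠ 0 := fun h4 => hX <| by
        rw [← Submodule.projection_add_projection_eq_self h X, h0, h4, add_zero]
      exact add_pos_of_nonneg_of_pos (mul_nonneg h₁.le (hQ.nonneg _)) (mul_pos h₂ (hQ.pos _ h3))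
    · exact add_pos_of_pos_of_nonneg (mul_pos h₁ (hQ.pos _ h0)) (mul_nonneg h₂.le (hQ.nonneg _))

theorem pos_of_isScalarProduct_diagForm (h : IsCompl p₁ p₂) (hQ : IsScalarProduct Q) {x₁ x₂ : ℝ}
    (hx : IsScalarProduct (diagForm h Q x₁ x₂)) (hp : p₁ ≠ ⊥) : 0 < x₁ := by
  obtain ⟨X, hX, hX0⟩ := Submodule.exists_mem_ne_zero_of_ne_bot hp
  have hpos := hx.pos X hX0
  rw [diagForm_apply_of_mem_left h Q x₁ x₂ hX hX] at hpos
  exact pos_of_mul_pos_left hpos (hQ.nonneg X)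

theorem eq_diagForm (h : IsCompl p₁ p₂) {S : LinearMap.BilinForm ℝ V} {c₁ c₂ : ℝ}
    (hS : ∀ X Y, S X Y = S Y X) (h₁ : S.restrict p₁ = c₁ • Q.restrict p₁)
    (h₂ : S.restrict p₂ = c₂ • Q.restrict p₂) (h₁₂ : ∀ X ∈ p₁, ∀ Y ∈ p₂, S X Y = 0) :
    S = diagForm h Q c₁ c₂ := by
  refine LinearMap.ext₂ fun X Y => ?_
  have m₁ := Submodule.projection_apply_mem h
  have m₂ := Submodule.projection_apply_mem h.symm
  have e₁ : ∀ X ∈ p₁, ∀ Y ∈ p₁, S X Y = c₁ * Q X Y := fun X hX Y hY =>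
    LinearMap.congr_fun₂ h₁ ⟨X, hX⟩ ⟨Y, hY⟩
  have e₂ : ∀ X ∈ p₂, ∀ Y ∈ p₂, S X Y = c₂ * Q X Y := fun X hX Y hY =>
    LinearMap.congr_fun₂ h₂ ⟨X, hX⟩ ⟨Y, hY⟩
  conv_lhs => rw [← Submodule.projection_add_projection_eq_self h X,
    ← Submodule.projection_add_projection_eq_self h Y]
  rw [map_add, map_add, LinearMap.add_apply, LinearMap.add_apply, e₁ _ (m₁ X) _ (m₁ Y),
    h₁₂ _ (m₁ X) _ (m₂ Y), hS (p₂.projection p₁ h.symm X) (p₁.projection p₂ h Y),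
    h₁₂ _ (m₁ Y) _ (m₂ X), e₂ _ (m₂ X) _ (m₂ Y), add_zero, zero_add, diagForm_apply]

/-- A `Q`-orthonormal basis whose two blocks of vectors lie in `p₁` and in `p₂`. -/
structure IsAdaptedBasis {ι₁ ι₂ : Type*} [DecidableEq ι₁] [DecidableEq ι₂]
    (Q : LinearMap.BilinForm ℝ V) (p₁ p₂ : Submodule ℝ V) (e : Module.Basis (ι₁ ⊕ ι₂) ℝ V) :
    Prop where
  isOrthonormalBasis : IsOrthonormalBasis Q e
  inl_mem : ∀ i, e (Sum.inl i) ∈ p₁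
  inr_mem : ∀ i, e (Sum.inr i) ∈ p₂

section AdaptedBasis

variable {ι₁ ι₂ : Type*} [DecidableEq ι₁] [DecidableEq ι₂] {e : Module.Basis (ι₁ ⊕ ι₂) ℝ V}

theorem IsAdaptedBasis.swap (he : IsAdaptedBasis Q p₁ p₂ e) :
    IsAdaptedBasis Q p₂ p₁ (e.reindex (Equiv.sumComm ι₁ ι₂)) := by
  refine ⟨fun i j => ?_, fun i => ?_, fun i => ?_⟩ <;> rw [Module.Basis.reindex_apply]
  · rw [Module.Basis.reindex_apply, he.isOrthonormalBasis]
    simp only [EmbeddingLike.apply_eq_iff_eq]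
  · exact he.inr_mem i
  · exact he.inl_mem i

theorem IsAdaptedBasis.sum_smul_inl [Fintype ι₁] [Finite ι₂] (he : IsAdaptedBasis Q p₁ p₂ e)
    (ho : ∀ X ∈ p₁, ∀ Y ∈ p₂, Q X Y = 0) {X : V} (hX : X ∈ p₁) :
    ∑ i, Q X (e (Sum.inl i)) • e (Sum.inl i) = X := by
  have := Fintype.ofFinite ι₂
  have h := he.isOrthonormalBasis.sum_smul X
  simpa only [Fintype.sum_sum_type, ho X hX _ (he.inr_mem _), zero_smul, Finset.sum_const_zero,
    add_zero] using h

theorem IsAdaptedBasis.diagForm_apply (he : IsAdaptedBasis Q p₁ p₂ e) (h : IsCompl p₁ p₂)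
    (hQ : IsScalarProduct Q) (ho : ∀ X ∈ p₁, ∀ Y ∈ p₂, Q X Y = 0) (x₁ x₂ : ℝ) (X : V)
    (i : ι₁ ⊕ ι₂) :
    diagForm h Q x₁ x₂ X (e i) = Sum.elim (fun _ => x₁) (fun _ => x₂) i * Q X (e i) := by
  have m₁ := Submodule.projection_apply_mem h X
  have m₂ := Submodule.projection_apply_mem h.symm X
  conv_rhs => rw [← Submodule.projection_add_projection_eq_self h X, map_add, LinearMap.add_apply]
  rw [HomRicci.diagForm_apply]
  rcases i with i | i
  · have hi := he.inl_mem i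
    rw [Submodule.projection_apply_of_mem_left h hi,
      Submodule.projection_apply_of_mem_right h.symm hi,
      hQ.symm (p₂.projection p₁ h.symm X) (e _), ho _ hi _ m₂, map_zero, mul_zero,
      Sum.elim_inl, add_zero, add_zero]
  · have hi := he.inr_mem i
    rw [Submodule.projection_apply_of_mem_left h.symm hi,
      Submodule.projection_apply_of_mem_right h hi, ho _ m₁ _ hi, map_zero, mul_zero, Sum.elim_inr,
      zero_add, zero_add]

end AdaptedBasis

theorem exists_isAdaptedBasis [FiniteDimensional ℝ V] (h : IsCompl p₁ p₂)
    (hQ : IsScalarProduct Q) (ho : ∀ X ∈ p₁, ∀ Y ∈ p₂, Q X Y = 0) :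
    ∃ e : Module.Basis (Fin (Module.finrank ℝ p₁) ⊕ Fin (Module.finrank ℝ p₂)) ℝ V,
      IsAdaptedBasis Q p₁ p₂ e := by
  obtain ⟨e₁, he₁⟩ := (hQ.restrict p₁).exists_isOrthonormalBasis
  obtain ⟨e₂, he₂⟩ := (hQ.restrict p₂).exists_isOrthonormalBasis
  let e := (e₁.prod e₂).map (Submodule.prodEquivOfIsCompl p₁ p₂ h)
  have h1 : ∀ i, e (Sum.inl i) = e₁ i := fun i => by simp [e]
  have h2 : ∀ i, e (Sum.inr i) = e₂ i := fun i => by simp [e]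
  refine ⟨e, ?_, fun i => by rw [h1]; exact (e₁ i).2, fun i => by rw [h2]; exact (e₂ i).2⟩
  rintro (i | i) (j | j)
  · rw [h1, h1]; simpa using he₁ i j
  · rw [h1, h2]; simpa using ho _ (e₁ i).2 _ (e₂ j).2
  · rw [h1, h2, hQ.symm]; simpa using ho _ (e₁ j).2 _ (e₂ i).2
  · rw [h2, h2]; simpa using he₂ i j

variable [FiniteDimensional ℝ V]

theorem rieszMap_diagForm (h : IsCompl p₁ p₂) (hQ : IsScalarProduct Q) {x₁ x₂ : ℝ} (h₁ : 0 < x₁)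
    (h₂ : 0 < x₂) (r₁ r₂ : ℝ) :
    rieszMap (isScalarProduct_diagForm h hQ h₁ h₂) (diagForm h Q r₁ r₂)
      = (r₁ / x₁) • p₁.projection p₂ h + (r₂ / x₂) • p₂.projection p₁ h.symm := by
  refine LinearMap.ext fun X => (isScalarProduct_diagForm h hQ h₁ h₂).eq_of_forall fun Y => ?_
  have m₁ := Submodule.projection_apply_mem h
  have m₂ := Submodule.projection_apply_mem h.symm
  have e₁ : p₁.projection p₂ h ((r₁ / x₁) • p₁.projection p₂ h X
      + (r₂ / x₂) • p₂.projection p₁ h.symm X) = (r₁ / x₁) • p₁.projection p₂ h X := by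
    rw [map_add, map_smul, map_smul, Submodule.projection_apply_of_mem_left h (m₁ X),
      Submodule.projection_apply_of_mem_right h (m₂ X), smul_zero, add_zero]
  have e₂ : p₂.projection p₁ h.symm ((r₁ / x₁) • p₁.projection p₂ h X
      + (r₂ / x₂) • p₂.projection p₁ h.symm X) = (r₂ / x₂) • p₂.projection p₁ h.symm X := by
    rw [map_add, map_smul, map_smul, Submodule.projection_apply_of_mem_left h.symm (m₂ X),
      Submodule.projection_apply_of_mem_right h.symm (m₁ X), smul_zero, zero_add]
  rw [form_rieszMap, LinearMap.add_apply, LinearMap.smul_apply, LinearMap.smul_apply,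
    diagForm_apply, diagForm_apply, e₁, e₂, map_smul, map_smul, LinearMap.smul_apply,
    LinearMap.smul_apply, smul_eq_mul, smul_eq_mul, ← mul_assoc, ← mul_assoc,
    mul_div_cancel₀ _ h₁.ne', mul_div_cancel₀ _ h₂.ne']

theorem trace_projection (h : IsCompl p₁ p₂) :
    LinearMap.trace ℝ V (p₁.projection p₂ h) = Module.finrank ℝ p₁ :=
  LinearMap.IsProj.trace
    ⟨Submodule.projection_apply_mem h, fun _ => Submodule.projection_apply_of_mem_left h⟩

theorem trace_rieszMap_diagForm (h : IsCompl p₁ p₂) (hQ : IsScalarProduct Q) {x₁ x₂ : ℝ}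
    (h₁ : 0 < x₁) (h₂ : 0 < x₂) (r₁ r₂ : ℝ) :
    LinearMap.trace ℝ V (rieszMap (isScalarProduct_diagForm h hQ h₁ h₂) (diagForm h Q r₁ r₂))
      = Module.finrank ℝ p₁ * r₁ / x₁ + Module.finrank ℝ p₂ * r₂ / x₂ := by
  rw [rieszMap_diagForm h hQ h₁ h₂, map_add, map_smul, map_smul, trace_projection,
    trace_projection, smul_eq_mul, smul_eq_mul]
  ring

end DiagForm

section InvariantDiagForm

variable {M V : Type*} [Group M] [AddCommGroup V] [Module ℝ V] {ρ : Representation ℝ M V}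
variable {W₁ W₂ : Subrepresentation ρ} {Q S : LinearMap.BilinForm ℝ V}

theorem projection_apply_rep (h : IsCompl W₁.toSubmodule W₂.toSubmodule) (a : M) (X : V) :
    W₁.toSubmodule.projection W₂.toSubmodule h (ρ a X)
      = ρ a (W₁.toSubmodule.projection W₂.toSubmodule h X) := by
  have m₁ := W₁.apply_mem_toSubmodule a (Submodule.projection_apply_mem h X)
  have m₂ := W₂.apply_mem_toSubmodule a (Submodule.projection_apply_mem h.symm X)
  conv_lhs => rw [← Submodule.projection_add_projection_eq_self h X, map_add, map_add,
    Submodule.projection_apply_of_mem_left h m₁, Submodule.projection_apply_of_mem_right h m₂,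
    add_zero]

theorem IsInvariantPairing.diagForm (h : IsCompl W₁.toSubmodule W₂.toSubmodule)
    (hQ : IsInvariantPairing ρ ρ Q) (x₁ x₂ : ℝ) :
    IsInvariantPairing ρ ρ (diagForm h Q x₁ x₂) := fun a X Y => by
  rw [diagForm_apply, diagForm_apply, projection_apply_rep h, projection_apply_rep h,
    projection_apply_rep h.symm, projection_apply_rep h.symm, hQ, hQ]

theorem IsInvariantPairing.restrict (hS : IsInvariantPairing ρ ρ S) (W₁ W₂ : Subrepresentation ρ) :
    IsInvariantPairing W₁.toRepresentation W₂.toRepresentation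
      (S.compl₁₂ W₁.toSubmodule.subtype W₂.toSubmodule.subtype) :=
  fun a X Y => hS a X Y

variable [FiniteDimensional ℝ V] [W₁.toRepresentation.IsIrreducible]
  [W₂.toRepresentation.IsIrreducible]
  [IsEmpty (W₁.toRepresentation.Equiv W₂.toRepresentation)]

theorem IsInvariantPairing.apply_eq_zero (hSi : IsInvariantPairing ρ ρ S)
    (hQ : IsScalarProduct Q) (hQi : IsInvariantPairing ρ ρ Q) {X Y : V} (hX : X ∈ W₁.toSubmodule)
    (hY : Y ∈ W₂.toSubmodule) : S X Y = 0 :=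
  LinearMap.congr_fun₂ (eq_zero_of_isEmpty_equiv (hQ.restrict _) (hQi.restrict W₂ W₂)
    (hSi.restrict W₁ W₂)) ⟨X, hX⟩ ⟨Y, hY⟩

theorem IsInvariantPairing.exists_eq_diagForm (h : IsCompl W₁.toSubmodule W₂.toSubmodule)
    (hSi : IsInvariantPairing ρ ρ S) (hS : ∀ X Y, S X Y = S Y X) (hQ : IsScalarProduct Q)
    (hQi : IsInvariantPairing ρ ρ Q) : ∃ c₁ c₂ : ℝ, S = HomRicci.diagForm h Q c₁ c₂ := by
  obtain ⟨c₁, h₁⟩ := exists_eq_smul_of_isIrreducible (hQ.restrict _) (hQi.restrict W₁ W₁)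
    (hSi.restrict W₁ W₁) fun X Y => hS X Y
  obtain ⟨c₂, h₂⟩ := exists_eq_smul_of_isIrreducible (hQ.restrict _) (hQi.restrict W₂ W₂)
    (hSi.restrict W₂ W₂) fun X Y => hS X Y
  exact ⟨c₁, c₂, eq_diagForm h hS h₁ h₂ fun X hX Y hY => hSi.apply_eq_zero hQ hQi hX hY⟩

end InvariantDiagForm

section ReductiveCurvature

variable {L : Type*} [LieRing L] [LieAlgebra ℝ L]
variable {k : LieSubalgebra ℝ L} {p : Submodule ℝ L}

theorem prP_of_mem_p (hkp : IsCompl k.toSubmodule p) (X : p) : prP hkp (X : L) = X :=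
  Submodule.projectionOnto_apply_left _ X

theorem prP_of_mem_k (hkp : IsCompl k.toSubmodule p) {Z : L} (hZ : Z ∈ k) : prP hkp Z = 0 :=
  Submodule.projectionOnto_apply_right hkp.symm (⟨Z, hZ⟩ : k.toSubmodule)

theorem prK_of_mem_k (hkp : IsCompl k.toSubmodule p) {Z : L} (hZ : Z ∈ k) :
    (prK hkp Z : L) = Z :=
  congrArg Subtype.val (Submodule.projectionOnto_apply_left hkp (⟨Z, hZ⟩ : k.toSubmodule))

theorem prK_of_mem_p (hkp : IsCompl k.toSubmodule p) (X : p) : prK hkp (X : L) = 0 :=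
  Submodule.projectionOnto_apply_right _ X

theorem prP_add_prK (hkp : IsCompl k.toSubmodule p) (U : L) :
    (prP hkp U : L) + (prK hkp U : L) = U :=
  Submodule.projection_add_projection_eq_self hkp.symm U

theorem sub_prP_mem (hkp : IsCompl k.toSubmodule p) (U : L) : U - prP hkp U ∈ k := by
  have h : U - prP hkp U = prK hkp U := sub_eq_of_eq_add' (prP_add_prK hkp U).symm
  exact h ▸ (prK hkp U).2

theorem prP_eq_zero_iff (hkp : IsCompl k.toSubmodule p) {U : L} : prP hkp U = 0 ↔ U ∈ k :=
  Submodule.projectionOnto_apply_eq_zero_iff hkp.symm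

theorem bracketP_apply (hkp : IsCompl k.toSubmodule p) (X Y : p) :
    bracketP hkp X Y = prP hkp ⁅(X : L), (Y : L)⁆ := rfl

/-- The map `(Z, X) ↦ [Z, X]_p`. For `Z ∈ k` it is the isotropy representation of `k` on
`L / k ≅ p`. -/
def adP (hkp : IsCompl k.toSubmodule p) : L →ₗ[ℝ] Module.End ℝ p :=
  LinearMap.mk₂ ℝ (fun Z (X : p) => prP hkp ⁅Z, (X : L)⁆)
    (by intros; simp) (by intros; simp) (by intros; simp) (by intros; simp)

theorem adP_apply (hkp : IsCompl k.toSubmodule p) (Z : L) (X : p) :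
    adP hkp Z X = prP hkp ⁅Z, (X : L)⁆ := rfl

theorem prP_lie (hkp : IsCompl k.toSubmodule p) {Z : L} (hZ : Z ∈ k)
    (U : L) : prP hkp ⁅Z, U⁆ = adP hkp Z (prP hkp U) := by
  conv_lhs => rw [← prP_add_prK hkp U, lie_add, map_add,
    prP_of_mem_k hkp (k.lie_mem hZ (prK hkp U).2), add_zero]
  rfl

/-- The scalar product `g` on `p` is invariant under the isotropy representation of `k`. -/
def IsAdInvariant (hkp : IsCompl k.toSubmodule p) (g : LinearMap.BilinForm ℝ p) : Prop :=
  ∀ Z ∈ k, ∀ X Y : p, g (adP hkp Z X) Y + g X (adP hkp Z Y) = 0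

theorem isLeviCivita_leviCivita [FiniteDimensional ℝ L] (hkp : IsCompl k.toSubmodule p)
    {g : LinearMap.BilinForm ℝ p} (hg : IsScalarProduct g) :
    IsLeviCivita hkp g (leviCivita hkp g) := by
  have h := (existsUnique_isLeviCivita hkp g hg).exists
  rw [leviCivita, dif_pos h]
  exact h.choose_spec

theorem eq_zero_of_symm_of_skew {V : Type*} [AddCommGroup V] [Module ℝ V]
    {g : LinearMap.BilinForm ℝ V} (hg : IsScalarProduct g) {D : V → V → V}
    (hs : ∀ X Y, D X Y = D Y X) (hm : ∀ X Y Z, g (D X Y) Z + g Y (D X Z) = 0) (X Y : V) :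
    D X Y = 0 := by
  apply hg.eq_of_forall
  intro Z
  rw [map_zero, LinearMap.zero_apply]
  have m1 := hm X Y Z
  have m2 := hm Y Z X
  have m3 := hm Z X Y
  rw [hg.symm Y, hs X Z] at m1
  rw [hg.symm Z, hs Y X] at m2
  rw [hg.symm X, hs Z Y] at m3
  rw [hs Z X, hs Y Z] at *
  linarith

/-- The Nomizu map on all of `L`: the Levi-Civita map `Λ` on `p`, the isotropy representation
on `k`. -/
def extConnection (hkp : IsCompl k.toSubmodule p) (Λ : p →ₗ[ℝ] p →ₗ[ℝ] p) :
    L →ₗ[ℝ] Module.End ℝ p :=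
  Λ ∘ₗ prP hkp + adP hkp ∘ₗ k.toSubmodule.subtype ∘ₗ prK hkp

theorem extConnection_of_mem_k (hkp : IsCompl k.toSubmodule p) (Λ : p →ₗ[ℝ] p →ₗ[ℝ] p) {Z : L}
    (hZ : Z ∈ k) : extConnection hkp Λ Z = adP hkp Z := by
  simp [extConnection, prP_of_mem_k hkp hZ, prK_of_mem_k hkp hZ]

theorem extConnection_of_mem_p (hkp : IsCompl k.toSubmodule p) (Λ : p →ₗ[ℝ] p →ₗ[ℝ] p) (X : p) :
    extConnection hkp Λ (X : L) = Λ X := by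
  simp [extConnection, prP_of_mem_p hkp, prK_of_mem_p hkp]

theorem extConnection_apply (hkp : IsCompl k.toSubmodule p) (Λ : p →ₗ[ℝ] p →ₗ[ℝ] p) (U : L)
    (X : p) : extConnection hkp Λ U X = Λ (prP hkp U) X + adP hkp (prK hkp U : L) X := rfl

variable {hkp : IsCompl k.toSubmodule p} {g : LinearMap.BilinForm ℝ p}
variable {Λ : p →ₗ[ℝ] p →ₗ[ℝ] p}

theorem extConnection_torsion_free (hΛ : IsLeviCivita hkp g Λ) (U V : L) :
    extConnection hkp Λ U (prP hkp V) - extConnection hkp Λ V (prP hkp U) = prP hkp ⁅U, V⁆ := by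
  have hlie : prP hkp ⁅U, V⁆ = bracketP hkp (prP hkp U) (prP hkp V)
      + adP hkp (prK hkp U : L) (prP hkp V) - adP hkp (prK hkp V : L) (prP hkp U) := by
    have hK : prP hkp ⁅(prK hkp U : L), V⁆ = adP hkp (prK hkp U : L) (prP hkp V) :=
      prP_lie hkp (prK hkp U).2 V
    have hP : prP hkp ⁅(prP hkp U : L), (prK hkp V : L)⁆
        = - adP hkp (prK hkp V : L) (prP hkp U) := by
      rw [← lie_skew, map_neg, adP_apply]
    conv_lhs => rw [← prP_add_prK hkp U, add_lie, map_add, hK]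
    conv_lhs => enter [1]; rw [← prP_add_prK hkp V, lie_add, map_add, hP]
    rw [bracketP_apply]
    abel
  rw [extConnection_apply, extConnection_apply, hlie, ← hΛ.torsion_free]
  abel

theorem extConnection_metric (hgk : IsAdInvariant hkp g) (hΛ : IsLeviCivita hkp g Λ) (U : L)
    (X Y : p) : g (extConnection hkp Λ U X) Y + g X (extConnection hkp Λ U Y) = 0 := by
  have h1 := hΛ.metric (prP hkp U) X Y
  have h2 := hgk _ (prK hkp U).2 X Y
  simp only [extConnection_apply, map_add, LinearMap.add_apply]
  linarith

/-- The curvature of `extConnection`. As it vanishes when an argument lies in `k`, it computes the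
curvature of `G/K` from arbitrary lifts of tangent vectors to `L`. -/
def extCurvature (hkp : IsCompl k.toSubmodule p) (Λ : p →ₗ[ℝ] p →ₗ[ℝ] p) (U V : L) :
    Module.End ℝ p :=
  extConnection hkp Λ U ∘ₗ extConnection hkp Λ V - extConnection hkp Λ V ∘ₗ extConnection hkp Λ U
    - extConnection hkp Λ ⁅U, V⁆

theorem extCurvature_apply (hkp : IsCompl k.toSubmodule p) (Λ : p →ₗ[ℝ] p →ₗ[ℝ] p) (U V : L)
    (X : p) : extCurvature hkp Λ U V X
      = extConnection hkp Λ U (extConnection hkp Λ V X)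
        - extConnection hkp Λ V (extConnection hkp Λ U X) - extConnection hkp Λ ⁅U, V⁆ X := rfl

theorem extCurvature_swap (hkp : IsCompl k.toSubmodule p) (Λ : p →ₗ[ℝ] p →ₗ[ℝ] p) (U V : L) :
    extCurvature hkp Λ U V = - extCurvature hkp Λ V U := by
  rw [extCurvature, extCurvature, ← lie_skew V U, map_neg]
  abel

theorem extCurvature_add_left (hkp : IsCompl k.toSubmodule p) (Λ : p →ₗ[ℝ] p →ₗ[ℝ] p)
    (U U' V : L) :
    extCurvature hkp Λ (U + U') V = extCurvature hkp Λ U V + extCurvature hkp Λ U' V := by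
  simp only [extCurvature, map_add, add_lie, LinearMap.add_comp, LinearMap.comp_add]
  abel

theorem extCurvature_skew (hgk : IsAdInvariant hkp g) (hΛ : IsLeviCivita hkp g Λ) (U V : L)
    (X Y : p) : g (extCurvature hkp Λ U V X) Y + g X (extCurvature hkp Λ U V Y) = 0 := by
  have m := extConnection_metric hgk hΛ
  simp only [extCurvature_apply, map_sub, LinearMap.sub_apply]
  linarith [m U (extConnection hkp Λ V X) Y, m V X (extConnection hkp Λ U Y),
    m V (extConnection hkp Λ U X) Y, m U X (extConnection hkp Λ V Y), m ⁅U, V⁆ X Y]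

theorem extCurvature_bianchi (hΛ : IsLeviCivita hkp g Λ) (U V W : L) :
    extCurvature hkp Λ U V (prP hkp W) + extCurvature hkp Λ V W (prP hkp U)
      + extCurvature hkp Λ W U (prP hkp V) = 0 := by
  have t := extConnection_torsion_free hΛ
  have hjacobi : prP hkp ⁅U, ⁅V, W⁆⁆ + prP hkp ⁅V, ⁅W, U⁆⁆ + prP hkp ⁅W, ⁅U, V⁆⁆ = 0 := by
    rw [← map_add, ← map_add, lie_jacobi, map_zero]
  rw [← t U ⁅V, W⁆, ← t V ⁅W, U⁆, ← t W ⁅U, V⁆, ← t V W, ← t W U, ← t U V, map_sub,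
    map_sub, map_sub] at hjacobi
  rw [← hjacobi]
  simp only [extCurvature_apply]
  abel

/-- For `Z ∈ k` the Bianchi identity makes `(X, Y) ↦ R(Z, X) Y` symmetric, and `R(Z, X)` is skew. -/
theorem extCurvature_of_mem_k (hg : IsScalarProduct g) (hgk : IsAdInvariant hkp g)
    (hΛ : IsLeviCivita hkp g Λ) {Z : L} (hZ : Z ∈ k) (V : L) : extCurvature hkp Λ Z V = 0 := by
  have hsymm : ∀ U W : L,
      extCurvature hkp Λ Z U (prP hkp W) = extCurvature hkp Λ Z W (prP hkp U) := by
    intro U W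
    have h := extCurvature_bianchi hΛ Z U W
    rwa [prP_of_mem_k hkp hZ, map_zero, add_zero, extCurvature_swap hkp Λ W Z,
      LinearMap.neg_apply, add_neg_eq_zero] at h
  have hzero : ∀ X Y : p, extCurvature hkp Λ Z X Y = 0 :=
    eq_zero_of_symm_of_skew hg (D := fun X Y => extCurvature hkp Λ Z X Y)
      (fun X Y => by simpa only [prP_of_mem_p] using hsymm X Y)
      (fun X => extCurvature_skew hgk hΛ Z X)
  ext1 Y
  rw [← prP_of_mem_p hkp Y, hsymm, hzero, LinearMap.zero_apply]

theorem extCurvature_congr (hg : IsScalarProduct g) (hgk : IsAdInvariant hkp g)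
    (hΛ : IsLeviCivita hkp g Λ) {U U' V V' : L} (hU : U' - U ∈ k) (hV : V' - V ∈ k) :
    extCurvature hkp Λ U' V' = extCurvature hkp Λ U V := by
  have hleft : ∀ {U U' : L} (V : L), U' - U ∈ k →
      extCurvature hkp Λ U' V = extCurvature hkp Λ U V := by
    intro U U' V hU
    rw [← add_sub_cancel U U', extCurvature_add_left, extCurvature_of_mem_k hg hgk hΛ hU,
      add_zero]
  rw [hleft _ hU, extCurvature_swap, hleft _ hV, ← extCurvature_swap]

theorem curvature_eq_extCurvature (hkp : IsCompl k.toSubmodule p) (g : LinearMap.BilinForm ℝ p)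
    (X Y : p) : curvature hkp g X Y = extCurvature hkp (leviCivita hkp g) (X : L) (Y : L) := by
  rw [curvature, extCurvature, extConnection_of_mem_p, extConnection_of_mem_p, sub_sub]
  congr 1

theorem ricci_apply (hkp : IsCompl k.toSubmodule p) (g : LinearMap.BilinForm ℝ p) (Y Z : p) :
    ricci hkp g Y Z = LinearMap.trace ℝ p (curvatureMap hkp g Y Z) := rfl

theorem ricci_symm [FiniteDimensional ℝ L] (hkp : IsCompl k.toSubmodule p)
    (hg : IsScalarProduct g) (hgk : IsAdInvariant hkp g) (Y Z : p) :
    ricci hkp g Y Z = ricci hkp g Z Y := by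
  have hΛ := isLeviCivita_leviCivita hkp hg
  have hbianchi : curvatureMap hkp g Y Z - curvatureMap hkp g Z Y = - curvature hkp g Y Z := by
    ext1 X
    have h := extCurvature_bianchi hΛ X Y Z
    simp only [prP_of_mem_p, ← curvature_eq_extCurvature] at h
    change curvature hkp g X Y Z - curvature hkp g X Z Y = - curvature hkp g Y Z X
    rw [curvature_eq_extCurvature hkp g X Z, extCurvature_swap, ← curvature_eq_extCurvature,
      LinearMap.neg_apply, sub_neg_eq_add, ← sub_eq_zero, ← h]
    abel
  have hskew : LinearMap.trace ℝ p (curvature hkp g Y Z) = 0 :=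
    hg.trace_eq_zero_of_skew fun X W => by
      simpa only [curvature_eq_extCurvature] using extCurvature_skew hgk hΛ Y Z X W
  rw [ricci_apply, ricci_apply, ← sub_eq_zero, ← map_sub, hbianchi, map_neg, hskew, neg_zero]

end ReductiveCurvature

section HorizontalLift

variable {L : Type*} [LieRing L] [LieAlgebra ℝ L]
variable {k : LieSubalgebra ℝ L} {p : Submodule ℝ L}

/-- `φ` lifts `p ≅ L / k` to the `B`-orthogonal complement of `k`. Computing with these lifts
makes the curvature independent of the choice of the complement `p`. -/
structure IsHorizontalLift (k : LieSubalgebra ℝ L) (B : LinearMap.BilinForm ℝ L)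
    (φ : p →ₗ[ℝ] L) : Prop where
  sub_mem : ∀ X : p, φ X - X ∈ k
  orthogonal : ∀ X : p, ∀ Z ∈ k, B (φ X) Z = 0

theorem exists_isHorizontalLift [FiniteDimensional ℝ L] (k : LieSubalgebra ℝ L)
    (p : Submodule ℝ L) {B : LinearMap.BilinForm ℝ L} (hB : IsScalarProduct B) :
    ∃ φ : p →ₗ[ℝ] L, IsHorizontalLift k B φ := by
  have hrefl : B.IsRefl := fun X Y h => by rw [hB.symm]; exact h
  have hc := LinearMap.BilinForm.isCompl_orthogonal_of_restrict_nondegenerate hrefl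
    (hB.restrict k.toSubmodule).nondegenerate
  refine ⟨Submodule.projection _ _ hc.symm ∘ₗ p.subtype, fun X => ?_, fun X Z hZ => ?_⟩
  · rw [← neg_sub]
    exact k.neg_mem (Submodule.sub_projection_mem hc.symm (X : L))
  · have h : (Submodule.projection _ _ hc.symm ∘ₗ p.subtype) X ∈ B.orthogonal k.toSubmodule :=
      Submodule.projection_apply_mem hc.symm (X : L)
    rw [hB.symm]
    exact h Z hZ

variable {B : LinearMap.BilinForm ℝ L} {φ : p →ₗ[ℝ] L}

theorem IsHorizontalLift.eq (hφ : IsHorizontalLift k B φ) (hB : IsScalarProduct B) {U : L} {X : p}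
    (hU : U - X ∈ k) (ho : ∀ Z ∈ k, B U Z = 0) : U = φ X := by
  have hk : U - φ X ∈ k := by
    have := k.sub_mem hU (hφ.sub_mem X)
    rwa [sub_sub_sub_cancel_right] at this
  rw [← sub_eq_zero]
  apply hB.eq_zero
  rw [map_sub B, LinearMap.sub_apply, ho _ hk, hφ.orthogonal _ _ hk, sub_self]

theorem IsHorizontalLift.prP (hφ : IsHorizontalLift k B φ) (hkp : IsCompl k.toSubmodule p) (X : p) :
    prP hkp (φ X) = X := by
  rw [← sub_add_cancel (φ X) (X : L), map_add, prP_of_mem_k hkp (hφ.sub_mem X), prP_of_mem_p,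
    zero_add]

/-- `B` is invariant under the adjoint representation. -/
def IsLieInvariant (B : LinearMap.BilinForm ℝ L) : Prop :=
  ∀ U V W : L, B ⁅U, V⁆ W + B V ⁅U, W⁆ = 0

theorem IsHorizontalLift.lie (hφ : IsHorizontalLift k B φ) (hB : IsScalarProduct B)
    (hBi : IsLieInvariant B) (hkp : IsCompl k.toSubmodule p) {Z : L} (hZ : Z ∈ k) (X : p) :
    ⁅Z, φ X⁆ = φ (adP hkp Z X) := by
  refine hφ.eq hB ?_ fun W hW => ?_
  · rw [← hφ.prP hkp X, ← prP_lie hkp hZ, hφ.prP]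
    exact sub_prP_mem hkp _
  · have := hBi Z (φ X) W
    rwa [hφ.orthogonal _ _ (k.lie_mem hZ hW), add_zero] at this

/-- The `p`-part of the bracket of horizontal lifts. -/
def liftBracketP (hkp : IsCompl k.toSubmodule p) (φ : p →ₗ[ℝ] L) : p →ₗ[ℝ] p →ₗ[ℝ] p :=
  LinearMap.mk₂ ℝ (fun X Y => prP hkp ⁅φ X, φ Y⁆)
    (by intros; simp) (by intros; simp) (by intros; simp) (by intros; simp)

/-- The `k`-part of the bracket of horizontal lifts. -/
def liftBracketK (hkp : IsCompl k.toSubmodule p) (φ : p →ₗ[ℝ] L) (X Y : p) : L :=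
  ⁅φ X, φ Y⁆ - φ (liftBracketP hkp φ X Y)

theorem liftBracketP_apply (hkp : IsCompl k.toSubmodule p) (φ : p →ₗ[ℝ] L) (X Y : p) :
    liftBracketP hkp φ X Y = prP hkp ⁅φ X, φ Y⁆ := rfl

theorem lie_lift (hkp : IsCompl k.toSubmodule p) (φ : p →ₗ[ℝ] L) (X Y : p) :
    ⁅φ X, φ Y⁆ = φ (liftBracketP hkp φ X Y) + liftBracketK hkp φ X Y :=
  (add_sub_cancel _ _).symm

theorem liftBracketP_swap (hkp : IsCompl k.toSubmodule p) (φ : p →ₗ[ℝ] L) (X Y : p) :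
    liftBracketP hkp φ X Y = - liftBracketP hkp φ Y X := by
  rw [liftBracketP_apply, liftBracketP_apply, ← lie_skew, map_neg]

theorem liftBracketK_swap (hkp : IsCompl k.toSubmodule p) (φ : p →ₗ[ℝ] L) (X Y : p) :
    liftBracketK hkp φ X Y = - liftBracketK hkp φ Y X := by
  rw [liftBracketK, liftBracketK, liftBracketP_swap, ← lie_skew, map_neg]
  abel

theorem liftBracketK_mem (hφ : IsHorizontalLift k B φ) (hkp : IsCompl k.toSubmodule p) (X Y : p) :
    liftBracketK hkp φ X Y ∈ k := by
  rw [← prP_eq_zero_iff hkp, liftBracketK, map_sub, hφ.prP, liftBracketP_apply, sub_self]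

/-- The scalar product on `p` induced by `B` through horizontal lifts. -/
def liftForm (B : LinearMap.BilinForm ℝ L) (φ : p →ₗ[ℝ] L) : LinearMap.BilinForm ℝ p :=
  B.compl₁₂ φ φ

theorem liftForm_apply (X Y : p) : liftForm B φ X Y = B (φ X) (φ Y) := rfl

theorem isScalarProduct_liftForm (hφ : IsHorizontalLift k B φ) (hB : IsScalarProduct B)
    (hkp : IsCompl k.toSubmodule p) : IsScalarProduct (liftForm B φ) := by
  refine ⟨fun X Y => hB.symm _ _, fun X hX => hB.pos _ fun h => hX ?_⟩
  rw [← hφ.prP hkp X, h, map_zero]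

theorem form_liftBracketK (hφ : IsHorizontalLift k B φ) (hB : IsScalarProduct B)
    (hkp : IsCompl k.toSubmodule p) {Z : L} (hZ : Z ∈ k) (X Y : p) :
    B Z (liftBracketK hkp φ X Y) = B Z ⁅φ X, φ Y⁆ := by
  rw [liftBracketK, map_sub, hB.symm Z (φ _), hφ.orthogonal _ _ hZ, sub_zero]

theorem liftForm_liftBracketP (hφ : IsHorizontalLift k B φ) (hB : IsScalarProduct B)
    (hkp : IsCompl k.toSubmodule p) (X Y Z : p) :
    liftForm B φ (liftBracketP hkp φ X Y) Z = B ⁅φ X, φ Y⁆ (φ Z) := by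
  rw [lie_lift hkp, map_add B, LinearMap.add_apply, hB.symm (liftBracketK hkp φ X Y),
    hφ.orthogonal _ _ (liftBracketK_mem hφ hkp X Y), add_zero, liftForm_apply]

theorem liftForm_adP_liftBracketK (hφ : IsHorizontalLift k B φ) (hB : IsScalarProduct B)
    (hBi : IsLieInvariant B) (hkp : IsCompl k.toSubmodule p) (X Y Z W : p) :
    liftForm B φ (adP hkp (liftBracketK hkp φ X Y) Z) W
      = B (liftBracketK hkp φ X Y) (liftBracketK hkp φ Z W) := by
  have hK := liftBracketK_mem hφ hkp X Y
  have hinv := hBi (φ Z) (liftBracketK hkp φ X Y) (φ W)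
  rw [liftForm_apply, ← hφ.lie hB hBi hkp hK, form_liftBracketK hφ hB hkp hK, ← lie_skew, map_neg,
    LinearMap.neg_apply]
  linarith

theorem liftForm_curvature [FiniteDimensional ℝ L] (hφ : IsHorizontalLift k B φ)
    (hB : IsScalarProduct B) (hBi : IsLieInvariant B) (hkp : IsCompl k.toSubmodule p)
    {g : LinearMap.BilinForm ℝ p} (hg : IsScalarProduct g) (hgk : IsAdInvariant hkp g)
    (X Y : p) (D : L →ₗ[ℝ] Module.End ℝ p) (hD : D = extConnection hkp (leviCivita hkp g)) :
    liftForm B φ (curvature hkp g X Y Y) X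
      = liftForm B φ (D (φ X) (D (φ Y) Y)) X - liftForm B φ (D (φ Y) (D (φ X) Y)) X
        - liftForm B φ (D (φ (liftBracketP hkp φ X Y)) Y) X
        + B (liftBracketK hkp φ X Y) (liftBracketK hkp φ X Y) := by
  have hlift : curvature hkp g X Y Y = D (φ X) (D (φ Y) Y) - D (φ Y) (D (φ X) Y)
      - D (φ (liftBracketP hkp φ X Y)) Y - adP hkp (liftBracketK hkp φ X Y) Y := by
    rw [curvature_eq_extCurvature, ← extCurvature_congr hg hgk (isLeviCivita_leviCivita hkp hg)
      (hφ.sub_mem X) (hφ.sub_mem Y), extCurvature_apply, ← hD, lie_lift hkp, map_add,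
      LinearMap.add_apply, ← sub_sub, hD,
      extConnection_of_mem_k hkp _ (liftBracketK_mem hφ hkp X Y)]
  rw [hlift]
  simp only [map_sub, LinearMap.sub_apply]
  rw [liftForm_adP_liftBracketK hφ hB hBi hkp, liftBracketK_swap hkp φ Y X, map_neg,
    sub_neg_eq_add]

section Ricci

variable {ι : Type*}

/-- The structure constants of the horizontal bracket. -/
def structureConst (hkp : IsCompl k.toSubmodule p) (B : LinearMap.BilinForm ℝ L) (φ : p →ₗ[ℝ] L)
    (e : Module.Basis ι ℝ p) (i j l : ι) : ℝ :=
  liftForm B φ (liftBracketP hkp φ (e i) (e j)) (e l)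

theorem structureConst_swap (hkp : IsCompl k.toSubmodule p) (e : Module.Basis ι ℝ p) (i j l : ι) :
    structureConst hkp B φ e j i l = - structureConst hkp B φ e i j l := by
  rw [structureConst, structureConst, liftBracketP_swap, map_neg, LinearMap.neg_apply]

theorem structureConst_rotate (hφ : IsHorizontalLift k B φ) (hB : IsScalarProduct B)
    (hBi : IsLieInvariant B) (hkp : IsCompl k.toSubmodule p) (e : Module.Basis ι ℝ p)
    (i j l : ι) : structureConst hkp B φ e j l i = structureConst hkp B φ e i j l := by
  have h := hBi (φ (e j)) (φ (e i)) (φ (e l))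
  simp only [structureConst, liftForm_liftBracketP hφ hB hkp]
  rw [← lie_skew, map_neg, LinearMap.neg_apply, hB.symm (φ (e i))] at h
  linarith

theorem structureConst_self (hφ : IsHorizontalLift k B φ) (hB : IsScalarProduct B)
    (hBi : IsLieInvariant B) (hkp : IsCompl k.toSubmodule p) (e : Module.Basis ι ℝ p)
    (i j : ι) : structureConst hkp B φ e i j i = 0 := by
  have hswap := structureConst_swap (B := B) (φ := φ) hkp e i i j
  rw [← structureConst_rotate hφ hB hBi hkp, ← structureConst_rotate hφ hB hBi hkp]
  linarith

/-- The factor by which the coefficients `⟨Λ(e i) (e j), e l⟩` of the Levi-Civita connection of the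
diagonal metric with entries `x` differ from the structure constants. -/
def lcCoeff (x : ι → ℝ) (i j l : ι) : ℝ := (x l - x i + x j) / (2 * x l)

theorem liftForm_extConnection_basis [FiniteDimensional ℝ L] (hφ : IsHorizontalLift k B φ)
    (hB : IsScalarProduct B) (hBi : IsLieInvariant B) (hkp : IsCompl k.toSubmodule p)
    {g : LinearMap.BilinForm ℝ p} (hg : IsScalarProduct g)
    (hgk : IsAdInvariant hkp g) {e : Module.Basis ι ℝ p} {x : ι → ℝ} (hx : ∀ i, 0 < x i)
    (hge : ∀ X i, g X (e i) = x i * liftForm B φ X (e i)) (i j l : ι) :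
    liftForm B φ (extConnection hkp (leviCivita hkp g) (φ (e i)) (e j)) (e l)
      = lcCoeff x i j l * structureConst hkp B φ e i j l := by
  set D : ι → Module.End ℝ p := fun i => extConnection hkp (leviCivita hkp g) (φ (e i))
  have hΛ := isLeviCivita_leviCivita hkp hg
  have t : ∀ i j l, g (D i (e j)) (e l) - g (D j (e i)) (e l)
      = x l * structureConst hkp B φ e i j l := by
    intro i j l
    have h := extConnection_torsion_free hΛ (φ (e i)) (φ (e j))
    rw [hφ.prP, hφ.prP] at h
    rw [← LinearMap.sub_apply, ← map_sub, h, hge]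
    rfl
  have m : ∀ i j l, g (D i (e j)) (e l) + g (D i (e l)) (e j) = 0 := by
    intro i j l
    rw [hg.symm (D i (e l))]
    exact extConnection_metric hgk hΛ _ _ _
  have r := structureConst_rotate hφ hB hBi hkp e
  have t1 := t i j l
  have t2 := t j l i
  have t3 := t l i j
  rw [r i j l] at t2
  rw [← r l i j] at t3
  have hkoszul : g (D i (e j)) (e l)
      = (x l - x i + x j) / 2 * structureConst hkp B φ e i j l := by
    linarith [m i j l, m j l i, m l i j]
  rw [hge] at hkoszul
  have := (hx l).ne'
  rw [lcCoeff]
  field_simp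
  linarith

variable [Fintype ι] [DecidableEq ι]

theorem ricci_basis [FiniteDimensional ℝ L] (hφ : IsHorizontalLift k B φ)
    (hB : IsScalarProduct B) (hBi : IsLieInvariant B) (hkp : IsCompl k.toSubmodule p)
    {g : LinearMap.BilinForm ℝ p} (hg : IsScalarProduct g)
    (hgk : IsAdInvariant hkp g) {e : Module.Basis ι ℝ p}
    (he : IsOrthonormalBasis (liftForm B φ) e) {x : ι → ℝ} (hx : ∀ i, 0 < x i)
    (hge : ∀ X i, g X (e i) = x i * liftForm B φ X (e i)) (a : ι) :
    ricci hkp g (e a) (e a)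
      = ∑ i, ((∑ l, (lcCoeff x l a i - lcCoeff x i a l * lcCoeff x a l i)
            * structureConst hkp B φ e i a l ^ 2)
          + B (liftBracketK hkp φ (e i) (e a)) (liftBracketK hkp φ (e i) (e a))) := by
  set D := extConnection hkp (leviCivita hkp g) with hD
  set τ := structureConst hkp B φ e
  have hDe : ∀ i j l, liftForm B φ (D (φ (e i)) (e j)) (e l) = lcCoeff x i j l * τ i j l :=
    liftForm_extConnection_basis hφ hB hBi hkp hg hgk hx hge
  have hDsum : ∀ i j, D (φ (e i)) (e j) = ∑ l, (lcCoeff x i j l * τ i j l) • e l := fun i j => by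
    simp_rw [← hDe, he.sum_smul]
  have hβsum : ∀ i j, liftBracketP hkp φ (e i) (e j) = ∑ l, τ i j l • e l := fun i j =>
    (he.sum_smul _).symm
  have hrotate : ∀ i j l, τ j l i = τ i j l := structureConst_rotate hφ hB hBi hkp e
  have hself : ∀ i j, τ i j i = 0 := structureConst_self hφ hB hBi hkp e
  rw [ricci_apply, he.trace]
  refine Finset.sum_congr rfl fun i _ => ?_
  change liftForm B φ (curvature hkp g (e i) (e a) (e a)) (e i) = _
  rw [liftForm_curvature hφ hB hBi hkp hg hgk _ _ D hD, hβsum, hDsum a a, hDsum i a]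
  simp only [map_sum, map_smul, LinearMap.sum_apply, LinearMap.smul_apply, hDe, smul_eq_mul, hself,
    mul_zero, Finset.sum_const_zero, zero_sub]
  rw [← Finset.sum_neg_distrib, ← Finset.sum_sub_distrib]
  congr 1
  refine Finset.sum_congr rfl fun l _ => ?_
  have hal : τ a l i = τ i a l := hrotate i a l
  have hla : τ l a i = - τ i a l := by
    rw [← hal]
    exact structureConst_swap hkp e a l i
  rw [hal, hla]
  ring

end Ricci

end HorizontalLift

section Naturality

variable {L : Type*} [LieRing L] [LieAlgebra ℝ L]
variable {k : LieSubalgebra ℝ L} {p : Submodule ℝ L}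

/-- The endomorphism `F` of the Lie algebra `L` preserves the splitting `L = k ⊕ p`, and `ψ` is its
restriction to `p`. -/
structure PreservesSplitting (k : LieSubalgebra ℝ L) (F : L →ₗ⁅ℝ⁆ L) (ψ : p ≃ₗ[ℝ] p) : Prop where
  map_mem : ∀ Z ∈ k, F Z ∈ k
  coe_apply : ∀ X : p, (ψ X : L) = F X

namespace PreservesSplitting

variable {F : L →ₗ⁅ℝ⁆ L} {ψ : p ≃ₗ[ℝ] p}

theorem prP (h : PreservesSplitting k F ψ) (hkp : IsCompl k.toSubmodule p) (U : L) :
    prP hkp (F U) = ψ (prP hkp U) := by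
  conv_lhs => rw [← prP_add_prK hkp U, map_add, map_add,
    prP_of_mem_k hkp (h.map_mem _ (prK hkp U).2), add_zero, ← h.coe_apply, prP_of_mem_p]

theorem prK (h : PreservesSplitting k F ψ) (hkp : IsCompl k.toSubmodule p) (U : L) :
    (prK hkp (F U) : L) = F (prK hkp U) := by
  conv_lhs => rw [← prP_add_prK hkp U, map_add, map_add, ← h.coe_apply, prK_of_mem_p, zero_add,
    prK_of_mem_k hkp (h.map_mem _ (HomRicci.prK hkp U).2)]

theorem bracketP (h : PreservesSplitting k F ψ) (hkp : IsCompl k.toSubmodule p) (X Y : p) :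
    bracketP hkp (ψ X) (ψ Y) = ψ (bracketP hkp X Y) := by
  rw [bracketP_apply, bracketP_apply, h.coe_apply, h.coe_apply, ← LieHom.map_lie, h.prP]

variable [FiniteDimensional ℝ L] {g : LinearMap.BilinForm ℝ p}

theorem leviCivita (h : PreservesSplitting k F ψ) (hkp : IsCompl k.toSubmodule p)
    (hg : IsScalarProduct g) (hgψ : ∀ X Y, g (ψ X) (ψ Y) = g X Y) (X Y : p) :
    leviCivita hkp g (ψ X) (ψ Y) = ψ (leviCivita hkp g X Y) := by
  have hLC := isLeviCivita_leviCivita hkp hg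
  have hsymm : ∀ X Y, g (ψ.symm X) Y = g X (ψ Y) := fun X Y => by
    rw [← hgψ, LinearEquiv.apply_symm_apply]
  have hpullback : IsLeviCivita hkp g (((HomRicci.leviCivita hkp g).compl₁₂
      ψ.toLinearMap ψ.toLinearMap).compr₂ ψ.symm.toLinearMap) := by
    refine ⟨fun X Y => ?_, fun X Y Z => ?_⟩ <;>
      simp only [LinearMap.compr₂_apply, LinearMap.compl₁₂_apply, LinearEquiv.coe_coe]
    · rw [← map_sub, hLC.torsion_free, h.bracketP, LinearEquiv.symm_apply_apply]
    · rw [hg.symm Y, hsymm, hsymm, hg.symm _ (ψ Y), hLC.metric]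
  have hunique := (existsUnique_isLeviCivita hkp g hg).unique hpullback hLC
  conv_rhs => rw [← hunique]
  simp

theorem curvature (h : PreservesSplitting k F ψ) (hkp : IsCompl k.toSubmodule p)
    (hg : IsScalarProduct g) (hgψ : ∀ X Y, g (ψ X) (ψ Y) = g X Y) (X Y Z : p) :
    curvature hkp g (ψ X) (ψ Y) (ψ Z) = ψ (curvature hkp g X Y Z) := by
  simp only [HomRicci.curvature, isotropyPart, LinearMap.sub_apply, LinearMap.comp_apply, map_sub,
    h.leviCivita hkp hg hgψ, h.bracketP, Submodule.subtype_apply, LieAlgebra.ad_apply, h.coe_apply,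
    ← LieHom.map_lie, h.prK, h.prP]

theorem ricci (h : PreservesSplitting k F ψ) (hkp : IsCompl k.toSubmodule p)
    (hg : IsScalarProduct g) (hgψ : ∀ X Y, g (ψ X) (ψ Y) = g X Y) (Y Z : p) :
    ricci hkp g (ψ Y) (ψ Z) = ricci hkp g Y Z := by
  have hconj : curvatureMap hkp g (ψ Y) (ψ Z) = ψ.conj (curvatureMap hkp g Y Z) := by
    ext1 X
    rw [LinearEquiv.conj_apply_apply]
    change HomRicci.curvature hkp g X (ψ Y) (ψ Z) = ψ (HomRicci.curvature hkp g (ψ.symm X) Y Z)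
    rw [← h.curvature hkp hg hgψ, LinearEquiv.apply_symm_apply]
  rw [ricci_apply, ricci_apply, hconj, LinearMap.trace_conj']

end PreservesSplitting

end Naturality

section MixedSqSum

variable {ι₁ ι₂ : Type*} [Fintype ι₁] [Fintype ι₂]

/-- The sum `[112]` of the squares of the components of `τ` with two indices in the first block and
one in the second. -/
def mixedSqSum (τ : ι₁ ⊕ ι₂ → ι₁ ⊕ ι₂ → ι₁ ⊕ ι₂ → ℝ) : ℝ :=
  ∑ j : ι₁, ∑ i : ι₁, ∑ l : ι₂, τ (Sum.inl i) (Sum.inl j) (Sum.inr l) ^ 2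

theorem mixedSqSum_pos {τ : ι₁ ⊕ ι₂ → ι₁ ⊕ ι₂ → ι₁ ⊕ ι₂ → ℝ} {i j : ι₁} {l : ι₂}
    (h : τ (Sum.inl i) (Sum.inl j) (Sum.inr l) ≠ 0) : 0 < mixedSqSum τ :=
  Finset.sum_pos' (fun _ _ => by positivity) ⟨j, Finset.mem_univ _,
    Finset.sum_pos' (fun _ _ => by positivity) ⟨i, Finset.mem_univ _,
      Finset.sum_pos' (fun _ _ => by positivity) ⟨l, Finset.mem_univ _, by positivity⟩⟩⟩

variable {τ : ι₁ ⊕ ι₂ → ι₁ ⊕ ι₂ → ι₁ ⊕ ι₂ → ℝ}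

theorem mixedSqSum_eq_of_rotate (hswap : ∀ i j l, τ j i l = -τ i j l)
    (hrotate : ∀ i j l, τ j l i = τ i j l) :
    ∑ j : ι₁, ∑ i : ι₂, ∑ l : ι₁, τ (Sum.inr i) (Sum.inl j) (Sum.inl l) ^ 2 = mixedSqSum τ := by
  refine Finset.sum_congr rfl fun j _ => ?_
  rw [Finset.sum_comm]
  simp_rw [← hrotate (Sum.inr _), hswap _ (Sum.inl j), neg_sq]

theorem mixedSqSum_swap_eq_of_rotate (hrotate : ∀ i j l, τ j l i = τ i j l) :
    ∑ j : ι₁, ∑ i : ι₂, ∑ l : ι₂, τ (Sum.inr i) (Sum.inl j) (Sum.inr l) ^ 2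
      = mixedSqSum fun i j l : ι₂ ⊕ ι₁ => τ i.swap j.swap l.swap := by
  simp_rw [mixedSqSum, Sum.swap_inl, Sum.swap_inr, hrotate (Sum.inr _) (Sum.inr _)]
  rw [Finset.sum_comm]
  exact Finset.sum_congr rfl fun i _ => Finset.sum_comm

theorem sum_lcCoeff (hswap : ∀ i j l, τ j i l = -τ i j l)
    (hrotate : ∀ i j l, τ j l i = τ i j l) {x : ι₁ ⊕ ι₂ → ℝ} {x₁ x₂ : ℝ} (h₁ : x₁ ≠ 0)
    (h₂ : x₂ ≠ 0) (hx₁ : ∀ i, x (Sum.inl i) = x₁) (hx₂ : ∀ i, x (Sum.inr i) = x₂) :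
    ∑ a : ι₁, ∑ i, ∑ l, (lcCoeff x l (Sum.inl a) i
        - lcCoeff x i (Sum.inl a) l * lcCoeff x (Sum.inl a) l i) * τ i (Sum.inl a) l ^ 2
      = (∑ j : ι₁, ∑ i : ι₁, ∑ l : ι₁, τ (Sum.inl i) (Sum.inl j) (Sum.inl l) ^ 2) / 4
        + (1 - x₂ / (2 * x₁)) * mixedSqSum τ
        + x₁ ^ 2 / (4 * x₂ ^ 2)
          * mixedSqSum fun i j l : ι₂ ⊕ ι₁ => τ i.swap j.swap l.swap := by
  simp only [Fintype.sum_sum_type, lcCoeff, hx₁, hx₂, Finset.sum_add_distrib, ← Finset.mul_sum,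
    mixedSqSum_eq_of_rotate hswap hrotate, mixedSqSum_swap_eq_of_rotate hrotate]
  rw [← mixedSqSum]
  field_simp
  ring

end MixedSqSum

/-- The numbers that determine the Ricci tensors of the metrics `x Q|p₁ ⊕ y Q|p₂`, where `Q` comes
from a bi-invariant scalar product: `dᵢ` is the dimension of `pᵢ`, `A` and `C` are the sums `[112]`
and `[221]` of squares of structure constants, and `Eᵢ` is the trace over `pᵢ` of the part of the
Ricci tensor that does not depend on `x` and `y`. -/
structure RicciData where
  d₁ : ℝ
  d₂ : ℝ
  E₁ : ℝ
  E₂ : ℝ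
  A : ℝ
  C : ℝ
  d₁_pos : 0 < d₁
  d₂_pos : 0 < d₂
  A_pos : 0 < A
  C_pos : 0 < C
  A_le : A ≤ E₁
  C_le : C ≤ E₂

namespace RicciData

/-- The data after an exchange of the two summands. -/
def swap (P : RicciData) : RicciData :=
  ⟨P.d₂, P.d₁, P.E₂, P.E₁, P.C, P.A, P.d₂_pos, P.d₁_pos, P.C_pos, P.A_pos, P.C_le, P.A_le⟩

/-- The factor `r₁` in `Ric = r₁ Q|p₁ ⊕ r₂ Q|p₂` for the metric `x Q|p₁ ⊕ y Q|p₂`. -/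
def r₁ (P : RicciData) (x y : ℝ) : ℝ :=
  (P.E₁ - P.A / 2 * (y / x) + P.C / 4 * (x ^ 2 / y ^ 2)) / P.d₁

/-- The factor `r₂` in `Ric = r₁ Q|p₁ ⊕ r₂ Q|p₂` for the metric `x Q|p₁ ⊕ y Q|p₂`. -/
def r₂ (P : RicciData) (x y : ℝ) : ℝ := P.swap.r₁ y x

/-- The scalar curvature of the metric `x Q|p₁ ⊕ y Q|p₂`. -/
def scal (P : RicciData) (x y : ℝ) : ℝ := P.d₁ * P.r₁ x y / x + P.d₂ * P.r₂ x y / y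

end RicciData

section DiagonalRicci

variable {L : Type*} [LieRing L] [LieAlgebra ℝ L]
variable {k : LieSubalgebra ℝ L} {p : Submodule ℝ L} {p₁ p₂ : Submodule ℝ p}
variable {B : LinearMap.BilinForm ℝ L} {φ : p →ₗ[ℝ] L}

section

variable {ι₁ ι₂ : Type*} [Fintype ι₁] [Fintype ι₂]

theorem structureConst_reindex {ι κ : Type*} (hkp : IsCompl k.toSubmodule p)
    (e : Module.Basis ι ℝ p) (f : ι ≃ κ) (i j l : κ) :
    structureConst hkp B φ (e.reindex f) i j l
      = structureConst hkp B φ e (f.symm i) (f.symm j) (f.symm l) := by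
  simp only [structureConst, Module.Basis.reindex_apply]

theorem mixedSqSum_structureConst_pos [DecidableEq ι₁] [DecidableEq ι₂]
    (hkp : IsCompl k.toSubmodule p) {e : Module.Basis (ι₁ ⊕ ι₂) ℝ p}
    (he : IsAdaptedBasis (liftForm B φ) p₁ p₂ e) (ho : ∀ X ∈ p₁, ∀ Y ∈ p₂, liftForm B φ X Y = 0)
    (hp₁ : ¬ ∀ X ∈ p₁, ∀ Y ∈ p₁, liftBracketP hkp φ X Y ∈ p₁) :
    0 < mixedSqSum (structureConst hkp B φ e) := by
  contrapose! hp₁ with hle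
  have hzero : ∀ i j l, structureConst hkp B φ e (Sum.inl i) (Sum.inl j) (Sum.inr l) = 0 := by
    intro i j l
    by_contra h
    exact hle.not_gt (mixedSqSum_pos h)
  have hbasis : ∀ i j, liftBracketP hkp φ (e (Sum.inl i)) (e (Sum.inl j)) ∈ p₁ := by
    intro i j
    rw [← he.isOrthonormalBasis.sum_smul (liftBracketP hkp φ _ _), Fintype.sum_sum_type]
    refine p₁.add_mem (p₁.sum_mem fun l _ => p₁.smul_mem _ (he.inl_mem l))
      (p₁.sum_mem fun l _ => ?_)
    change structureConst hkp B φ e _ _ _ • _ ∈ p₁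
    rw [hzero, zero_smul]
    exact p₁.zero_mem
  intro X hX Y hY
  rw [← he.sum_smul_inl ho hX, ← he.sum_smul_inl ho hY]
  simp only [map_sum, map_smul, LinearMap.sum_apply, LinearMap.smul_apply]
  exact p₁.sum_mem fun i _ => p₁.smul_mem _ <| p₁.sum_mem fun j _ => p₁.smul_mem _ (hbasis j i)

/-- The trace over the first block of `e` of the part of the Ricci tensor that is the same for all
diagonal metrics. -/
def ricciTrace (hkp : IsCompl k.toSubmodule p) (B : LinearMap.BilinForm ℝ L) (φ : p →ₗ[ℝ] L)
    (e : Module.Basis (ι₁ ⊕ ι₂) ℝ p) : ℝ :=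
  (∑ j : ι₁, ∑ i : ι₁, ∑ l : ι₁,
      structureConst hkp B φ e (Sum.inl i) (Sum.inl j) (Sum.inl l) ^ 2) / 4
    + mixedSqSum (structureConst hkp B φ e)
    + ∑ a : ι₁, ∑ i, B (liftBracketK hkp φ (e i) (e (Sum.inl a)))
        (liftBracketK hkp φ (e i) (e (Sum.inl a)))

theorem mixedSqSum_le_ricciTrace (hB : IsScalarProduct B) (hkp : IsCompl k.toSubmodule p)
    (e : Module.Basis (ι₁ ⊕ ι₂) ℝ p) :
    mixedSqSum (structureConst hkp B φ e) ≤ ricciTrace hkp B φ e := by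
  have hK : 0 ≤ ∑ a : ι₁, ∑ i, B (liftBracketK hkp φ (e i) (e (Sum.inl a)))
      (liftBracketK hkp φ (e i) (e (Sum.inl a))) :=
    Finset.sum_nonneg fun _ _ => Finset.sum_nonneg fun _ _ => hB.nonneg _
  rw [ricciTrace, add_right_comm]
  exact le_add_of_nonneg_left (by positivity)

variable [DecidableEq ι₁] [DecidableEq ι₂] [FiniteDimensional ℝ L]

theorem sum_ricci_diagForm (hφ : IsHorizontalLift k B φ) (hB : IsScalarProduct B)
    (hBi : IsLieInvariant B) (hkp : IsCompl k.toSubmodule p) (h : IsCompl p₁ p₂)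
    (ho : ∀ X ∈ p₁, ∀ Y ∈ p₂, liftForm B φ X Y = 0) {x y : ℝ} (hx : 0 < x) (hy : 0 < y)
    (hgk : IsAdInvariant hkp (diagForm h (liftForm B φ) x y)) {e : Module.Basis (ι₁ ⊕ ι₂) ℝ p}
    (he : IsAdaptedBasis (liftForm B φ) p₁ p₂ e) :
    ∑ a, ricci hkp (diagForm h (liftForm B φ) x y) (e (Sum.inl a)) (e (Sum.inl a))
      = ricciTrace hkp B φ e - mixedSqSum (structureConst hkp B φ e) / 2 * (y / x)
        + mixedSqSum (structureConst hkp B φ (e.reindex (Equiv.sumComm ι₁ ι₂))) / 4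
          * (x ^ 2 / y ^ 2) := by
  have hQ := isScalarProduct_liftForm hφ hB hkp
  have hswap : structureConst hkp B φ (e.reindex (Equiv.sumComm ι₁ ι₂))
      = fun i j l => structureConst hkp B φ e i.swap j.swap l.swap :=
    funext₃ fun _ _ _ => structureConst_reindex hkp e _ _ _ _
  have hpos : ∀ i : ι₁ ⊕ ι₂, 0 < Sum.elim (fun _ => x) (fun _ => y) i := by
    rintro (_ | _) <;> assumption
  simp only [ricci_basis hφ hB hBi hkp (isScalarProduct_diagForm h hQ hx hy) hgk
    he.isOrthonormalBasis hpos (he.diagForm_apply h hQ ho x y), Finset.sum_add_distrib]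
  rw [sum_lcCoeff (structureConst_swap hkp e) (structureConst_rotate hφ hB hBi hkp e) hx.ne' hy.ne'
    (fun _ => rfl) (fun _ => rfl), hswap, ricciTrace]
  field_simp
  ring

theorem eq_of_ricci_eq_diagForm [Nonempty ι₁] (hφ : IsHorizontalLift k B φ)
    (hB : IsScalarProduct B) (hBi : IsLieInvariant B) (hkp : IsCompl k.toSubmodule p)
    (h : IsCompl p₁ p₂) (ho : ∀ X ∈ p₁, ∀ Y ∈ p₂, liftForm B φ X Y = 0) {x y : ℝ} (hx : 0 < x)
    (hy : 0 < y) (hgk : IsAdInvariant hkp (diagForm h (liftForm B φ) x y))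
    {e : Module.Basis (ι₁ ⊕ ι₂) ℝ p} (he : IsAdaptedBasis (liftForm B φ) p₁ p₂ e) {c₁ c₂ : ℝ}
    (hRic : ricci hkp (diagForm h (liftForm B φ) x y) = diagForm h (liftForm B φ) c₁ c₂) :
    c₁ = (ricciTrace hkp B φ e - mixedSqSum (structureConst hkp B φ e) / 2 * (y / x)
        + mixedSqSum (structureConst hkp B φ (e.reindex (Equiv.sumComm ι₁ ι₂))) / 4
          * (x ^ 2 / y ^ 2)) / Fintype.card ι₁ := by
  have htrace := sum_ricci_diagForm hφ hB hBi hkp h ho hx hy hgk he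
  simp only [hRic, diagForm_apply_of_mem_left h _ c₁ c₂ (he.inl_mem _) (he.inl_mem _),
    he.isOrthonormalBasis _ _, if_true, mul_one, Finset.sum_const, Finset.card_univ,
    nsmul_eq_mul] at htrace
  rw [← htrace, mul_div_cancel_left₀ _ (Nat.cast_ne_zero.2 Fintype.card_ne_zero)]

end

theorem exists_ricciData [FiniteDimensional ℝ L] (hφ : IsHorizontalLift k B φ)
    (hB : IsScalarProduct B) (hBi : IsLieInvariant B) (hkp : IsCompl k.toSubmodule p)
    (h : IsCompl p₁ p₂) (ho : ∀ X ∈ p₁, ∀ Y ∈ p₂, liftForm B φ X Y = 0)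
    (hgk : ∀ x y, IsAdInvariant hkp (diagForm h (liftForm B φ) x y))
    (hRic : ∀ x y, 0 < x → 0 < y → ∃ c₁ c₂, ricci hkp (diagForm h (liftForm B φ) x y)
      = diagForm h (liftForm B φ) c₁ c₂)
    (hp₁ : p₁ ≠ ⊥) (hp₂ : p₂ ≠ ⊥) (hA : ¬ ∀ X ∈ p₁, ∀ Y ∈ p₁, liftBracketP hkp φ X Y ∈ p₁)
    (hC : ¬ ∀ X ∈ p₂, ∀ Y ∈ p₂, liftBracketP hkp φ X Y ∈ p₂) :
    ∃ P : RicciData, P.d₁ = Module.finrank ℝ p₁ ∧ P.d₂ = Module.finrank ℝ p₂ ∧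
      ∀ x y, 0 < x → 0 < y → ricci hkp (diagForm h (liftForm B φ) x y)
        = diagForm h (liftForm B φ) (P.r₁ x y) (P.r₂ x y) := by
  have hQ := isScalarProduct_liftForm hφ hB hkp
  have ho' : ∀ X ∈ p₂, ∀ Y ∈ p₁, liftForm B φ X Y = 0 := fun X hX Y hY => by
    rw [hQ.symm, ho Y hY X hX]
  obtain ⟨e, he⟩ := exists_isAdaptedBasis h hQ ho
  set e' := e.reindex (Equiv.sumComm _ _)
  have he' : IsAdaptedBasis (liftForm B φ) p₂ p₁ e' := he.swap
  have hd₁ := Submodule.one_le_finrank_iff.2 hp₁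
  have hd₂ := Submodule.one_le_finrank_iff.2 hp₂
  have : Nonempty (Fin (Module.finrank ℝ p₁)) := ⟨⟨0, hd₁⟩⟩
  have : Nonempty (Fin (Module.finrank ℝ p₂)) := ⟨⟨0, hd₂⟩⟩
  let P : RicciData :=
    { d₁ := Module.finrank ℝ p₁
      d₂ := Module.finrank ℝ p₂
      E₁ := ricciTrace hkp B φ e
      E₂ := ricciTrace hkp B φ e'
      A := mixedSqSum (structureConst hkp B φ e)
      C := mixedSqSum (structureConst hkp B φ e')
      d₁_pos := Nat.cast_pos.2 hd₁
      d₂_pos := Nat.cast_pos.2 hd₂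
      A_pos := mixedSqSum_structureConst_pos hkp he ho hA
      C_pos := mixedSqSum_structureConst_pos hkp he' ho' hC
      A_le := mixedSqSum_le_ricciTrace hB hkp e
      C_le := mixedSqSum_le_ricciTrace hB hkp e' }
  refine ⟨P, rfl, rfl, fun x y hx hy => ?_⟩
  obtain ⟨c₁, c₂, hc⟩ := hRic x y hx hy
  have hc₁ : c₁ = P.r₁ x y := by
    rw [eq_of_ricci_eq_diagForm hφ hB hBi hkp h ho hx hy (hgk x y) he hc, Fintype.card_fin]
    rfl
  have hc₂ : c₂ = P.r₂ x y := by
    have hgk' := hgk x y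
    rw [← diagForm_comm] at hgk'
    rw [← diagForm_comm, ← diagForm_comm h] at hc
    rw [eq_of_ricci_eq_diagForm hφ hB hBi hkp h.symm ho' hy hx hgk' he' hc, Fintype.card_fin]
    have hee : e'.reindex (Equiv.sumComm _ _) = e := by ext i; simp [e']
    rw [hee]
    rfl
  rw [← hc₁, ← hc₂, hc]

theorem scalarCurvature_diagForm [FiniteDimensional ℝ L] (hkp : IsCompl k.toSubmodule p)
    (h : IsCompl p₁ p₂) {Q : LinearMap.BilinForm ℝ p} (hQ : IsScalarProduct Q) {x y r₁ r₂ : ℝ}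
    (hx : 0 < x) (hy : 0 < y)
    (hRic : ricci hkp (diagForm h Q x y) = diagForm h Q r₁ r₂) :
    scalarCurvature hkp (diagForm h Q x y)
      = Module.finrank ℝ p₁ * r₁ / x + Module.finrank ℝ p₂ * r₂ / y := by
  have hg := isScalarProduct_diagForm h hQ hx hy
  rw [scalarCurvature, dif_pos hg.nondegenerate, hRic]
  exact trace_rieszMap_diagForm h hQ hx hy r₁ r₂

/-- The Ricci flow in the coordinates `x, y` of the metrics `x Q|p₁ ⊕ y Q|p₂`. -/
structure RicciData.IsSol (P : RicciData) (x y : ℝ → ℝ) (J : Set ℝ) : Prop where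
  pos₁ : ∀ t ∈ J, 0 < x t
  pos₂ : ∀ t ∈ J, 0 < y t
  deriv₁ : ∀ t ∈ J, HasDerivWithinAt x (-2 * P.r₁ (x t) (y t)) J t
  deriv₂ : ∀ t ∈ J, HasDerivWithinAt y (-2 * P.r₂ (x t) (y t)) J t

theorem hasDerivWithinAt_of_diagForm {V : Type*} [AddCommGroup V] [Module ℝ V]
    {p₁ p₂ : Submodule ℝ V} (h : IsCompl p₁ p₂) {Q : LinearMap.BilinForm ℝ V}
    (hQ : IsScalarProduct Q) (hp₁ : p₁ ≠ ⊥) {x y : ℝ → ℝ} {x' y' t : ℝ} {J : Set ℝ}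
    (hd : ∀ X Y, HasDerivWithinAt (fun s => diagForm h Q (x s) (y s) X Y)
      (diagForm h Q x' y' X Y) J t) : HasDerivWithinAt x x' J t := by
  obtain ⟨X, hX, hX0⟩ := Submodule.exists_mem_ne_zero_of_ne_bot hp₁
  have hdX := (hd X X).div_const (Q X X)
  simpa only [diagForm_apply_of_mem_left h Q _ _ hX hX, mul_div_assoc,
    div_self (hQ.pos X hX0).ne', mul_one] using hdX

theorem isHRF_iff (hkp : IsCompl k.toSubmodule p) (h : IsCompl p₁ p₂)
    {Q : LinearMap.BilinForm ℝ p} (hQ : IsScalarProduct Q) (hp₁ : p₁ ≠ ⊥) (hp₂ : p₂ ≠ ⊥)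
    {P : RicciData} (hP : ∀ x y, 0 < x → 0 < y →
      ricci hkp (diagForm h Q x y) = diagForm h Q (P.r₁ x y) (P.r₂ x y))
    {x y : ℝ → ℝ} {J : Set ℝ} : IsHRF hkp h Q x y J ↔ P.IsSol x y J := by
  have hflow : ∀ t, 0 < x t → 0 < y t → ∀ X Y, -2 * ricci hkp (diagForm h Q (x t) (y t)) X Y
      = diagForm h Q (-2 * P.r₁ (x t) (y t)) (-2 * P.r₂ (x t) (y t)) X Y := fun t hx hy X Y => by
    rw [hP _ _ hx hy, diagForm_apply, diagForm_apply]
    ring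
  refine ⟨fun hf => ?_, fun hf => ⟨hf.pos₁, hf.pos₂, fun t ht => ?_, fun t ht X Y => ?_⟩⟩
  · have hd : ∀ t ∈ J, ∀ X Y, HasDerivWithinAt (fun s => diagForm h Q (x s) (y s) X Y)
        (diagForm h Q (-2 * P.r₁ (x t) (y t)) (-2 * P.r₂ (x t) (y t)) X Y) J t :=
      fun t ht X Y => by
        rw [← hflow t (hf.pos₁ t ht) (hf.pos₂ t ht)]
        exact hf.flow.flow t ht X Y
    refine ⟨hf.pos₁, hf.pos₂, fun t ht => hasDerivWithinAt_of_diagForm h hQ hp₁ (hd t ht),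
      fun t ht => hasDerivWithinAt_of_diagForm h.symm hQ hp₂ (y := x)
        (y' := -2 * P.r₁ (x t) (y t)) fun X Y => ?_⟩
    simp only [diagForm_comm h]
    exact hd t ht X Y
  · exact isScalarProduct_diagForm h hQ (hf.pos₁ t ht) (hf.pos₂ t ht)
  · rw [hflow t (hf.pos₁ t ht) (hf.pos₂ t ht)]
    exact ((hf.deriv₁ t ht).mul_const _).add ((hf.deriv₂ t ht).mul_const _)

end DiagonalRicci

open Filter Topology

section Extension

variable {E : Type*} [NormedAddCommGroup E] [NormedSpace ℝ E] {v : E → E} {X Y : ℝ → E}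
  {a b c : ℝ}

theorem hasDerivWithinAt_Iic_of_tendsto (hab : a < b) (hv : ContinuousAt v (X b))
    (hX : ∀ t ∈ Ioo a b, HasDerivAt X (v (X t)) t) (hl : Tendsto X (𝓝[<] b) (𝓝 (X b))) :
    HasDerivWithinAt X (v (X b)) (Iic b) b := by
  have hderiv : ∀ᶠ t in 𝓝[<] b, v (X t) = deriv X t := by
    filter_upwards [Ioo_mem_nhdsLT hab] with t ht using (hX t ht).deriv.symm
  exact hasDerivWithinAt_Iic_of_tendsto_deriv
    (fun t ht => (hX t ht).differentiableAt.differentiableWithinAt)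
    (hl.mono_left (nhdsWithin_mono _ Ioo_subset_Iio_self)) (Ioo_mem_nhdsLT hab)
    ((hv.tendsto.comp hl).congr' hderiv)

theorem hasDerivWithinAt_piecewise_Iio (hab : a < b) (hv : ContinuousAt v (Y b))
    (hX : ∀ t ∈ Ico a b, HasDerivWithinAt X (v (X t)) (Ico a b) t)
    (hl : Tendsto X (𝓝[<] b) (𝓝 (Y b))) (hY : ∀ t ∈ Ico b c, HasDerivAt Y (v (Y t)) t)
    {t : ℝ} (ht : t ∈ Ico a c) :
    HasDerivWithinAt ((Iio b).piecewise X Y) (v ((Iio b).piecewise X Y t)) (Ico a c) t := by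
  set Z := (Iio b).piecewise X Y
  have hZX : EqOn Z X (Iio b) := piecewise_eqOn _ _ _
  have hZY : EqOn Z Y (Ici b) := fun s hs => piecewise_eq_of_notMem _ _ _ (notMem_Iio.2 hs)
  rcases lt_trichotomy t b with htb | rfl | hbt
  · rw [hZX htb]
    have hnhds : Ico a b ∈ 𝓝[Ico a c] t := by
      filter_upwards [self_mem_nhdsWithin, mem_nhdsWithin_of_mem_nhds (Iio_mem_nhds htb)] with s hs
        hsb using ⟨hs.1, hsb⟩
    exact ((hX t ⟨ht.1, htb⟩).mono_of_mem_nhdsWithin hnhds).congr_of_eventuallyEq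
      (hZX.eventuallyEq_of_mem (mem_nhdsWithin_of_mem_nhds (Iio_mem_nhds htb))) (hZX htb)
  · have hZt : Z t = Y t := hZY self_mem_Ici
    have hleft : HasDerivWithinAt Z (v (Z t)) (Iic t) t := by
      refine hasDerivWithinAt_Iic_of_tendsto hab (by rwa [hZt]) (fun s hs => ?_) ?_
      · rw [hZX hs.2]
        have hXs := (hX s (Ioo_subset_Ico_self hs)).hasDerivAt (Ico_mem_nhds hs.1 hs.2)
        exact hXs.congr_of_eventuallyEq (hZX.eventuallyEq_of_mem (Iio_mem_nhds hs.2))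
      · rw [hZt]
        exact hl.congr' (hZX.symm.eventuallyEq_of_mem self_mem_nhdsWithin)
    have hright : HasDerivWithinAt Z (v (Z t)) (Ici t) t := by
      rw [hZt]
      exact (hY t ⟨le_rfl, ht.2⟩).hasDerivWithinAt.congr hZY hZt
    have hunion := hleft.union hright
    rw [Iic_union_Ici] at hunion
    exact hunion.mono (subset_univ _)
  · rw [hZY hbt.le]
    exact ((hY t ⟨hbt.le, ht.2⟩).congr_of_eventuallyEq
      ((hZY.mono Ioi_subset_Ici_self).eventuallyEq_of_mem (Ioi_mem_nhds hbt))).hasDerivWithinAt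

theorem exists_hasDerivWithinAt_extension [CompleteSpace E] {l : E} (hab : a < b)
    (hv : ContDiffAt ℝ 1 v l) (hX : ∀ t ∈ Ico a b, HasDerivWithinAt X (v (X t)) (Ico a b) t)
    (hl : Tendsto X (𝓝[<] b) (𝓝 l)) {U : Set E} (hU : U ∈ 𝓝 l) :
    ∃ c > b, ∃ Z : ℝ → E, EqOn Z X (Ico a b) ∧
      (∀ t ∈ Ico a c, HasDerivWithinAt Z (v (Z t)) (Ico a c) t) ∧ ∀ t ∈ Ico b c, Z t ∈ U := by
  obtain ⟨Y, rfl, ε, hε, hY⟩ :=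
    hv.exists_forall_mem_closedBall_exists_eq_forall_mem_Ioo_hasDerivAt₀ b
  have hYU : ∀ᶠ t in 𝓝 b, Y t ∈ U :=
    (hY b ⟨by linarith, by linarith⟩).continuousAt.eventually_mem hU
  obtain ⟨c, hbc, hc⟩ : ∃ c > b, ∀ t ∈ Ico b c, t < b + ε ∧ Y t ∈ U :=
    mem_nhdsGE_iff_exists_Ico_subset.1 <| mem_nhdsWithin_of_mem_nhds <|
      (eventually_lt_nhds (by linarith)).and hYU
  refine ⟨c, hbc, (Iio b).piecewise X Y, (piecewise_eqOn _ _ _).mono fun t ht => ht.2,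
    fun t ht => hasDerivWithinAt_piecewise_Iio hab hv.continuousAt hX hl (fun s hs => ?_) ht,
    fun t ht => ?_⟩
  · exact hY s ⟨by linarith [hs.1], (hc s hs).1⟩
  · rw [piecewise_eq_of_notMem _ _ _ (notMem_Iio.2 ht.1)]
    exact (hc t ht).2

end Extension

theorem convex_timeInterval (T : EReal) : Convex ℝ (timeInterval T) :=
  OrdConnected.convex ⟨fun _ hs _ ht _ hu =>
    ⟨hs.1.trans hu.1, (EReal.coe_le_coe_iff.2 hu.2).trans_lt ht.2⟩⟩

theorem timeInterval_coe (b : ℝ) : timeInterval (b : EReal) = Ico 0 b := by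
  ext t
  simp only [timeInterval, EReal.coe_lt_coe_iff, mem_ofPred_eq, mem_Ico]

theorem zero_mem_timeInterval {T : EReal} (hT : 0 < T) : (0 : ℝ) ∈ timeInterval T :=
  ⟨le_rfl, hT⟩

theorem exists_eq_coe_of_forall_lt {T : EReal} (hT : 0 < T) {M : ℝ}
    (hM : ∀ t ∈ timeInterval T, t < M) : ∃ b : ℝ, T = b := by
  induction T with
  | bot => exact absurd hT not_lt_bot
  | coe b => exact ⟨b, rfl⟩
  | top =>
    have h0 := hM 0 (zero_mem_timeInterval hT)
    exact absurd (hM M ⟨h0.le, EReal.coe_lt_top M⟩) (lt_irrefl M)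

namespace RicciData

variable {P : RicciData} {x y : ℝ → ℝ} {J : Set ℝ}

theorem IsSol.swap (h : P.IsSol x y J) : P.swap.IsSol y x J :=
  ⟨h.pos₂, h.pos₁, h.deriv₂, h.deriv₁⟩

theorem scal_swap (P : RicciData) (x y : ℝ) : P.swap.scal y x = P.scal x y := add_comm _ _

theorem r₂_eq (P : RicciData) (x y : ℝ) :
    P.r₂ x y = (P.E₂ - P.C / 2 * (x / y) + P.A / 4 * (y ^ 2 / x ^ 2)) / P.d₂ := rfl

theorem scal_eq (P : RicciData) {x y : ℝ} (hx : x ≠ 0) (hy : y ≠ 0) :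
    P.scal x y = P.E₁ / x + P.E₂ / y - P.A / 4 * (y / x ^ 2) - P.C / 4 * (x / y ^ 2) := by
  have hd₁ := P.d₁_pos
  have hd₂ := P.d₂_pos
  rw [scal, r₂_eq, r₁]
  field_simp
  ring

theorem scal_self_pos (P : RicciData) {x : ℝ} (hx : 0 < x) : 0 < P.scal x x := by
  have heq : P.scal x x = (P.E₁ + P.E₂ - P.A / 4 - P.C / 4) / x := by
    rw [P.scal_eq hx.ne' hx.ne']
    field_simp
  rw [heq]
  exact div_pos (by linarith [P.A_pos, P.C_pos, P.A_le, P.C_le]) hx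

theorem IsSol.hasDerivWithinAt_scal (h : P.IsSol x y J) {t : ℝ} (ht : t ∈ J) :
    HasDerivWithinAt (fun s => P.scal (x s) (y s))
      (2 * (P.d₁ * (P.r₁ (x t) (y t) / x t) ^ 2 + P.d₂ * (P.r₂ (x t) (y t) / y t) ^ 2)) J t := by
  have hd₁ := P.d₁_pos
  have hd₂ := P.d₂_pos
  have hx := (h.pos₁ t ht).ne'
  have hy := (h.pos₂ t ht).ne'
  have hx' := h.deriv₁ t ht
  have hy' := h.deriv₂ t ht
  have hscal := ((((hasDerivWithinAt_const t J P.E₁).div hx' hx).add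
    ((hasDerivWithinAt_const t J P.E₂).div hy' hy)).sub
    ((hy'.div (hx'.pow 2) (pow_ne_zero 2 hx)).const_mul (P.A / 4))).sub
    ((hx'.div (hy'.pow 2) (pow_ne_zero 2 hy)).const_mul (P.C / 4))
  -- `∂ scal/∂x = -d₁ r₁ / x ^ 2` and `∂ scal/∂y = -d₂ r₂ / y ^ 2`
  refine (hscal.congr_deriv ?_).congr_of_mem
    (fun s hs => P.scal_eq (h.pos₁ s hs).ne' (h.pos₂ s hs).ne') ht
  simp only [r₂_eq, r₁, Pi.pow_apply]
  field_simp
  ring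

theorem IsSol.monotoneOn_scal (h : P.IsSol x y J) (hJ : Convex ℝ J) :
    MonotoneOn (fun s => P.scal (x s) (y s)) J := by
  have hd₁ := P.d₁_pos
  have hd₂ := P.d₂_pos
  exact monotoneOn_of_hasDerivWithinAt_nonneg hJ
    (fun t ht => (h.hasDerivWithinAt_scal ht).continuousWithinAt)
    (fun t ht => (h.hasDerivWithinAt_scal (interior_subset ht)).mono interior_subset)
    fun t _ => by positivity

theorem scal_pos (P : RicciData) {x y : ℝ} (hx : 0 < x) (hy : 0 < y) (h₁ : 0 < P.r₁ x y)
    (h₂ : 0 < P.r₂ x y) : 0 < P.scal x y :=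
  add_pos (div_pos (mul_pos P.d₁_pos h₁) hx) (div_pos (mul_pos P.d₂_pos h₂) hy)

theorem IsSol.scal_pos_of_derivWithin_neg (h : P.IsSol x y J) {t : ℝ} (ht : t ∈ J)
    (hJ : UniqueDiffWithinAt ℝ J t) (hx : derivWithin x J t < 0) (hy : derivWithin y J t < 0) :
    0 < P.scal (x t) (y t) := by
  rw [(h.deriv₁ t ht).derivWithin hJ] at hx
  rw [(h.deriv₂ t ht).derivWithin hJ] at hy
  exact P.scal_pos (h.pos₁ t ht) (h.pos₂ t ht) (by linarith) (by linarith)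

theorem IsSol.monotoneOn (h : P.IsSol x y J) (hJ : Convex ℝ J)
    (hr : ∀ t ∈ J, P.r₁ (x t) (y t) ≤ 0) : MonotoneOn x J :=
  monotoneOn_of_hasDerivWithinAt_nonneg hJ (fun t ht => (h.deriv₁ t ht).continuousWithinAt)
    (fun t ht => (h.deriv₁ t (interior_subset ht)).mono interior_subset)
    fun t ht => by linarith [hr t (interior_subset ht)]

theorem IsSol.antitoneOn_add_mul (h : P.IsSol x y J) (hJ : Convex ℝ J) {m : ℝ}
    (hr : ∀ t ∈ J, m ≤ P.r₂ (x t) (y t)) : AntitoneOn (fun t => y t + 2 * m * t) J := by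
  have hd : ∀ t ∈ J, HasDerivWithinAt (fun t => y t + 2 * m * t)
      (-2 * P.r₂ (x t) (y t) + 2 * m * 1) J t := fun t ht =>
    (h.deriv₂ t ht).add ((hasDerivWithinAt_id t _).const_mul _)
  exact antitoneOn_of_hasDerivWithinAt_nonpos hJ (fun t ht => (hd t ht).continuousWithinAt)
    (fun t ht => (hd t (interior_subset ht)).mono interior_subset)
    fun t ht => by linarith [hr t (interior_subset ht)]

theorem r₁_neg_of_scal_nonpos (P : RicciData) {x y : ℝ} (hx : 0 < x) (hxy : x < y)
    (hs : P.scal x y ≤ 0) : P.r₁ x y < 0 := by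
  have hy := hx.trans hxy
  have hE₁ : 0 < P.E₁ := P.A_pos.trans_le P.A_le
  have hratio : x / y < 1 := (div_lt_one hy).2 hxy
  have hratio₀ : 0 < x / y := div_pos hx hy
  have heq : P.E₁ - P.A / 2 * (y / x) + P.C / 4 * (x ^ 2 / y ^ 2)
      = 2 * x * P.scal x y - P.E₁ - (2 * P.E₂ - 3 / 4 * P.C * (x / y)) * (x / y) := by
    rw [P.scal_eq hx.ne' hy.ne']
    field_simp
    ring
  have hnonneg : 0 ≤ (2 * P.E₂ - 3 / 4 * P.C * (x / y)) * (x / y) :=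
    mul_nonneg (by nlinarith [P.C_pos, P.C_le]) hratio₀.le
  have hscal : 2 * x * P.scal x y ≤ 0 := mul_nonpos_of_nonneg_of_nonpos (by linarith) hs
  refine div_neg_of_neg_of_pos ?_ P.d₁_pos
  rw [heq]
  linarith

theorem le_r₂ (P : RicciData) {x y : ℝ} (hx : 0 < x) (hxy : x < y) :
    P.E₂ / 2 / P.d₂ ≤ P.r₂ x y := by
  have hy := hx.trans hxy
  have hratio : x / y < 1 := (div_lt_one hy).2 hxy
  have hA := P.A_pos
  have hnonneg : 0 ≤ P.A / 4 * (y ^ 2 / x ^ 2) := by positivity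
  rw [r₂_eq]
  refine div_le_div_of_nonneg_right ?_ P.d₂_pos.le
  nlinarith [P.C_pos, P.C_le]

theorem contDiffAt_r₁ (P : RicciData) {m : WithTop ℕ∞} {q : ℝ × ℝ} (h₁ : q.1 ≠ 0)
    (h₂ : q.2 ≠ 0) : ContDiffAt ℝ m (fun q : ℝ × ℝ => P.r₁ q.1 q.2) q :=
  ((contDiffAt_const.sub (contDiffAt_const.mul (contDiffAt_snd.div contDiffAt_fst h₁))).add
    (contDiffAt_const.mul ((contDiffAt_fst.pow 2).div (contDiffAt_snd.pow 2)
      (pow_ne_zero 2 h₂)))).div_const _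

theorem contDiffAt_r₂ (P : RicciData) {m : WithTop ℕ∞} {q : ℝ × ℝ} (h₁ : q.1 ≠ 0)
    (h₂ : q.2 ≠ 0) : ContDiffAt ℝ m (fun q : ℝ × ℝ => P.r₂ q.1 q.2) q :=
  (P.swap.contDiffAt_r₁ (q := q.swap) h₂ h₁).comp q (contDiffAt_snd.prodMk contDiffAt_fst)

theorem IsSol.exists_extension_of_tendsto {a b l₁ l₂ : ℝ} (hab : a < b)
    (h : P.IsSol x y (Ico a b)) (hx : Tendsto x (𝓝[<] b) (𝓝 l₁)) (hl₁ : 0 < l₁)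
    (hy : Tendsto y (𝓝[<] b) (𝓝 l₂)) (hl₂ : 0 < l₂) :
    ∃ c > b, ∃ x' y' : ℝ → ℝ, P.IsSol x' y' (Ico a c) ∧ EqOn x x' (Ico a b) ∧
      EqOn y y' (Ico a b) := by
  have hv : ContDiffAt ℝ 1 (fun q : ℝ × ℝ => (-2 * P.r₁ q.1 q.2, -2 * P.r₂ q.1 q.2)) (l₁, l₂) :=
    (contDiffAt_const.mul (P.contDiffAt_r₁ hl₁.ne' hl₂.ne')).prodMk
      (contDiffAt_const.mul (P.contDiffAt_r₂ hl₁.ne' hl₂.ne'))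
  obtain ⟨c, hbc, Z, hZ, hderiv, hZpos⟩ := exists_hasDerivWithinAt_extension hab hv
    (fun t ht => (h.deriv₁ t ht).prodMk (h.deriv₂ t ht)) (hx.prodMk_nhds hy)
    (prod_mem_nhds (Ioi_mem_nhds hl₁) (Ioi_mem_nhds hl₂))
  have hpos : ∀ t ∈ Ico a c, 0 < (Z t).1 ∧ 0 < (Z t).2 := fun t ht => by
    rcases lt_or_ge t b with htb | htb
    · rw [hZ ⟨ht.1, htb⟩]
      exact ⟨h.pos₁ t ⟨ht.1, htb⟩, h.pos₂ t ⟨ht.1, htb⟩⟩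
    · exact hZpos t ⟨htb, ht.2⟩
  exact ⟨c, hbc, fun t => (Z t).1, fun t => (Z t).2,
    ⟨fun t ht => (hpos t ht).1, fun t ht => (hpos t ht).2,
      fun t ht => (hasFDerivAt_fst (p := Z t)).comp_hasDerivWithinAt t (hderiv t ht),
      fun t ht => (hasFDerivAt_snd (p := Z t)).comp_hasDerivWithinAt t (hderiv t ht)⟩,
    fun t ht => (congrArg Prod.fst (hZ ht)).symm, fun t ht => (congrArg Prod.snd (hZ ht)).symm⟩

theorem IsSol.exists_extension_of_monotoneOn {a b : ℝ} (hab : a < b) (h : P.IsSol x y (Ico a b))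
    (hx : MonotoneOn x (Ico a b)) (hy : AntitoneOn y (Ico a b))
    (hxy : ∀ t ∈ Ico a b, x t ≤ y t) :
    ∃ c > b, ∃ x' y' : ℝ → ℝ, P.IsSol x' y' (Ico a c) ∧ EqOn x x' (Ico a b) ∧
      EqOn y y' (Ico a b) := by
  have ha : a ∈ Ico a b := left_mem_Ico.2 hab
  have hne : (Ioo a b).Nonempty := nonempty_Ioo.2 hab
  have hsub : Ioo a b ⊆ Ico a b := Ioo_subset_Ico_self
  have hxge : ∀ t ∈ Ioo a b, x a ≤ x t := fun t ht => hx ha (hsub ht) ht.1.le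
  have hyge : ∀ t ∈ Ioo a b, x a ≤ y t := fun t ht => (hxge t ht).trans (hxy t (hsub ht))
  have hxle : ∀ t ∈ Ioo a b, x t ≤ y a := fun t ht =>
    (hxy t (hsub ht)).trans (hy ha (hsub ht) ht.1.le)
  have hxlim := (hx.mono hsub).tendsto_nhdsWithin_Ioo_left hne ⟨y a, forall_mem_image.2 hxle⟩
  have hylim := (hy.mono hsub).tendsto_nhdsWithin_Ioo_left hne ⟨x a, forall_mem_image.2 hyge⟩
  have hmem : ∀ᶠ t in 𝓝[<] b, t ∈ Ioo a b := Ioo_mem_nhdsLT hab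
  have hxa := h.pos₁ a ha
  exact h.exists_extension_of_tendsto hab
    hxlim (hxa.trans_le (ge_of_tendsto hxlim (hmem.mono hxge)))
    hylim (hxa.trans_le (ge_of_tendsto hylim (hmem.mono hyge)))

variable {T : EReal}

theorem IsSol.exists_extension_of_lt (hT : 0 < T) (h : P.IsSol x y (timeInterval T))
    (hs : ∀ t ∈ timeInterval T, P.scal (x t) (y t) ≤ 0) (hxy : ∀ t ∈ timeInterval T, x t < y t) :
    ∃ T', T < T' ∧ ∃ x' y' : ℝ → ℝ, P.IsSol x' y' (timeInterval T') ∧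
      EqOn x x' (timeInterval T) ∧ EqOn y y' (timeInterval T) := by
  have h0 := zero_mem_timeInterval hT
  have hconv := convex_timeInterval T
  set m := P.E₂ / 2 / P.d₂
  have hm : 0 < m := div_pos (half_pos (P.C_pos.trans_le P.C_le)) P.d₂_pos
  have hx : MonotoneOn x (timeInterval T) := h.monotoneOn hconv fun t ht =>
    (P.r₁_neg_of_scal_nonpos (h.pos₁ t ht) (hxy t ht) (hs t ht)).le
  have hym : AntitoneOn (fun t => y t + 2 * m * t) (timeInterval T) :=
    h.antitoneOn_add_mul hconv fun t ht => P.le_r₂ (h.pos₁ t ht) (hxy t ht)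
  have hy : AntitoneOn y (timeInterval T) := fun s hs t ht hst => by
    have hle : y t + 2 * m * t ≤ y s + 2 * m * s := hym hs ht hst
    linarith [mul_le_mul_of_nonneg_left hst (mul_pos two_pos hm).le]
  have hlt : ∀ t ∈ timeInterval T, t < y 0 / (2 * m) := fun t ht => by
    have hle : y t + 2 * m * t ≤ y 0 + 2 * m * 0 := hym h0 ht ht.1
    rw [lt_div_iff₀ (mul_pos two_pos hm)]
    linarith [h.pos₂ t ht]
  obtain ⟨b, rfl⟩ := exists_eq_coe_of_forall_lt hT hlt
  rw [timeInterval_coe] at h hx hy hxy ⊢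
  obtain ⟨c, hbc, hext⟩ := h.exists_extension_of_monotoneOn (EReal.coe_pos.1 hT) hx hy
    fun t ht => (hxy t ht).le
  exact ⟨c, EReal.coe_lt_coe_iff.2 hbc, by rwa [timeInterval_coe]⟩

theorem IsSol.lt_of_scal_nonpos (h : P.IsSol x y J) (hJ : IsPreconnected J)
    (hs : ∀ t ∈ J, P.scal (x t) (y t) ≤ 0) {s : ℝ} (hsJ : s ∈ J) (hxy : x s < y s) :
    ∀ t ∈ J, x t < y t := by
  intro t ht
  by_contra! hle
  obtain ⟨u, hu, heq⟩ := hJ.intermediate_value₂ hsJ ht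
    (fun t ht => (h.deriv₁ t ht).continuousWithinAt)
    (fun t ht => (h.deriv₂ t ht).continuousWithinAt) hxy.le hle
  have hpos := P.scal_self_pos (h.pos₁ u hu)
  have hnonpos := hs u hu
  rw [← heq] at hnonpos
  exact hnonpos.not_gt hpos

theorem IsSol.exists_extension (hT : 0 < T) (h : P.IsSol x y (timeInterval T))
    (hs : ∀ t ∈ timeInterval T, P.scal (x t) (y t) ≤ 0) :
    ∃ T', T < T' ∧ ∃ x' y' : ℝ → ℝ, P.IsSol x' y' (timeInterval T') ∧
      EqOn x x' (timeInterval T) ∧ EqOn y y' (timeInterval T) := by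
  have h0 := zero_mem_timeInterval hT
  have hconn := (convex_timeInterval T).isPreconnected
  rcases lt_trichotomy (x 0) (y 0) with hxy | hxy | hyx
  · exact h.exists_extension_of_lt hT hs (h.lt_of_scal_nonpos hconn hs h0 hxy)
  · have hpos := P.scal_self_pos (h.pos₁ 0 h0)
    have hnonpos := hs 0 h0
    rw [← hxy] at hnonpos
    exact absurd hpos hnonpos.not_gt
  · have hs' : ∀ t ∈ timeInterval T, P.swap.scal (y t) (x t) ≤ 0 := fun t ht =>
      (P.scal_swap _ _).trans_le (hs t ht)
    obtain ⟨T', hT', y', x', hsol, hy, hx⟩ := h.swap.exists_extension_of_lt hT hs'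
      (h.swap.lt_of_scal_nonpos hconn hs' h0 hyx)
    exact ⟨T', hT', x', y', hsol.swap, hx, hy⟩

theorem IsSol.exists_forall_scal_pos (hT : 0 < T) (h : P.IsSol x y (timeInterval T))
    (hmax : ∀ T', T < T' → ∀ x' y' : ℝ → ℝ, P.IsSol x' y' (timeInterval T') →
      ¬ (EqOn x x' (timeInterval T) ∧ EqOn y y' (timeInterval T)))
    (h0 : P.scal (x 0) (y 0) < 0) :
    ∃ t₁ : ℝ, 0 < t₁ ∧ (t₁ : EReal) < T ∧ ∀ t : ℝ, t₁ ≤ t → (t : EReal) < T →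
      0 < P.scal (x t) (y t) := by
  obtain ⟨t₁, ht₁, hpos⟩ : ∃ t ∈ timeInterval T, 0 < P.scal (x t) (y t) := by
    by_contra! hs
    obtain ⟨T', hT', x', y', hsol, heq⟩ := h.exists_extension hT hs
    exact hmax T' hT' x' y' hsol heq
  have hne : t₁ ≠ 0 := by
    rintro rfl
    exact h0.not_gt hpos
  exact ⟨t₁, ht₁.1.lt_of_ne' hne, ht₁.2, fun t ht htT => hpos.trans_le <|
    h.monotoneOn_scal (convex_timeInterval T) ht₁ ⟨ht₁.1.trans ht, htT⟩ ht⟩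

end RicciData

section AdjointRepresentation

variable {n : ℕ} {G : Type*} [TopologicalSpace G] [ChartedSpace (EuclideanSpace ℝ (Fin n)) G]
  [Group G]

local notation "𝔼" => EuclideanSpace ℝ (Fin n)
local notation "ψ" => extChartAt (𝓡 n) (1 : G)
local notation "ψ⁻¹" => PartialEquiv.symm (extChartAt (𝓡 n) (1 : G))

variable (n) in
/-- The map `Ad a` as a continuous linear map of the model space, which is normed, unlike
`GroupLieAlgebra`. -/
def AdCLM (a : G) : 𝔼 →L[ℝ] 𝔼 :=
  mfderiv (𝓡 n) (𝓡 n) (fun h : G => a * h * a⁻¹) 1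

theorem Ad_apply (a : G) (X : GroupLieAlgebra (𝓡 n) G) : Ad a X = AdCLM n a X := rfl

theorem AdCLM_one : AdCLM n (1 : G) = ContinuousLinearMap.id ℝ 𝔼 := by
  have hid : (fun h : G => 1 * h * 1⁻¹) = id := by ext; simp
  rw [AdCLM, hid]
  exact mfderiv_id

variable (n G) in
/-- The multiplication of `G` read in the preferred chart at `1`. -/
def chartMul (q : 𝔼 × 𝔼) : 𝔼 := ψ (ψ⁻¹ q.1 * ψ⁻¹ q.2)

variable (n G) in
/-- The coordinates of `1` in the preferred chart at `1`. -/
def chartOne : 𝔼 := ψ 1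

variable (n G) in
theorem chart_symm_chartOne : ψ⁻¹ (chartOne n G) = 1 := extChartAt_to_inv (1 : G)

variable (n) in
/-- The velocity at time `0` of a curve through the identity. -/
def velocity (γ : ℝ → G) : 𝔼 := mfderiv 𝓘(ℝ, ℝ) (𝓡 n) γ 0 (1 : ℝ)

theorem hasDerivAt_comp_curve {γ : ℝ → G} (hγ : ContMDiff 𝓘(ℝ, ℝ) (𝓡 n) ∞ γ) (hγ0 : γ 0 = 1)
    {F : Type*} [NormedAddCommGroup F] [NormedSpace ℝ F] {f : G → F}
    (hf : MDifferentiableAt (𝓡 n) 𝓘(ℝ, F) f 1) :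
    HasDerivAt (fun t => f (γ t))
      ((mfderiv (𝓡 n) 𝓘(ℝ, F) f 1 : 𝔼 →L[ℝ] F) (velocity n γ)) 0 := by
  have hf' := hf.hasMFDerivAt
  let A : 𝔼 →L[ℝ] F := mfderiv (𝓡 n) 𝓘(ℝ, F) f 1
  let B : ℝ →L[ℝ] 𝔼 := mfderiv 𝓘(ℝ, ℝ) (𝓡 n) γ 0
  have hA : HasMFDerivAt (𝓡 n) 𝓘(ℝ, F) f (γ 0) A := by rwa [hγ0]
  have hcomp : HasFDerivAt (fun t => f (γ t)) (A.comp B) 0 :=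
    (hA.comp (0 : ℝ) (hγ.mdifferentiableAt (by simp)).hasMFDerivAt).hasFDerivAt
  exact hcomp.hasDerivAt

variable [LieGroup (𝓡 n) ∞ G]

variable (n) in
theorem contMDiff_conj (a : G) : ContMDiff (𝓡 n) (𝓡 n) ∞ (fun h : G => a * h * a⁻¹) :=
  (contMDiff_const.mul contMDiff_id).mul contMDiff_const

theorem hasMFDerivAt_conj (a : G) :
    HasMFDerivAt (𝓡 n) (𝓡 n) (fun h : G => a * h * a⁻¹) 1 (AdCLM n a) :=
  ((contMDiff_conj n a).mdifferentiableAt (by simp)).hasMFDerivAt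

theorem AdCLM_mul (a b : G) : AdCLM n (a * b) = (AdCLM n a).comp (AdCLM n b) := by
  have ha : HasMFDerivAt (𝓡 n) (𝓡 n) (fun h : G => a * h * a⁻¹) (b * 1 * b⁻¹) (AdCLM n a) := by
    rw [mul_one, mul_inv_cancel]
    exact hasMFDerivAt_conj a
  have hab := ha.comp (1 : G) (hasMFDerivAt_conj b)
  have hcomp : (fun h : G => a * h * a⁻¹) ∘ (fun h : G => b * h * b⁻¹)
      = fun h : G => a * b * h * (a * b)⁻¹ := by ext; simp [mul_assoc]
  rw [hcomp] at hab
  exact hab.mfderiv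

variable (n G) in
/-- The adjoint representation of a Lie group on its Lie algebra. -/
def adjointRep : Representation ℝ G (GroupLieAlgebra (𝓡 n) G) where
  toFun := Ad
  map_one' := LinearMap.ext fun X => by rw [Ad_apply, AdCLM_one]; rfl
  map_mul' a b := LinearMap.ext fun X => by rw [Ad_apply, AdCLM_mul]; rfl

theorem Ad_one (X : GroupLieAlgebra (𝓡 n) G) : Ad (1 : G) X = X :=
  LinearMap.congr_fun (map_one (adjointRep n G)) X

theorem Ad_mul (a b : G) (X : GroupLieAlgebra (𝓡 n) G) : Ad (a * b) X = Ad a (Ad b X) :=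
  LinearMap.congr_fun (map_mul (adjointRep n G) a b) X

theorem Ad_inv_Ad (a : G) (X : GroupLieAlgebra (𝓡 n) G) : Ad a⁻¹ (Ad a X) = X := by
  rw [← Ad_mul, inv_mul_cancel, Ad_one]

variable (n) in
theorem contMDiff_AdCLM : ContMDiff (𝓡 n) 𝓘(ℝ, 𝔼 →L[ℝ] 𝔼) ∞ (fun a : G => AdCLM n a) := by
  intro a₀
  have : IsManifold (𝓡 n) 1 G := IsManifold.of_le (n := ∞) (by simp)
  have hconj : ContMDiff ((𝓡 n).prod (𝓡 n)) (𝓡 n) ∞ (fun q : G × G => q.1 * q.2 * q.1⁻¹) :=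
    (contMDiff_fst.mul contMDiff_snd).mul contMDiff_fst.inv
  have hsmooth := ContMDiffAt.mfderiv (I := 𝓡 n) (I' := 𝓡 n) (J := 𝓡 n) (x₀ := a₀)
    (n := ∞) (m := ∞) (fun a h : G => a * h * a⁻¹) (fun _ => (1 : G))
    (hconj _) contMDiffAt_const (by simp)
  refine hsmooth.congr_of_eventuallyEq (Filter.Eventually.of_forall fun a => ?_)
  -- Conjugation fixes `1`, so the trivialisations at source and target are the identity.
  have hfix : ∀ b : G, b * 1 * b⁻¹ = 1 := by simp
  refine ((inTangentCoordinates_eq (I := 𝓡 n) (I' := 𝓡 n) (fun _ : G => (1 : G))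
    (fun a : G => a * 1 * a⁻¹) (fun a : G => AdCLM n a) (mem_chart_source _ _)
    (by simp only [hfix]; exact mem_chart_source _ _)).trans ?_).symm
  ext1 v
  simp only [hfix, ContinuousLinearMap.comp_apply]
  rw [(tangentBundleCore (𝓡 n) G).coordChange_self _ _ (mem_chart_source _ (1 : G)),
    (tangentBundleCore (𝓡 n) G).coordChange_self _ _ (mem_chart_source _ (1 : G))]

theorem continuous_AdCLM_apply (X : 𝔼) : Continuous fun a : G => AdCLM n a X :=
  (contMDiff_AdCLM (G := G) n).continuous.clm_apply continuous_const

variable (n) in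
theorem mfderiv_mul_left_eq_mfderiv_mul_right (a : G) (w : 𝔼) :
    (mfderiv (𝓡 n) (𝓡 n) (fun h : G => a * h) 1 w : 𝔼)
      = (mfderiv (𝓡 n) (𝓡 n) (fun h : G => h * a) 1 (AdCLM n a w) : 𝔼) := by
  have hright : HasMFDerivAt (𝓡 n) (𝓡 n) (fun h : G => h * a) (a * 1 * a⁻¹)
      (mfderiv (𝓡 n) (𝓡 n) (fun h : G => h * a) 1 : 𝔼 →L[ℝ] 𝔼) := by
    rw [mul_one, mul_inv_cancel]
    exact ((contMDiff_mul_right (n := ∞)).mdifferentiableAt (by simp)).hasMFDerivAt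
  have hcomp := hright.comp (1 : G) (hasMFDerivAt_conj a)
  have hleft : (fun h : G => h * a) ∘ (fun h : G => a * h * a⁻¹) = fun h : G => a * h := by
    ext
    simp [mul_assoc]
  rw [hleft] at hcomp
  rw [hcomp.mfderiv]
  rfl

theorem contDiffAt_chartMul :
    ContDiffAt ℝ ∞ (chartMul n G) (chartOne n G, chartOne n G) := by
  rw [← contMDiffAt_iff_contDiffAt]
  have hsymm : ContMDiffAt 𝓘(ℝ, 𝔼) (𝓡 n) ∞ ψ⁻¹ (chartOne n G) :=
    (contMDiffOn_extChartAt_symm (1 : G)).contMDiffAt (extChartAt_target_mem_nhds (1 : G))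
  have hmul := (hsymm.comp (chartOne n G, chartOne n G) contDiffAt_fst.contMDiffAt).mul
    (hsymm.comp (chartOne n G, chartOne n G) contDiffAt_snd.contMDiffAt)
  refine ContMDiffAt.comp (chartOne n G, chartOne n G) (g := ψ) ?_ hmul
  simp only [chart_symm_chartOne, mul_one]
  exact contMDiffAt_extChartAt

theorem hasMFDerivAt_chart_symm_chartOne :
    HasMFDerivAt 𝓘(ℝ, 𝔼) (𝓡 n) ψ⁻¹ (chartOne n G) (ContinuousLinearMap.id ℝ 𝔼) := by
  have : IsManifold (𝓡 n) 1 G := IsManifold.of_le (n := ∞) (by simp)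
  have hdiff := mdifferentiableWithinAt_extChartAt_symm (I := 𝓡 n)
    (mem_extChartAt_target (I := 𝓡 n) (1 : G))
  have hderiv := mfderivWithin_range_extChartAt_symm (I := 𝓡 n) (x := (1 : G))
  simp only [ModelWithCorners.range_eq_univ, mfderivWithin_univ,
    mdifferentiableWithinAt_univ] at hdiff hderiv
  have h := hdiff.hasMFDerivAt
  rw [hderiv] at h
  exact h

theorem hasFDerivAt_comp_chart_symm {F : Type*} [NormedAddCommGroup F] [NormedSpace ℝ F]
    {f : G → F} {f' : 𝔼 →L[ℝ] F} (hf : HasMFDerivAt (𝓡 n) 𝓘(ℝ, F) f 1 f') :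
    HasFDerivAt (fun y => f (ψ⁻¹ y)) f' (chartOne n G) := by
  have hf₁ : HasMFDerivAt (𝓡 n) 𝓘(ℝ, F) f (ψ⁻¹ (chartOne n G)) f' := by
    rwa [chart_symm_chartOne]
  exact (hf₁.comp _ hasMFDerivAt_chart_symm_chartOne).hasFDerivAt

theorem hasMFDerivAt_chart_comp {f : G → G} (hf : MDifferentiableAt (𝓡 n) (𝓡 n) f 1)
    (hsource : f 1 ∈ (ψ).source) :
    HasMFDerivAt (𝓡 n) 𝓘(ℝ, 𝔼) (fun h => ψ (f h)) 1
      ((mfderiv (𝓡 n) 𝓘(ℝ, 𝔼) ψ (f 1) : 𝔼 →L[ℝ] 𝔼).comp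
        (mfderiv (𝓡 n) (𝓡 n) f 1 : 𝔼 →L[ℝ] 𝔼)) := by
  have : IsManifold (𝓡 n) 1 G := IsManifold.of_le (n := ∞) (by simp)
  rw [extChartAt_source] at hsource
  exact (mdifferentiableAt_extChartAt hsource).hasMFDerivAt.comp 1 hf.hasMFDerivAt

theorem fderiv_chartMul_right {x : 𝔼} (hx : x ∈ (ψ).target)
    (hd : DifferentiableAt ℝ (chartMul n G) (x, chartOne n G)) (w : 𝔼) :
    fderiv ℝ (chartMul n G) (x, chartOne n G) (0, w)
      = mfderiv (𝓡 n) 𝓘(ℝ, 𝔼) ψ (ψ⁻¹ x)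
          (mfderiv (𝓡 n) (𝓡 n) (fun h : G => ψ⁻¹ x * h) 1 w : 𝔼) := by
  have hsource : ψ⁻¹ x * 1 ∈ (ψ).source := by rw [mul_one]; exact (ψ).map_target hx
  have htranslation := hasFDerivAt_comp_chart_symm (hasMFDerivAt_chart_comp
    ((contMDiff_mul_left (n := ∞) (a := ψ⁻¹ x)).mdifferentiableAt (by simp)) hsource)
  rw [mul_one] at htranslation
  have hpartial : HasFDerivAt (fun y => chartMul n G (x, y)) _ (chartOne n G) :=
    hd.hasFDerivAt.comp (chartOne n G) (hasFDerivAt_prodMk_right x _)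
  exact DFunLike.congr_fun (hpartial.unique htranslation) w

theorem fderiv_chartMul_left {x : 𝔼} (hx : x ∈ (ψ).target)
    (hd : DifferentiableAt ℝ (chartMul n G) (chartOne n G, x)) (w : 𝔼) :
    fderiv ℝ (chartMul n G) (chartOne n G, x) (w, 0)
      = mfderiv (𝓡 n) 𝓘(ℝ, 𝔼) ψ (ψ⁻¹ x)
          (mfderiv (𝓡 n) (𝓡 n) (fun h : G => h * ψ⁻¹ x) 1 w : 𝔼) := by
  have hsource : 1 * ψ⁻¹ x ∈ (ψ).source := by rw [one_mul]; exact (ψ).map_target hx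
  have htranslation := hasFDerivAt_comp_chart_symm (hasMFDerivAt_chart_comp
    ((contMDiff_mul_right (n := ∞) (a := ψ⁻¹ x)).mdifferentiableAt (by simp)) hsource)
  rw [one_mul] at htranslation
  have hpartial : HasFDerivAt (fun y => chartMul n G (y, x)) _ (chartOne n G) :=
    HasFDerivAt.comp (chartOne n G) (f := fun y => (y, x)) hd.hasFDerivAt
      (hasFDerivAt_prodMk_left _ x)
  exact DFunLike.congr_fun (hpartial.unique htranslation) w

theorem fderiv_chartMul_right_eq_left {x : 𝔼} (hx : x ∈ (ψ).target)
    (hd : DifferentiableAt ℝ (chartMul n G) (x, chartOne n G))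
    (hd' : DifferentiableAt ℝ (chartMul n G) (chartOne n G, x)) (w : 𝔼) :
    fderiv ℝ (chartMul n G) (x, chartOne n G) (0, w)
      = fderiv ℝ (chartMul n G) (chartOne n G, x) (AdCLM n (ψ⁻¹ x) w, 0) := by
  rw [fderiv_chartMul_right hx hd, fderiv_chartMul_left hx hd',
    mfderiv_mul_left_eq_mfderiv_mul_right]

theorem mpullbackWithin_mulInvariantVectorField {x : 𝔼} (hx : x ∈ (ψ).target)
    (hd : DifferentiableAt ℝ (chartMul n G) (x, chartOne n G)) (w : 𝔼) :
    VectorField.mpullbackWithin 𝓘(ℝ, 𝔼) (𝓡 n) ψ⁻¹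
      (mulInvariantVectorField (I := 𝓡 n) (G := G) w) (range (𝓡 n)) x
      = fderiv ℝ (chartMul n G) (x, chartOne n G) (0, w) := by
  have : IsManifold (𝓡 n) 1 G := IsManifold.of_le (n := ∞) (by simp)
  rw [fderiv_chartMul_right hx hd, VectorField.mpullbackWithin_apply,
    ContinuousLinearMap.inverse_eq (mfderivWithin_extChartAt_symm_comp_mfderiv_extChartAt hx)
      (mfderiv_extChartAt_comp_mfderivWithin_extChartAt_symm hx)]
  rfl

theorem eventually_differentiableAt_chartMul :
    ∀ᶠ x in nhds (chartOne n G), x ∈ (ψ).target ∧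
      DifferentiableAt ℝ (chartMul n G) (x, chartOne n G) ∧
      DifferentiableAt ℝ (chartMul n G) (chartOne n G, x) := by
  have hdiff : ∀ᶠ q in nhds (chartOne n G, chartOne n G), DifferentiableAt ℝ (chartMul n G) q :=
    ((contDiffAt_chartMul.of_le (m := 1) (by simp)).eventually (by simp)).mono
      fun q hq => hq.differentiableAt (by simp)
  have hleft : Continuous fun x : 𝔼 => (x, chartOne n G) := by fun_prop
  have hright : Continuous fun x : 𝔼 => (chartOne n G, x) := by fun_prop
  exact Filter.Eventually.and (extChartAt_target_mem_nhds (1 : G))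
    ((hleft.continuousAt.eventually hdiff).and (hright.continuousAt.eventually hdiff))

theorem fderiv_chartMul_chartOne (u w : 𝔼) :
    fderiv ℝ (chartMul n G) (chartOne n G, chartOne n G) (u, w) = u + w := by
  have hμ : DifferentiableAt ℝ (chartMul n G) (chartOne n G, chartOne n G) :=
    contDiffAt_chartMul.differentiableAt (by simp)
  have hright : HasFDerivAt (fun y => chartMul n G (chartOne n G, y)) (ContinuousLinearMap.id ℝ 𝔼)
      (chartOne n G) := by
    refine (hasFDerivAt_id _).congr_of_eventuallyEq ?_
    filter_upwards [extChartAt_target_mem_nhds (I := 𝓡 n) (1 : G)] with x hx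
    simp only [chartMul, chart_symm_chartOne, one_mul, (ψ).right_inv hx, id]
  have hleft : HasFDerivAt (fun x => chartMul n G (x, chartOne n G)) (ContinuousLinearMap.id ℝ 𝔼)
      (chartOne n G) := by
    refine (hasFDerivAt_id _).congr_of_eventuallyEq ?_
    filter_upwards [extChartAt_target_mem_nhds (I := 𝓡 n) (1 : G)] with x hx
    simp only [chartMul, chart_symm_chartOne, mul_one, (ψ).right_inv hx, id]
  have hu := DFunLike.congr_fun ((HasFDerivAt.comp (chartOne n G) (f := fun y => (y, chartOne n G))
    hμ.hasFDerivAt (hasFDerivAt_prodMk_left _ _)).unique hleft) u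
  have hw := DFunLike.congr_fun
    ((hμ.hasFDerivAt.comp (chartOne n G) (hasFDerivAt_prodMk_right _ _)).unique hright) w
  calc fderiv ℝ (chartMul n G) (chartOne n G, chartOne n G) (u, w)
      = fderiv ℝ (chartMul n G) (chartOne n G, chartOne n G) (u, 0)
        + fderiv ℝ (chartMul n G) (chartOne n G, chartOne n G) (0, w) := by
        rw [← map_add, Prod.mk_add_mk, add_zero, zero_add]
    _ = u + w := congrArg₂ (· + ·) hu hw

variable (n G) in
/-- The second derivative at `1` of the multiplication in the chart at `1`. -/
def chartMulHessian : (𝔼 × 𝔼) →L[ℝ] (𝔼 × 𝔼) →L[ℝ] 𝔼 :=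
  fderiv ℝ (fderiv ℝ (chartMul n G)) (chartOne n G, chartOne n G)

theorem hasFDerivAt_fderiv_chartMul :
    HasFDerivAt (fderiv ℝ (chartMul n G)) (chartMulHessian n G) (chartOne n G, chartOne n G) :=
  ((contDiffAt_chartMul.fderiv_right (m := 1) (by norm_cast)).differentiableAt
    (by simp)).hasFDerivAt

theorem hasFDerivAt_fderiv_chartMul_right (w : 𝔼) :
    HasFDerivAt (fun x => fderiv ℝ (chartMul n G) (x, chartOne n G) (0, w))
      (((chartMulHessian n G).comp (ContinuousLinearMap.inl ℝ _ _)).flip (0, w))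
      (chartOne n G) := by
  have h : HasFDerivAt (fun x => fderiv ℝ (chartMul n G) (x, chartOne n G))
      ((chartMulHessian n G).comp (ContinuousLinearMap.inl ℝ _ _)) (chartOne n G) :=
    HasFDerivAt.comp (chartOne n G) (f := fun y => (y, chartOne n G)) hasFDerivAt_fderiv_chartMul
      (hasFDerivAt_prodMk_left _ _)
  simpa using h.clm_apply (hasFDerivAt_const ((0 : 𝔼), w) (chartOne n G))

variable (n G) in
/-- The bracket of `GroupLieAlgebra`, on the model space. -/
def modelBracket (v w : 𝔼) : 𝔼 :=
  @Bracket.bracket (GroupLieAlgebra (𝓡 n) G) (GroupLieAlgebra (𝓡 n) G) _ v w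

theorem modelBracket_eq_chartMulHessian_sub (v w : 𝔼) :
    modelBracket n G v w
      = chartMulHessian n G (v, 0) (0, w) - chartMulHessian n G (w, 0) (0, v) := by
  have : IsManifold (𝓡 n) 1 G := IsManifold.of_le (n := ∞) (by simp)
  let V (u : 𝔼) : 𝔼 → 𝔼 := VectorField.mpullbackWithin 𝓘(ℝ, 𝔼) (𝓡 n) ψ⁻¹
    (mulInvariantVectorField (I := 𝓡 n) (G := G) u) (range (𝓡 n))
  have hV : ∀ u : 𝔼, V u =ᶠ[nhds (chartOne n G)]
      fun x => fderiv ℝ (chartMul n G) (x, chartOne n G) (0, u) := by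
    intro u
    filter_upwards [eventually_differentiableAt_chartMul (n := n) (G := G)] with x hx
    exact mpullbackWithin_mulInvariantVectorField hx.1 hx.2.1 u
  let A : 𝔼 →L[ℝ] 𝔼 := mfderiv (𝓡 n) 𝓘(ℝ, 𝔼) ψ 1
  have hchart : A = ContinuousLinearMap.id ℝ 𝔼 := mfderiv_extChartAt_self
  have hbracket : modelBracket n G v w = A.inverse (VectorField.lieBracketWithin ℝ (V v) (V w)
      (ψ⁻¹ ⁻¹' univ ∩ range (𝓡 n)) (chartOne n G)) := rfl
  have huniv : ψ⁻¹ ⁻¹' univ ∩ range (𝓡 n) = univ := by simp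
  refine hbracket.trans ?_
  rw [huniv, hchart, ContinuousLinearMap.inverse_id, VectorField.lieBracketWithin_univ,
    (hV v).lieBracket_vectorField_eq (hV w), VectorField.lieBracket_eq]
  simp only [(hasFDerivAt_fderiv_chartMul_right _).fderiv, fderiv_chartMul_chartOne, zero_add]
  rfl

theorem mdifferentiableAt_AdCLM_apply (w : 𝔼) :
    MDifferentiableAt (𝓡 n) 𝓘(ℝ, 𝔼) (fun a : G => AdCLM n a w) 1 :=
  ((contMDiff_AdCLM n (1 : G)).clm_apply contMDiffAt_const).mdifferentiableAt (by simp)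

/- Differentiate `∂₂μ(x, 1) w = ∂₁μ(1, x) (Ad x w)` in `x` at `1`, where `μ` is the multiplication:
the derivative of `Ad` is the antisymmetric part of the mixed second derivative of `μ`. -/
theorem mfderiv_AdCLM_apply (v w : 𝔼) :
    (mfderiv (𝓡 n) 𝓘(ℝ, 𝔼) (fun a : G => AdCLM n a w) 1 : 𝔼 →L[ℝ] 𝔼) v
      = modelBracket n G v w := by
  set A : 𝔼 →L[ℝ] 𝔼 := mfderiv (𝓡 n) 𝓘(ℝ, 𝔼) (fun a : G => AdCLM n a w) 1
  have hAd : HasFDerivAt (fun x => AdCLM n (ψ⁻¹ x) w) A (chartOne n G) :=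
    hasFDerivAt_comp_chart_symm (mdifferentiableAt_AdCLM_apply w).hasMFDerivAt
  have hμ : HasFDerivAt (fun x => fderiv ℝ (chartMul n G) (chartOne n G, x))
      ((chartMulHessian n G).comp (ContinuousLinearMap.inr ℝ _ _)) (chartOne n G) :=
    HasFDerivAt.comp (chartOne n G) (f := fun y => (chartOne n G, y)) hasFDerivAt_fderiv_chartMul
      (hasFDerivAt_prodMk_right _ _)
  have hright := hμ.clm_apply (hAd.prodMk (hasFDerivAt_const (0 : 𝔼) (chartOne n G)))
  have heq : (fun x => fderiv ℝ (chartMul n G) (x, chartOne n G) (0, w)) =ᶠ[nhds (chartOne n G)]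
      fun x => fderiv ℝ (chartMul n G) (chartOne n G, x) (AdCLM n (ψ⁻¹ x) w, 0) := by
    filter_upwards [eventually_differentiableAt_chartMul (n := n) (G := G)] with x hx
    exact fderiv_chartMul_right_eq_left hx.1 hx.2.1 hx.2.2 w
  have hderiv := DFunLike.congr_fun ((hasFDerivAt_fderiv_chartMul_right w).unique
    (hright.congr_of_eventuallyEq heq)) v
  have hsymm : chartMulHessian n G (0, v) (w, 0) = chartMulHessian n G (w, 0) (0, v) :=
    (contDiffAt_chartMul.isSymmSndFDerivAt (by simp [ENat.LEInfty.out])) _ _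
  simp only [chart_symm_chartOne, AdCLM_one, add_apply, ContinuousLinearMap.comp_apply,
    ContinuousLinearMap.flip_apply, ContinuousLinearMap.inl_apply, ContinuousLinearMap.inr_apply,
    ContinuousLinearMap.prod_apply, zero_apply, fderiv_chartMul_chartOne,
    ContinuousLinearMap.id_apply, add_zero] at hderiv
  rw [modelBracket_eq_chartMulHessian_sub, ← hsymm, hderiv]
  abel

theorem Ad_lie (a : G) (X Y : GroupLieAlgebra (𝓡 n) G) : Ad a ⁅X, Y⁆ = ⁅Ad a X, Ad a Y⁆ := by
  -- Differentiate `Ad (a b a⁻¹) (Ad a Y) = Ad a (Ad b Y)` in `b`.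
  have hleft : HasMFDerivAt (𝓡 n) 𝓘(ℝ, 𝔼) (fun b : G => AdCLM n b (AdCLM n a Y)) (a * 1 * a⁻¹)
      (mfderiv (𝓡 n) 𝓘(ℝ, 𝔼) (fun b : G => AdCLM n b (AdCLM n a Y)) 1 : 𝔼 →L[ℝ] 𝔼) := by
    rw [mul_one, mul_inv_cancel]
    exact (mdifferentiableAt_AdCLM_apply _).hasMFDerivAt
  have hconj := hleft.comp (1 : G) (hasMFDerivAt_conj a)
  have hright := (AdCLM n a).hasMFDerivAt.comp (1 : G)
    (mdifferentiableAt_AdCLM_apply (G := G) Y).hasMFDerivAt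
  have hcomp : (fun b : G => AdCLM n b (AdCLM n a Y)) ∘ (fun b : G => a * b * a⁻¹)
      = AdCLM n a ∘ (fun b : G => AdCLM n b Y) := by
    funext b
    have h : AdCLM n (a * b * a⁻¹) ∘L AdCLM n a = AdCLM n a ∘L AdCLM n b := by
      rw [← AdCLM_mul, inv_mul_cancel_right, AdCLM_mul]
    exact DFunLike.congr_fun h Y
  rw [hcomp] at hconj
  have h : (mfderiv (𝓡 n) 𝓘(ℝ, 𝔼) (fun b : G => AdCLM n b (AdCLM n a Y)) 1 : 𝔼 →L[ℝ] 𝔼)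
      (AdCLM n a X)
      = AdCLM n a ((mfderiv (𝓡 n) 𝓘(ℝ, 𝔼) (fun b : G => AdCLM n b Y) 1 : 𝔼 →L[ℝ] 𝔼) X) :=
    DFunLike.congr_fun (hasMFDerivAt_unique hconj hright) X
  exact ((mfderiv_AdCLM_apply _ _).symm.trans
    (h.trans (congrArg (AdCLM n a) (mfderiv_AdCLM_apply X Y)))).symm

theorem mdifferentiableAt_form_AdCLM (g : LinearMap.BilinForm ℝ 𝔼) (X Y : 𝔼) :
    MDifferentiableAt (𝓡 n) 𝓘(ℝ, ℝ) (fun a : G => g (AdCLM n a X) (AdCLM n a Y)) 1 :=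
  (((LinearMap.toContinuousBilinearMap g).contMDiff.contMDiffAt.comp (1 : G)
    ((contMDiff_AdCLM n (1 : G)).clm_apply contMDiffAt_const)).clm_apply
    ((contMDiff_AdCLM n (1 : G)).clm_apply contMDiffAt_const)).mdifferentiableAt (by simp)

theorem mfderiv_form_AdCLM (g : LinearMap.BilinForm ℝ 𝔼) (X Y v : 𝔼) :
    (mfderiv (𝓡 n) 𝓘(ℝ, ℝ) (fun a : G => g (AdCLM n a X) (AdCLM n a Y)) 1 : 𝔼 →L[ℝ] ℝ) v
      = g (modelBracket n G v X) Y + g X (modelBracket n G v Y) := by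
  let A (w : 𝔼) : 𝔼 →L[ℝ] 𝔼 := mfderiv (𝓡 n) 𝓘(ℝ, 𝔼) (fun a : G => AdCLM n a w) 1
  have hA (w : 𝔼) : HasMFDerivAt (𝓡 n) 𝓘(ℝ, 𝔼) (fun a : G => AdCLM n a w) 1 (A w) :=
    (mdifferentiableAt_AdCLM_apply w).hasMFDerivAt
  have hpair : HasMFDerivAt (𝓡 n) 𝓘(ℝ, 𝔼 × 𝔼) (fun a : G => (AdCLM n a X, AdCLM n a Y)) 1
      ((A X).prod (A Y)) :=
    ⟨(hA X).1.prodMk (hA Y).1, (hA X).2.prodMk (hA Y).2⟩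
  have hg := ((LinearMap.toContinuousBilinearMap g).isBoundedBilinearMap.hasFDerivAt
    (AdCLM n (1 : G) X, AdCLM n (1 : G) Y)).hasMFDerivAt
  refine (DFunLike.congr_fun (HasMFDerivAt.comp (1 : G) hg hpair).mfderiv v).trans ?_
  change g (AdCLM n (1 : G) X) (A Y v) + g (A X v) (AdCLM n (1 : G) Y) = _
  rw [show A X v = _ from mfderiv_AdCLM_apply v X, show A Y v = _ from mfderiv_AdCLM_apply v Y,
    AdCLM_one, add_comm]
  rfl

theorem hasDerivAt_AdCLM_curve {γ : ℝ → G} (hγ : ContMDiff 𝓘(ℝ, ℝ) (𝓡 n) ∞ γ) (hγ0 : γ 0 = 1)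
    (Y : 𝔼) :
    HasDerivAt (fun t => AdCLM n (γ t) Y) (modelBracket n G (velocity n γ) Y) 0 := by
  rw [← mfderiv_AdCLM_apply]
  exact hasDerivAt_comp_curve hγ hγ0 (mdifferentiableAt_AdCLM_apply Y)

theorem mem_of_hasDerivAt {E : Type*} [NormedAddCommGroup E] [NormedSpace ℝ E]
    {W : Submodule ℝ E} (hW : IsClosed (W : Set E)) {f : ℝ → E} {f' : E} {t : ℝ}
    (hf : ∀ s, f s ∈ W) (h : HasDerivAt f f' t) : f' ∈ W :=
  hW.mem_of_tendsto (hasDerivAt_iff_tendsto_slope_zero.1 h) (.of_forall fun _ =>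
    W.smul_mem _ (W.sub_mem (hf _) (hf _)))

theorem lie_mem_of_Ad_invariant {K : Subgroup G} {W : Submodule ℝ (GroupLieAlgebra (𝓡 n) G)}
    (hW : ∀ a ∈ K, ∀ X ∈ W, Ad a X ∈ W) {Z : GroupLieAlgebra (𝓡 n) G}
    (hZ : Z ∈ isotropyAlgebra n K) : ∀ X ∈ W, ⁅Z, X⁆ ∈ W := by
  refine lie_mem_of_mem_lieSpan ?_ hZ
  rintro _ ⟨γ, hγ, hγ0, hK, rfl⟩ X hX
  let V : Submodule ℝ 𝔼 := W
  exact mem_of_hasDerivAt (E := 𝔼) (W := V) V.closed_of_finiteDimensional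
    (fun t => hW _ (hK t) X hX) (hasDerivAt_AdCLM_curve hγ hγ0 X)

theorem form_lie_of_Ad_invariant {K : Subgroup G} {W : Submodule ℝ (GroupLieAlgebra (𝓡 n) G)}
    {g : LinearMap.BilinForm ℝ (GroupLieAlgebra (𝓡 n) G)}
    (hW : ∀ a ∈ K, ∀ X ∈ W, Ad a X ∈ W)
    (hg : ∀ a ∈ K, ∀ X ∈ W, ∀ Y ∈ W, g (Ad a X) (Ad a Y) = g X Y)
    {Z : GroupLieAlgebra (𝓡 n) G} (hZ : Z ∈ isotropyAlgebra n K) :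
    ∀ X ∈ W, ∀ Y ∈ W, g ⁅Z, X⁆ Y + g X ⁅Z, Y⁆ = 0 := by
  refine form_lie_of_mem_lieSpan (fun Z hZ => lie_mem_of_Ad_invariant hW
    (LieSubalgebra.subset_lieSpan hZ)) ?_ hZ
  rintro _ ⟨γ, hγ, hγ0, hK, rfl⟩ X hX Y hY
  have hderiv := hasDerivAt_comp_curve hγ hγ0 (mdifferentiableAt_form_AdCLM g X Y)
  have hconst : (fun t => g (AdCLM n (γ t) X) (AdCLM n (γ t) Y)) = fun _ => g X Y :=
    funext fun t => hg _ (hK t) X hX Y hY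
  exact (mfderiv_form_AdCLM g X Y _).symm.trans
    (hderiv.unique (hconst ▸ hasDerivAt_const (0 : ℝ) (g X Y)))

theorem form_lie_of_Ad_invariant_univ {g : LinearMap.BilinForm ℝ (GroupLieAlgebra (𝓡 n) G)}
    (hg : ∀ (a : G) X Y, g (Ad a X) (Ad a Y) = g X Y) (Z X Y : GroupLieAlgebra (𝓡 n) G) :
    g ⁅Z, X⁆ Y + g X ⁅Z, Y⁆ = 0 := by
  have hconst := (mdifferentiableAt_form_AdCLM (G := G) g X Y).hasMFDerivAt.congr_of_eventuallyEq
    (f₁ := fun _ => g X Y) (.of_forall fun a => (hg a X Y).symm)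
  exact (mfderiv_form_AdCLM (G := G) g X Y Z).symm.trans (DFunLike.congr_fun
    (hasMFDerivAt_unique hconst (hasMFDerivAt_const (g X Y : ℝ) (1 : G))) Z)

theorem Ad_mem_tangentVectors {K : Subgroup G} {a : G} (ha : a ∈ K)
    {X : GroupLieAlgebra (𝓡 n) G} (hX : X ∈ tangentVectors n K) : Ad a X ∈ tangentVectors n K := by
  obtain ⟨γ, hγ, hγ0, hK, rfl⟩ := hX
  refine ⟨fun t => a * γ t * a⁻¹, (contMDiff_conj n a).comp hγ, by simp [hγ0],
    fun t => K.mul_mem (K.mul_mem ha (hK t)) (K.inv_mem ha), ?_⟩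
  have hconj := hasMFDerivAt_conj (n := n) a
  rw [← hγ0] at hconj
  exact DFunLike.congr_fun
    (hconj.comp (0 : ℝ) ((hγ.mdifferentiableAt (by simp)).hasMFDerivAt)).mfderiv (1 : ℝ)

/-- `Ad a` as an endomorphism of the Lie algebra of `G`. -/
def adLieHom (a : G) : GroupLieAlgebra (𝓡 n) G →ₗ⁅ℝ⁆ GroupLieAlgebra (𝓡 n) G :=
  { Ad a with map_lie' := fun {X Y} => Ad_lie a X Y }

theorem Ad_mem_isotropyAlgebra {K : Subgroup G} {a : G} (ha : a ∈ K)
    {X : GroupLieAlgebra (𝓡 n) G} (hX : X ∈ isotropyAlgebra n K) :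
    Ad a X ∈ isotropyAlgebra n K := by
  have h : isotropyAlgebra n K ≤ (isotropyAlgebra n K).comap (adLieHom a) :=
    LieSubalgebra.lieSpan_le.2 fun X hX =>
      LieSubalgebra.subset_lieSpan (Ad_mem_tangentVectors ha hX)
  exact h hX

theorem exists_Ad_invariant_isScalarProduct [CompactSpace G] :
    ∃ B : LinearMap.BilinForm ℝ (GroupLieAlgebra (𝓡 n) G), IsScalarProduct B ∧
      ∀ (a : G) X Y, B (Ad a X) (Ad a Y) = B X Y := by
  have := topologicalGroup_of_lieGroup (𝓡 n) ∞ (G := G)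
  exact exists_invariant_isScalarProduct (E := 𝔼) (adjointRep n G) continuous_AdCLM_apply

end AdjointRepresentation

section HorizontalSubalgebra

variable {L : Type*} [LieRing L] [LieAlgebra ℝ L] {k : LieSubalgebra ℝ L} {p : Submodule ℝ L}
variable {B : LinearMap.BilinForm ℝ L} {φ : p →ₗ[ℝ] L} {W : Submodule ℝ p}

theorem sub_lift_prP_mem (hφ : IsHorizontalLift k B φ) (hkp : IsCompl k.toSubmodule p) (U : L) :
    U - φ (prP hkp U) ∈ k := by
  rw [← prP_eq_zero_iff hkp, map_sub, hφ.prP, sub_self]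

theorem prP_lie_mem (hφ : IsHorizontalLift k B φ) (hkp : IsCompl k.toSubmodule p)
    (hk : ∀ Z ∈ k, ∀ X ∈ W, adP hkp Z X ∈ W)
    (hW : ∀ X ∈ W, ∀ Y ∈ W, liftBracketP hkp φ X Y ∈ W) {U V : L} (hU : prP hkp U ∈ W)
    (hV : prP hkp V ∈ W) : prP hkp ⁅U, V⁆ ∈ W := by
  have hkU := sub_lift_prP_mem hφ hkp U
  have hkV := sub_lift_prP_mem hφ hkp V
  have hsplit : ⁅U, V⁆ = ⁅φ (prP hkp U), φ (prP hkp V)⁆ + ⁅U - φ (prP hkp U), V⁆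
      - ⁅V - φ (prP hkp V), φ (prP hkp U)⁆ := by
    rw [← lie_skew (V - φ (prP hkp V)) (φ (prP hkp U))]
    simp only [sub_lie, lie_sub]
    abel
  rw [hsplit, map_sub, map_add, prP_lie hkp hkU, prP_lie hkp hkV, hφ.prP]
  exact W.sub_mem (W.add_mem (hW _ hU _ hV) (hk _ hkU _ hV)) (hk _ hkV _ hU)

end HorizontalSubalgebra

section Rescaling

variable {L : Type*} [LieRing L] [LieAlgebra ℝ L] {k : LieSubalgebra ℝ L} {p : Submodule ℝ L}

theorem isHRF_diagForm_iff (hkp : IsCompl k.toSubmodule p) {p₁ p₂ : Submodule ℝ p}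
    (h : IsCompl p₁ p₂) {Q : LinearMap.BilinForm ℝ p} {q₁ q₂ : ℝ} (hq₁ : 0 < q₁) (hq₂ : 0 < q₂)
    {x₁ x₂ : ℝ → ℝ} {J : Set ℝ} :
    IsHRF hkp h (diagForm h Q q₁ q₂) x₁ x₂ J ↔
      IsHRF hkp h Q (fun t => q₁ * x₁ t) (fun t => q₂ * x₂ t) J := by
  have hflow : (fun t => diagForm h (diagForm h Q q₁ q₂) (x₁ t) (x₂ t))
      = fun t => diagForm h Q (q₁ * x₁ t) (q₂ * x₂ t) :=
    funext fun t => diagForm_diagForm h Q q₁ q₂ (x₁ t) (x₂ t)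
  refine ⟨fun H => ⟨fun t ht => mul_pos hq₁ (H.pos₁ t ht), fun t ht => mul_pos hq₂ (H.pos₂ t ht),
    hflow ▸ H.flow⟩, fun H => ⟨fun t ht => pos_of_mul_pos_right (H.pos₁ t ht) hq₁.le,
    fun t ht => pos_of_mul_pos_right (H.pos₂ t ht) hq₂.le, hflow ▸ H.flow⟩⟩

end Rescaling

section Isotropy

variable {n : ℕ} {G : Type*} [TopologicalSpace G] [ChartedSpace (EuclideanSpace ℝ (Fin n)) G]
  [Group G] [LieGroup (𝓡 n) ∞ G] {K : Subgroup G} {p : Submodule ℝ (GroupLieAlgebra (𝓡 n) G)}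

/-- The isotropy representation of `K` on an `Ad(K)`-invariant complement `p`, as the
subrepresentation `p` of the adjoint representation restricted to `K`. -/
def isotropyRepresentation (hp : ∀ a ∈ K, ∀ X ∈ p, Ad a X ∈ p) : Representation ℝ K p :=
  Subrepresentation.toRepresentation (ρ := (adjointRep n G).comp K.subtype)
    ⟨p, fun a X hX => hp a a.2 X hX⟩

theorem preservesSplitting_isotropyRepresentation (hp : ∀ a ∈ K, ∀ X ∈ p, Ad a X ∈ p) (a : K) :
    PreservesSplitting (isotropyAlgebra n K) (adLieHom (a : G))
      (LinearEquiv.ofBijective (isotropyRepresentation hp a)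
        ((isotropyRepresentation hp).apply_bijective a)) :=
  ⟨fun _ => Ad_mem_isotropyAlgebra a.2, fun _ => rfl⟩

variable {hp : ∀ a ∈ K, ∀ X ∈ p, Ad a X ∈ p}

theorem coe_isotropyRepresentation (a : K) (X : p) :
    (isotropyRepresentation hp a X : GroupLieAlgebra (𝓡 n) G) = Ad (a : G) X := rfl

variable {hkp : IsCompl (isotropyAlgebra n K).toSubmodule p}

theorem isotropyRep_eq (hp : ∀ a ∈ K, ∀ X ∈ p, Ad a X ∈ p) (a : K) :
    isotropyRep hkp a = isotropyRepresentation hp a :=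
  LinearMap.ext fun X => prP_of_mem_p hkp (isotropyRepresentation hp a X)

theorem prP_Ad (hp : ∀ a ∈ K, ∀ X ∈ p, Ad a X ∈ p) (a : K) (U : GroupLieAlgebra (𝓡 n) G) :
    prP hkp (Ad (a : G) U) = isotropyRepresentation hp a (prP hkp U) :=
  (preservesSplitting_isotropyRepresentation hp a).prP hkp U

theorem IsInvariantPairing.isAdInvariant {g : LinearMap.BilinForm ℝ p}
    (hg : IsInvariantPairing (isotropyRepresentation hp) (isotropyRepresentation hp) g) :
    IsAdInvariant hkp g := fun Z hZ X Y => by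
  have h := form_lie_of_Ad_invariant (g := g.compl₁₂ (prP hkp) (prP hkp)) hp
    (fun a ha X _ Y _ => by
      rw [LinearMap.compl₁₂_apply, LinearMap.compl₁₂_apply, prP_Ad hp ⟨a, ha⟩, prP_Ad hp ⟨a, ha⟩,
        hg]) hZ X X.2 Y Y.2
  simpa only [LinearMap.compl₁₂_apply, prP_of_mem_p, ← adP_apply] using h

theorem IsInvariantPairing.ricci {g : LinearMap.BilinForm ℝ p} (hg : IsScalarProduct g)
    (hgi : IsInvariantPairing (isotropyRepresentation hp) (isotropyRepresentation hp) g) :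
    IsInvariantPairing (isotropyRepresentation hp) (isotropyRepresentation hp) (ricci hkp g) :=
  fun a => (preservesSplitting_isotropyRepresentation hp a).ricci hkp hg (hgi a)

variable {B : LinearMap.BilinForm ℝ (GroupLieAlgebra (𝓡 n) G)}
  {φ : p →ₗ[ℝ] GroupLieAlgebra (𝓡 n) G}

theorem IsHorizontalLift.apply_isotropyRepresentation (hB : IsScalarProduct B)
    (hBG : ∀ (a : G) X Y, B (Ad a X) (Ad a Y) = B X Y)
    (hφ : IsHorizontalLift (isotropyAlgebra n K) B φ) (a : K) (X : p) :
    φ (isotropyRepresentation hp a X) = Ad (a : G) (φ X) := by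
  refine (hφ.eq hB ?_ fun Z hZ => ?_).symm
  · rw [coe_isotropyRepresentation, ← map_sub]
    exact Ad_mem_isotropyAlgebra a.2 (hφ.sub_mem X)
  · rw [← hBG (a : G)⁻¹, Ad_inv_Ad]
    exact hφ.orthogonal _ _ (Ad_mem_isotropyAlgebra (K.inv_mem a.2) hZ)

theorem isInvariantPairing_liftForm (hB : IsScalarProduct B)
    (hBG : ∀ (a : G) X Y, B (Ad a X) (Ad a Y) = B X Y)
    (hφ : IsHorizontalLift (isotropyAlgebra n K) B φ) :
    IsInvariantPairing (isotropyRepresentation hp) (isotropyRepresentation hp) (liftForm B φ) :=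
  fun a X Y => by
    rw [liftForm_apply, liftForm_apply, hφ.apply_isotropyRepresentation hB hBG,
      hφ.apply_isotropyRepresentation hB hBG, hBG]

theorem adP_mem_of_subrepresentation (W : Subrepresentation (isotropyRepresentation hp))
    {Z : GroupLieAlgebra (𝓡 n) G} (hZ : Z ∈ isotropyAlgebra n K) {X : p}
    (hX : X ∈ W.toSubmodule) : adP hkp Z X ∈ W.toSubmodule := by
  obtain ⟨Y, hY, hYZ⟩ := lie_mem_of_Ad_invariant (W := W.toSubmodule.map p.subtype) (K := K) (by
    rintro a ha _ ⟨X, hX, rfl⟩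
    exact ⟨_, W.apply_mem_toSubmodule ⟨a, ha⟩ hX, rfl⟩) hZ X ⟨X, hX, rfl⟩
  rw [adP_apply, ← hYZ]
  exact (prP_of_mem_p hkp Y).symm ▸ hY

/- The preimage of `W` in the Lie algebra of `G` is an `Ad(K)`-invariant subspace between `k` and
the whole Lie algebra; it would be a subalgebra if `W` were closed under the bracket. -/
theorem not_forall_liftBracketP_mem (hmax : IsMaximalIsotropy n K)
    (hφ : IsHorizontalLift (isotropyAlgebra n K) B φ)
    (W : Subrepresentation (isotropyRepresentation hp)) (hb : W.toSubmodule ≠ ⊥)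
    (ht : W.toSubmodule ≠ ⊤) :
    ¬ ∀ X ∈ W.toSubmodule, ∀ Y ∈ W.toSubmodule, liftBracketP hkp φ X Y ∈ W.toSubmodule := by
  intro hW
  let H : LieSubalgebra ℝ (GroupLieAlgebra (𝓡 n) G) :=
    { W.toSubmodule.comap (prP hkp) with
      lie_mem' := prP_lie_mem hφ hkp (fun _ hZ _ => adP_mem_of_subrepresentation W hZ) hW }
  have hH : ∀ U, U ∈ H ↔ prP hkp U ∈ W.toSubmodule := fun U => Iff.rfl
  have hk : isotropyAlgebra n K ≤ H := fun U hU => by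
    rw [hH, prP_of_mem_k hkp hU]
    exact W.toSubmodule.zero_mem
  have hAd : ∀ a ∈ K, ∀ U ∈ H, Ad a U ∈ H := fun a ha U hU => by
    rw [hH, prP_Ad hp ⟨a, ha⟩]
    exact W.apply_mem_toSubmodule ⟨a, ha⟩ hU
  rcases hmax H hk hAd with h | h
  · refine hb (eq_bot_iff.2 fun X hX => ?_)
    have hXH : (X : GroupLieAlgebra (𝓡 n) G) ∈ H := by rwa [hH, prP_of_mem_p]
    rwa [h, ← prP_eq_zero_iff hkp, prP_of_mem_p] at hXH
  · refine ht (eq_top_iff.2 fun X _ => ?_)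
    rw [← prP_of_mem_p hkp X, ← hH, h]
    trivial

section Summand

variable {W : Submodule ℝ p}

/-- An irreducible summand as a subrepresentation of the isotropy representation. -/
def IsIrreducibleSummand.toSubrepresentation (hp : ∀ a ∈ K, ∀ X ∈ p, Ad a X ∈ p)
    (hW : IsIrreducibleSummand hkp W) : Subrepresentation (isotropyRepresentation hp) :=
  ⟨W, fun a X hX => isotropyRep_eq (hkp := hkp) hp a ▸ hW.invariant a a.2 X hX⟩

theorem IsIrreducibleSummand.isIrreducible (hW : IsIrreducibleSummand hkp W) :
    (hW.toSubrepresentation hp).toRepresentation.IsIrreducible where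
  exists_pair_ne := by
    have : Nontrivial W := Submodule.nontrivial_iff_ne_bot.2 hW.ne_bot
    exact ⟨⊥, ⊤, fun h => (bot_ne_top : (⊥ : Submodule ℝ W) ≠ ⊤)
      (congrArg Subrepresentation.toSubmodule h)⟩
  eq_bot_or_eq_top U := by
    have hU : IsInvariant hkp (U.toSubmodule.map W.subtype) := by
      rintro a ha _ ⟨X, hX, rfl⟩
      rw [isotropyRep_eq hp ⟨a, ha⟩]
      exact ⟨_, U.apply_mem_toSubmodule ⟨a, ha⟩ hX, rfl⟩
    refine (hW.irreducible _ (Submodule.map_subtype_le W _) hU).imp (fun h => ?_) fun h => ?_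
    · exact Subrepresentation.toSubmodule_injective <|
        Submodule.map_injective_of_injective W.injective_subtype <|
          h.trans (Submodule.map_bot _).symm
    · exact Subrepresentation.toSubmodule_injective <|
        Submodule.map_injective_of_injective W.injective_subtype <|
          h.trans (Submodule.map_subtype_top W).symm

end Summand

namespace IsTwoSummandSplitting

variable {p₁ p₂ : Submodule ℝ p}

theorem isEmpty_equiv (hs : IsTwoSummandSplitting hkp p₁ p₂) :
    IsEmpty ((hs.irreducible₁.toSubrepresentation hs.reductive).toRepresentation.Equiv
      (hs.irreducible₂.toSubrepresentation hs.reductive).toRepresentation) := by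
  refine ⟨fun φ => hs.inequivalent ⟨φ.toLinearEquiv, fun a ha X Y hXY => ?_⟩⟩
  rw [isotropyRep_eq hs.reductive ⟨a, ha⟩] at hXY ⊢
  obtain rfl : Y = (hs.irreducible₁.toSubrepresentation hs.reductive).toRepresentation ⟨a, ha⟩ X :=
    Subtype.ext hXY
  exact congrArg Subtype.val (φ.toIntertwiningMap.isIntertwining _ _ _ X)

variable {Q S : LinearMap.BilinForm ℝ p}

theorem apply_eq_zero (hs : IsTwoSummandSplitting hkp p₁ p₂) (hQ : IsScalarProduct Q)
    (hQi : IsInvariantPairing (isotropyRepresentation hs.reductive)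
      (isotropyRepresentation hs.reductive) Q) : ∀ X ∈ p₁, ∀ Y ∈ p₂, Q X Y = 0 := by
  have := hs.irreducible₁.isIrreducible (hp := hs.reductive)
  have := hs.irreducible₂.isIrreducible (hp := hs.reductive)
  have := hs.isEmpty_equiv
  exact fun X hX Y hY => hQi.apply_eq_zero hQ hQi
    (W₁ := hs.irreducible₁.toSubrepresentation hs.reductive)
    (W₂ := hs.irreducible₂.toSubrepresentation hs.reductive) hX hY

theorem exists_eq_diagForm (hs : IsTwoSummandSplitting hkp p₁ p₂) (hQ : IsScalarProduct Q)
    (hQi : IsInvariantPairing (isotropyRepresentation hs.reductive)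
      (isotropyRepresentation hs.reductive) Q) (hS : ∀ X Y, S X Y = S Y X)
    (hSi : IsInvariantPairing (isotropyRepresentation hs.reductive)
      (isotropyRepresentation hs.reductive) S) :
    ∃ c₁ c₂ : ℝ, S = diagForm hs.isCompl Q c₁ c₂ := by
  have := hs.irreducible₁.isIrreducible (hp := hs.reductive)
  have := hs.irreducible₂.isIrreducible (hp := hs.reductive)
  have := hs.isEmpty_equiv
  exact hSi.exists_eq_diagForm (W₁ := hs.irreducible₁.toSubrepresentation hs.reductive)
    (W₂ := hs.irreducible₂.toSubrepresentation hs.reductive) hs.isCompl hS hQ hQi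

theorem isInvariantPairing_diagForm (hs : IsTwoSummandSplitting hkp p₁ p₂)
    (hQi : IsInvariantPairing (isotropyRepresentation hs.reductive)
      (isotropyRepresentation hs.reductive) Q) (x y : ℝ) :
    IsInvariantPairing (isotropyRepresentation hs.reductive) (isotropyRepresentation hs.reductive)
      (diagForm hs.isCompl Q x y) :=
  hQi.diagForm (W₁ := hs.irreducible₁.toSubrepresentation hs.reductive)
    (W₂ := hs.irreducible₂.toSubrepresentation hs.reductive) hs.isCompl x y

theorem exists_ricciData_liftForm (hs : IsTwoSummandSplitting hkp p₁ p₂)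
    (hmax : IsMaximalIsotropy n K) (hB : IsScalarProduct B)
    (hBG : ∀ (a : G) X Y, B (Ad a X) (Ad a Y) = B X Y)
    (hφ : IsHorizontalLift (isotropyAlgebra n K) B φ) :
    ∃ P : RicciData, P.d₁ = Module.finrank ℝ p₁ ∧ P.d₂ = Module.finrank ℝ p₂ ∧
      ∀ x y, 0 < x → 0 < y → ricci hkp (diagForm hs.isCompl (liftForm B φ) x y)
        = diagForm hs.isCompl (liftForm B φ) (P.r₁ x y) (P.r₂ x y) := by
  have hQ := isScalarProduct_liftForm hφ hB hkp
  have hQi := isInvariantPairing_liftForm (hp := hs.reductive) hB hBG hφ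
  have hgi := hs.isInvariantPairing_diagForm hQi
  have hp₁ := hs.irreducible₁.ne_bot
  have hp₂ := hs.irreducible₂.ne_bot
  refine exists_ricciData hφ hB (form_lie_of_Ad_invariant_univ hBG) hkp hs.isCompl
    (hs.apply_eq_zero hQ hQi) (fun x y => (hgi x y).isAdInvariant) (fun x y hx hy => ?_) hp₁ hp₂
    (not_forall_liftBracketP_mem hmax hφ (hs.irreducible₁.toSubrepresentation hs.reductive) hp₁
      fun h => hp₂ ?_)
    (not_forall_liftBracketP_mem hmax hφ (hs.irreducible₂.toSubrepresentation hs.reductive) hp₂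
      fun h => hp₁ ?_)
  · have hg := isScalarProduct_diagForm hs.isCompl hQ hx hy
    exact hs.exists_eq_diagForm hQ hQi (ricci_symm hkp hg (hgi x y).isAdInvariant)
      ((hgi x y).ricci hg)
  · exact eq_bot_of_top_isCompl (h ▸ hs.isCompl : IsCompl ⊤ p₂)
  · exact eq_bot_of_isCompl_top (h ▸ hs.isCompl : IsCompl p₁ ⊤)

theorem exists_ricciData [CompactSpace G] (hs : IsTwoSummandSplitting hkp p₁ p₂)
    (hmax : IsMaximalIsotropy n K) (hQ : IsInvariantScalarProduct hkp Q) :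
    ∃ (P : RicciData) (q₁ q₂ : ℝ), 0 < q₁ ∧ 0 < q₂ ∧
      (∀ (x₁ x₂ : ℝ → ℝ) (J : Set ℝ), IsHRF hkp hs.isCompl Q x₁ x₂ J ↔
        P.IsSol (fun t => q₁ * x₁ t) (fun t => q₂ * x₂ t) J) ∧
      ∀ x y, 0 < x → 0 < y →
        scalarCurvature hkp (diagForm hs.isCompl Q x y) = P.scal (q₁ * x) (q₂ * y) := by
  obtain ⟨B, hB, hBG⟩ := exists_Ad_invariant_isScalarProduct (n := n) (G := G)
  obtain ⟨φ, hφ⟩ := exists_isHorizontalLift (isotropyAlgebra n K) p hB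
  have hQ₀ := isScalarProduct_liftForm hφ hB hkp
  have hp₁ := hs.irreducible₁.ne_bot
  have hp₂ := hs.irreducible₂.ne_bot
  obtain ⟨P, hd₁, hd₂, hP⟩ := hs.exists_ricciData_liftForm hmax hB hBG hφ
  obtain ⟨q₁, q₂, rfl⟩ := hs.exists_eq_diagForm hQ₀
    (isInvariantPairing_liftForm hB hBG hφ) hQ.scalarProduct.symm fun a X Y => by
      rw [← isotropyRep_eq (hkp := hkp)]
      exact hQ.invariant a a.2 X Y
  have hq₁ := pos_of_isScalarProduct_diagForm hs.isCompl hQ₀ hQ.scalarProduct hp₁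
  have hq₂ := pos_of_isScalarProduct_diagForm hs.isCompl.symm hQ₀
    (diagForm_comm hs.isCompl (liftForm B φ) q₁ q₂ ▸ hQ.scalarProduct) hp₂
  refine ⟨P, q₁, q₂, hq₁, hq₂, fun x₁ x₂ J => ?_, fun x y hx hy => ?_⟩
  · rw [← isHRF_iff hkp hs.isCompl hQ₀ hp₁ hp₂ hP]
    exact isHRF_diagForm_iff hkp hs.isCompl hq₁ hq₂
  · rw [diagForm_diagForm, scalarCurvature_diagForm hkp hs.isCompl hQ₀ (mul_pos hq₁ hx)
      (mul_pos hq₂ hy) (hP _ _ (mul_pos hq₁ hx) (mul_pos hq₂ hy)), RicciData.scal, hd₁, hd₂]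

end IsTwoSummandSplitting

end Isotropy

end HomRicci

end

theorem mainTheorem12 {n : ℕ} {G : Type*} [TopologicalSpace G]
    [ChartedSpace (EuclideanSpace ℝ (Fin n)) G] [Group G] [LieGroup (𝓡 n) ∞ G]
    [CompactSpace G] [T2Space G] (K : Subgroup G) (hK : IsClosed (K : Set G))
    (p : Submodule ℝ (GroupLieAlgebra (𝓡 n) G))
    (hkp : IsCompl (HomRicci.isotropyAlgebra n K).toSubmodule p)
    (p₁ p₂ : Submodule ℝ p) (hsplit : HomRicci.IsTwoSummandSplitting hkp p₁ p₂)
    (hmax : HomRicci.IsMaximalIsotropy n K)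
    (Q : LinearMap.BilinForm ℝ p) (hQ : HomRicci.IsInvariantScalarProduct hkp Q) :
    (∀ (J : Set ℝ) (x₁ x₂ : ℝ → ℝ), J.OrdConnected → J.Nontrivial →
      HomRicci.IsHRF hkp hsplit.isCompl Q x₁ x₂ J →
      ∀ t ∈ J, derivWithin x₁ J t < 0 → derivWithin x₂ J t < 0 →
        0 < HomRicci.scalarCurvature hkp
          (HomRicci.diagForm hsplit.isCompl Q (x₁ t) (x₂ t))) ∧
    (∀ (T : EReal) (x₁ x₂ : ℝ → ℝ),
      HomRicci.IsMaximalHRF hkp hsplit.isCompl Q x₁ x₂ T →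
      HomRicci.scalarCurvature hkp
          (HomRicci.diagForm hsplit.isCompl Q (x₁ 0) (x₂ 0)) < 0 →
      ∃ t₁ : ℝ, 0 < t₁ ∧ (t₁ : EReal) < T ∧ ∀ t : ℝ, t₁ ≤ t → (t : EReal) < T →
        0 < HomRicci.scalarCurvature hkp
          (HomRicci.diagForm hsplit.isCompl Q (x₁ t) (x₂ t))) := by
  obtain ⟨P, q₁, q₂, hq₁, hq₂, hsol, hscal⟩ := hsplit.exists_ricciData hmax hQ
  refine ⟨fun J x₁ x₂ hJ hJn hf t ht hd₁ hd₂ => ?_, fun T x₁ x₂ hf h0 => ?_⟩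
  · have hu : UniqueDiffWithinAt ℝ J t := uniqueDiffWithinAt_convex hJ.convex
      (hJ.convex.nontrivial_iff_nonempty_interior.1 hJn) (subset_closure ht)
    rw [hscal _ _ (hf.pos₁ t ht) (hf.pos₂ t ht)]
    refine ((hsol _ _ _).1 hf).scal_pos_of_derivWithin_neg ht hu ?_ ?_
    · simpa only [derivWithin_const_mul_field] using mul_neg_of_pos_of_neg hq₁ hd₁
    · simpa only [derivWithin_const_mul_field] using mul_neg_of_pos_of_neg hq₂ hd₂
  · have hscal' : ∀ t ∈ HomRicci.timeInterval T, HomRicci.scalarCurvature hkp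
        (HomRicci.diagForm hsplit.isCompl Q (x₁ t) (x₂ t)) = P.scal (q₁ * x₁ t) (q₂ * x₂ t) :=
      fun t ht => hscal _ _ (hf.isHRF.pos₁ t ht) (hf.isHRF.pos₂ t ht)
    rw [hscal' 0 (HomRicci.zero_mem_timeInterval hf.pos)] at h0
    obtain ⟨t₁, ht₁, ht₁T, hpos⟩ := ((hsol _ _ _).1 hf.isHRF).exists_forall_scal_pos hf.pos
      (fun T' hT' y₁ y₂ hy heq => hf.maximal T' hT' (fun t => y₁ t / q₁) (fun t => y₂ t / q₂)
        ((hsol _ _ _).2 (by simpa only [mul_div_cancel₀ _ hq₁.ne', mul_div_cancel₀ _ hq₂.ne']))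
        ⟨fun t ht => eq_div_of_mul_eq hq₁.ne' ((mul_comm _ _).trans (heq.1 ht)),
          fun t ht => eq_div_of_mul_eq hq₂.ne' ((mul_comm _ _).trans (heq.2 ht))⟩) h0
    refine ⟨t₁, ht₁, ht₁T, fun t ht htT => ?_⟩
    rw [hscal' t ⟨ht₁.le.trans ht, htT⟩]
    exact hpos t ht htT
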